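/- **Conventions.** Let $n\in\mathbb N$, $D=2n$, $\theta\in\mathbb R\setminus\{0\}$, and let $\Theta=\theta\,\Sigma$, where $\Sigma=\mathrm{diag}(J_2,\dots,J_2)$ is the $D\times D$ block-diagonal matrix with $n$ blocks $J_2=\begin{pmatrix}0&-1\\1&0\end{pmatrix}$. For Schwartz functions on $\mathbb R^D$ put $$(a\star b)(x)=\frac1{(\pi\theta)^{D}}\int\!\!\int a(x+y)\,b(x+z)\,e^{-2i\,y\Theta^{-1}z}\,dy\,dz .$$ For $T\in\mathcal S'$, $a,b\in\mathcal S$ set $\langle T\star a,b\rangle=\langle T,a\star b\rangle$ and $\langle a\star T,b\rangle=\langle T,b\star a\rangle$. The Moyal algebra $\mathcal M$ is the space of all $T\in\mathcal S'(\mathbb R^D)$ such that $T\star a\in\mathcal S$ and $a\star T\in\mathcal S$ for all $a\in\mathcal S$, with product $\langle S\star T,a\rangle=\langle S,T\star a\rangle$; it is a unital associative algebra which contains the polynomial functions. Put $[a,b]_\star=a\star b-b\star a$, $\{a,b\}_\star=a\star b+b\star a$, $\xi_\mu=-\sum_\nu\Theta^{-1}_{\mu\nu}x_\nu$, and let $\xi_\mu\xi_\nu$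 be the pointwise product. Let $\mathbb A^\bullet=\mathcal M\oplus\mathcal M$, graded by $\mathbb Z_2$ (the first summand has degree $0$, the second degree $1$), with product $(a_0,a_1)(b_0,b_1)=(a_0\star b_0+a_1\star b_1,\;a_0\star b_1+a_1\star b_0)$ and graded bracket $[a,b]_\bullet=ab-(-1)^{|a||b|}ba$, extended bilinearly. Let $\mathrm{Ad}_a(b)=[a,b]_\bullet$. Let $\mathcal G_2^\bullet\subset\mathrm{Der}(\mathbb A^\bullet)$ be the $\mathbb Z_2$-graded Lie subalgebra of all $\mathrm{Ad}_{(P_0,P_1)}$, where $P_0$, $P_1$ are complex polynomial functions of degrees at most $2$ and at most $1$; it contains $\mathrm{Ad}_a$ for $$T_\mu=(i\xi_\mu,0),\quad U_\mu=(0,i\xi_\mu),\quad M_{\mu\nu}=(i\xi_\mu\xi_\nu,0),\quad J=(0,i).$$ A $1$-form of degree $0$ (of the restricted differential calculus based on $\mathcal G_2^\bullet$) is a linear map $\omega:\mathcal G_2^\bullet\to\mathbb A^\bullet$ of degree $0$. It defines the connection $\nabla_X(a)=X(a)+\omega(X)a$, whose curvature is the $2$-form $F=\hat d\omega+\omega\omega$,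 i.e., for homogeneous $X$, $Y$, $$F(X,Y)=X(\omega(Y))-(-1)^{|X||Y|}Y(\omega(X))-\omega([X,Y]_\bullet)+\omega(X)\omega(Y)-(-1)^{|X||Y|}\omega(Y)\omega(X).$$ Let $\eta$ be the $1$-form $\eta(\mathrm{Ad}_{(P_0,P_1)})=(P_0-P_0(0),P_1)$. **Statement.** Let $A$ be any $1$-form of degree $0$, and consider the connection $\nabla_X(a)=X(a)-iA(X)a$, i.e. the one with $\omega=-iA$, and its curvature $F$. 1. For homogeneous $X,Y\in\mathcal G_2^\bullet$ and all $a\in\mathbb A^\bullet$: $F(X,Y)\,a=\big([\nabla_X,\nabla_Y]_\bullet-\nabla_{[X,Y]_\bullet}\big)(a)$. 2. $A(\mathrm{Ad}_{T_\mu})=(A^0_\mu,0)$, $A(\mathrm{Ad}_{U_\mu})=(0,A^1_\mu)$, $A(\mathrm{Ad}_{M_{\mu\nu}})=(G^0_{\mu\nu},0)$, $A(\mathrm{Ad}_J)=(0,\varphi)$ for (unique) elements $A^0_\mu,A^1_\mu,G^0_{\mu\nu},\varphi$ of $\mathcal M$. With the covariant coordinates $$\mathcal A^0_\mu=A^0_\mu-\xi_\mu,\quad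 \mathcal A^1_\mu=A^1_\mu-\xi_\mu,\quad \mathcal G^0_{\mu\nu}=G^0_{\mu\nu}-\xi_\mu\xi_\nu,\quad \Phi=\varphi-1,$$ the tensor $1$-form $\mathcal A=-iA+\eta$ has the components $\mathcal A(\mathrm{Ad}_{T_\mu})=-i(\mathcal A^0_\mu,0)$, $\mathcal A(\mathrm{Ad}_{U_\mu})=-i(0,\mathcal A^1_\mu)$, $\mathcal A(\mathrm{Ad}_{M_{\mu\nu}})=-i(\mathcal G^0_{\mu\nu},0)$, $\mathcal A(\mathrm{Ad}_J)=-i(0,\Phi)$. 3. For all $\mu,\nu,\rho,\sigma$, the components of the curvature are $$\begin{aligned} F(\mathrm{Ad}_{T_\mu},\mathrm{Ad}_{T_\nu})&=(-[\mathcal A^0_\mu,\mathcal A^0_\nu]_\star-i\Theta^{-1}_{\mu\nu},\,0),\\ F(\mathrm{Ad}_{U_\mu},\mathrm{Ad}_{U_\nu})&=(-\{\mathcal A^1_\mu,\mathcal A^1_\nu\}_\star-2\mathcal G^0_{\mu\nu},\,0),\\ F(\mathrm{Ad}_J,\mathrm{Ad}_J)&=(-2\Phi\star\Phi+2,\,0),\\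 F(\mathrm{Ad}_{T_\mu},\mathrm{Ad}_J)&=(0,\,-[\mathcal A^0_\mu,\Phi]_\star),\\ F(\mathrm{Ad}_{U_\mu},\mathrm{Ad}_J)&=(-\{\mathcal A^1_\mu,\Phi\}_\star-2\mathcal A^0_\mu,\,0),\\ F(\mathrm{Ad}_{M_{\mu\nu}},\mathrm{Ad}_J)&=(0,\,-[\mathcal G^0_{\mu\nu},\Phi]_\star),\\ F(\mathrm{Ad}_{T_\mu},\mathrm{Ad}_{U_\nu})&=(0,\,-[\mathcal A^0_\mu,\mathcal A^1_\nu]_\star+i\Theta^{-1}_{\mu\nu}\Phi),\\ F(\mathrm{Ad}_{M_{\mu\nu}},\mathrm{Ad}_{T_\rho})&=(-[\mathcal G^0_{\mu\nu},\mathcal A^0_\rho]_\star+i\Theta^{-1}_{\nu\rho}\mathcal A^0_\mu+i\Theta^{-1}_{\mu\rho}\mathcal A^0_\nu,\,0),\\ F(\mathrm{Ad}_{M_{\mu\nu}},\mathrm{Ad}_{U_\rho})&=(0,\,-[\mathcal G^0_{\mu\nu},\mathcal A^1_\rho]_\star+i\Theta^{-1}_{\nu\rho}\mathcal A^1_\mu+i\Theta^{-1}_{\mu\rho}\mathcal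 A^1_\nu),\\ F(\mathrm{Ad}_{M_{\mu\nu}},\mathrm{Ad}_{M_{\rho\sigma}})&=\big(-[\mathcal G^0_{\mu\nu},\mathcal G^0_{\rho\sigma}]_\star+i(\Theta^{-1}_{\nu\sigma}\mathcal G^0_{\mu\rho}+\Theta^{-1}_{\nu\rho}\mathcal G^0_{\mu\sigma}+\Theta^{-1}_{\mu\sigma}\mathcal G^0_{\nu\rho}+\Theta^{-1}_{\mu\rho}\mathcal G^0_{\nu\sigma}),\,0\big). \end{aligned}$$ -/

import Mathlib

set_option linter.unusedSectionVars false

section MoyalAnalysis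

open SchwartzMap MeasureTheory FourierTransform LineDeriv Filter Topology
open scoped ContDiff

namespace Moyal

section Twisted

variable {E : Type*} [NormedAddCommGroup E] [InnerProductSpace ℝ E] [FiniteDimensional ℝ E]
  [MeasurableSpace E] [BorelSpace E]

/-- The plane wave `x ↦ exp (2πi ⟨T y, x⟩)`. -/
noncomputable def wave (T : E ≃L[ℝ] E) (y x : E) : ℂ :=
  Complex.exp (((2 * Real.pi * inner ℝ (T y) x : ℝ) : ℂ) * Complex.I)

/-- Superposition of translated Schwartz functions times plane waves. -/
noncomputable def twist (T : E ≃L[ℝ] E) (a B : 𝓢(E, ℂ)) (x : E) : ℂ :=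
  ∫ y, a (x + y) * B y * wave T y x

lemma norm_wave (T : E ≃L[ℝ] E) (y x : E) : ‖wave T y x‖ = 1 := by
  unfold wave; exact Complex.norm_exp_ofReal_mul_I _

lemma continuous_wave (T : E ≃L[ℝ] E) : Continuous fun p : E × E => wave T p.1 p.2 := by
  unfold wave
  fun_prop

@[fun_prop]
lemma continuous_wave' {X : Type*} [TopologicalSpace X] (T : E ≃L[ℝ] E) {f g : X → E}
    (hf : Continuous f) (hg : Continuous g) : Continuous fun x => wave T (f x) (g x) :=
  (continuous_wave T).comp (hf.prodMk hg)

/-- Multiplication by the linear function `x ↦ ⟨v, x⟩`. -/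
noncomputable def mulLin (v : E) : 𝓢(E, ℂ) →L[ℂ] 𝓢(E, ℂ) :=
  smulLeftCLM ℂ fun x => ((inner ℝ v x : ℝ) : ℂ)

lemma mulLin_apply (v : E) (a : 𝓢(E, ℂ)) (x : E) :
    mulLin v a x = ((inner ℝ v x : ℝ) : ℂ) * a x := by
  unfold mulLin
  rw [smulLeftCLM_apply_apply, smul_eq_mul]
  exact Function.HasTemperateGrowth.comp (g := Complex.ofReal) (by fun_prop)
    (Function.hasTemperateGrowth_inner_right v)

lemma integrable_twist (T : E ≃L[ℝ] E) (a B : 𝓢(E, ℂ)) (x : E) :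
    Integrable fun y => a (x + y) * B y * wave T y x := by
  refine Integrable.mono' (g := fun y => SchwartzMap.seminorm ℂ 0 0 a * ‖B y‖)
    (B.integrable.norm.const_mul _) ?_ ?_
  · exact (by fun_prop : Continuous fun y => a (x + y) * B y * wave T y x).aestronglyMeasurable
  · refine Filter.Eventually.of_forall fun y => ?_
    rw [norm_mul, norm_mul, norm_wave, mul_one]
    gcongr
    exact norm_le_seminorm ℂ a _

lemma norm_twist_le (T : E ≃L[ℝ] E) (a B : 𝓢(E, ℂ)) (x : E) :
    ‖twist T a B x‖ ≤ SchwartzMap.seminorm ℂ 0 0 a * ∫ y, ‖B y‖ := by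
  rw [← integral_const_mul]
  refine norm_integral_le_of_norm_le (B.integrable.norm.const_mul _) ?_
  refine Filter.Eventually.of_forall fun y => ?_
  rw [norm_mul, norm_mul, norm_wave, mul_one]
  gcongr
  exact norm_le_seminorm ℂ a _

lemma mulLin_twist (T : E ≃L[ℝ] E) (a B : 𝓢(E, ℂ)) (v x : E) :
    ((inner ℝ v x : ℝ) : ℂ) * twist T a B x =
      twist T (mulLin v a) B x - twist T a (mulLin v B) x := by
  unfold twist
  rw [← integral_const_mul, ← integral_sub (integrable_twist T _ _ x) (integrable_twist T _ _ x)]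
  congr 1; ext y
  rw [mulLin_apply, mulLin_apply, inner_add_right]
  push_cast; ring

/-- Multiplication by `y ↦ 2πi ⟨T y, w⟩`. -/
noncomputable def mulDer (T : E ≃L[ℝ] E) (w : E) : 𝓢(E, ℂ) →L[ℂ] 𝓢(E, ℂ) :=
  (2 * Real.pi * Complex.I : ℂ) • mulLin (ContinuousLinearMap.adjoint (T : E →L[ℝ] E) w)

lemma mulDer_apply (T : E ≃L[ℝ] E) (w : E) (a : 𝓢(E, ℂ)) (x : E) :
    mulDer T w a x = (2 * Real.pi * Complex.I : ℂ) * ((inner ℝ (T x) w : ℝ) : ℂ) * a x := by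
  simp [mulDer, mulLin_apply, ContinuousLinearMap.adjoint_inner_left, real_inner_comm, mul_assoc]

lemma hasFDerivAt_twist (T : E ≃L[ℝ] E) (a B : 𝓢(E, ℂ)) (x : E) :
    HasFDerivAt (twist T a B) (fderiv ℝ (twist T a B) x) x ∧ ∀ w,
      fderiv ℝ (twist T a B) x w = twist T (∂_{w} a) B x + twist T a (mulDer T w B) x := by
  set F' : E → E → (E →L[ℝ] ℂ) := fun x y =>
    (B y * wave T y x) • fderiv ℝ a (x + y) +
    (a (x + y) * B y * wave T y x * (2 * Real.pi * Complex.I)) •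
      (Complex.ofRealCLM.comp (innerSL ℝ (T y))) with hF'
  have hdiff : ∀ y x, HasFDerivAt (fun x => a (x + y) * B y * wave T y x) (F' x y) x := by
    intro y x
    have h1 : HasFDerivAt (fun x => a (x + y)) (fderiv ℝ a (x + y)) x :=
      (hasFDerivAt_comp_add_right y).2 (a.hasFDerivAt (x + y))
    have h2 : HasFDerivAt (fun x => (((2 * Real.pi * inner ℝ (T y) x : ℝ) : ℂ) * Complex.I))
        ((2 * Real.pi * Complex.I : ℂ) • (Complex.ofRealCLM.comp (innerSL ℝ (T y)))) x := by
      have := ((2 * Real.pi * Complex.I : ℂ) •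
        (Complex.ofRealCLM.comp (innerSL ℝ (T y)))).hasFDerivAt (x := x)
      refine this.congr_of_eventuallyEq (Filter.Eventually.of_forall fun z => ?_)
      simp; ring
    have h3 : HasFDerivAt (fun x => wave T y x) _ x := h2.cexp
    refine ((h1.mul_const (B y)).mul h3).congr_fderiv ?_
    ext w
    simp [hF', wave]; ring
  have hcont : ∀ x, Continuous (F' x) := by
    intro x
    have : Continuous (fun y => fderiv ℝ a (x + y)) :=
      ((a.smooth 1).continuous_fderiv (by simp)).comp (by fun_prop)
    have h3 : Continuous (fun y => Complex.ofRealCLM.comp (innerSL ℝ (T y))) := by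
      fun_prop
    simp only [hF']
    fun_prop
  set bound : E → ℝ := fun y => SchwartzMap.seminorm ℂ 0 1 a * ‖B y‖ +
      SchwartzMap.seminorm ℂ 0 0 a * (2 * Real.pi * ‖(T : E →L[ℝ] E)‖) * (‖y‖ ^ 1 * ‖B y‖) with hbd
  have hb : ∀ x y, ‖F' x y‖ ≤ bound y := by
    intro x y
    refine (norm_add_le _ _).trans ?_
    rw [norm_smul, norm_smul, norm_mul, norm_mul, norm_mul, norm_mul, norm_wave]
    have e1 : ‖fderiv ℝ a (x + y)‖ ≤ SchwartzMap.seminorm ℂ 0 1 a := by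
      have := a.norm_iteratedFDeriv_le_seminorm ℂ 1 (x + y)
      rwa [norm_iteratedFDeriv_one] at this
    have e2 : ‖a (x + y)‖ ≤ SchwartzMap.seminorm ℂ 0 0 a := norm_le_seminorm ℂ a _
    have e3 : ‖Complex.ofRealCLM.comp (innerSL ℝ (T y))‖ ≤ ‖(T : E →L[ℝ] E)‖ * ‖y‖ := by
      refine (ContinuousLinearMap.opNorm_comp_le _ _).trans ?_
      rw [Complex.ofRealCLM_norm, one_mul, innerSL_apply_norm]
      exact (T : E →L[ℝ] E).le_opNorm y
    have e4 : ‖(2 * Real.pi * Complex.I : ℂ)‖ = 2 * Real.pi := by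
      simp [abs_of_pos Real.pi_pos]
    rw [e4]
    have : ‖B y‖ * 1 * ‖fderiv ℝ a (x + y)‖ ≤ SchwartzMap.seminorm ℂ 0 1 a * ‖B y‖ := by
      rw [mul_one, mul_comm]; gcongr
    refine add_le_add this ?_
    calc ‖a (x + y)‖ * ‖B y‖ * 1 * (2 * Real.pi) * ‖Complex.ofRealCLM.comp (innerSL ℝ (T y))‖
        ≤ SchwartzMap.seminorm ℂ 0 0 a * ‖B y‖ * 1 * (2 * Real.pi) * (‖(T : E →L[ℝ] E)‖ * ‖y‖) := by
          gcongr
      _ = _ := by ring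
  have hbi : Integrable bound := by
    refine (B.integrable.norm.const_mul _).add ((Integrable.const_mul ?_ _))
    exact B.integrable_pow_mul volume 1
  have key : HasFDerivAt (twist T a B) (∫ y, F' x y) x :=
    hasFDerivAt_integral_of_dominated_of_fderiv_le (Filter.univ_mem)
      (Filter.Eventually.of_forall fun x => (integrable_twist T a B x).aestronglyMeasurable)
      (integrable_twist T a B x) (hcont x).aestronglyMeasurable
      (Filter.Eventually.of_forall fun y z _ => hb z y) hbi
      (Filter.Eventually.of_forall fun y z _ => hdiff y z)
  refine ⟨key.fderiv ▸ key, fun w => ?_⟩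
  rw [key.fderiv]
  have hint : Integrable (F' x) :=
    hbi.mono' (hcont x).aestronglyMeasurable (Filter.Eventually.of_forall fun y => hb x y)
  rw [ContinuousLinearMap.integral_apply hint]
  unfold twist
  rw [← integral_add (integrable_twist T _ _ x) (integrable_twist T _ _ x)]
  congr 1; ext y
  simp [hF', mulDer_apply, lineDerivOp_apply_eq_fderiv]; ring

lemma fderiv_twist_eq (T : E ≃L[ℝ] E) (a B : 𝓢(E, ℂ)) :
    fderiv ℝ (twist T a B) = fun x => ∑ i, (twist T (∂_{stdOrthonormalBasis ℝ E i} a) B x +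
      twist T a (mulDer T (stdOrthonormalBasis ℝ E i) B) x) •
        (Complex.ofRealCLM.comp (innerSL ℝ (stdOrthonormalBasis ℝ E i))) := by
  ext x w
  conv_lhs => rw [← (stdOrthonormalBasis ℝ E).sum_repr' w]
  rw [map_sum, _root_.sum_apply]
  refine Finset.sum_congr rfl fun i _ => ?_
  rw [map_smul, (hasFDerivAt_twist T a B x).2]
  simp
  ring

lemma contDiff_twist (T : E ≃L[ℝ] E) (n : ℕ) (a B : 𝓢(E, ℂ)) : ContDiff ℝ n (twist T a B) := by
  induction n generalizing a B with
  | zero =>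
    exact contDiff_zero.2 (continuous_iff_continuousAt.2 fun x =>
      (hasFDerivAt_twist T a B x).1.continuousAt)
  | succ n ih =>
    push_cast
    rw [contDiff_succ_iff_fderiv]
    refine ⟨fun x => (hasFDerivAt_twist T a B x).1.differentiableAt, by simp, ?_⟩
    rw [fderiv_twist_eq]
    refine ContDiff.sum fun i _ => ?_
    exact ((ih _ _).add (ih _ _)).smul contDiff_const

/-- Joint estimate of all Schwartz seminorms of `twist T a B`. -/
lemma twist_decay (T : E ≃L[ℝ] E) (k n : ℕ) : ∃ p q : 𝓢(E, ℂ) → ℝ, (Continuous p ∧ p 0 = 0 ∧ 0 ≤ p) ∧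
    (Continuous q ∧ q 0 = 0 ∧ 0 ≤ q) ∧
    ∀ a B x, ‖x‖ ^ k * ‖iteratedFDeriv ℝ n (twist T a B) x‖ ≤ p a * q B := by
  induction n with
  | zero =>
    simp only [norm_iteratedFDeriv_zero]
    induction k with
    | zero =>
      refine ⟨SchwartzMap.seminorm ℂ 0 0, fun B => ‖toLpCLM ℂ ℂ (1 : ENNReal) (volume : Measure E) B‖,
        ⟨(schwartz_withSeminorms ℂ E ℂ).continuous_seminorm (0, 0), map_zero _,
          fun _ => apply_nonneg _ _⟩, ⟨?_, by beta_reduce; rw [map_zero, norm_zero], fun _ => norm_nonneg _⟩, fun a B x => ?_⟩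
      · exact continuous_norm.comp (toLpCLM ℂ ℂ (1 : ENNReal) (volume : Measure E)).continuous
      · rw [pow_zero, one_mul]
        refine (norm_twist_le T a B x).trans (le_of_eq ?_)
        congr 1
        change _ = ‖B.toLp 1 volume‖
        rw [norm_toLp_one]
    | succ k ih =>
      obtain ⟨p, q, ⟨hp, hp0, hpn⟩, ⟨hq, hq0, hqn⟩, h⟩ := ih
      set b := stdOrthonormalBasis ℝ E
      refine ⟨fun a => p a + ∑ i, p (mulLin (b i) a), fun B => q B + ∑ i, q (mulLin (b i) B),
        ⟨hp.add (continuous_finsetSum _ fun i _ => hp.comp (mulLin (b i)).continuous),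
          by simp [hp0], fun a => add_nonneg (hpn _) (Finset.sum_nonneg fun i _ => hpn _)⟩,
        ⟨hq.add (continuous_finsetSum _ fun i _ => hq.comp (mulLin (b i)).continuous),
          by simp [hq0], fun a => add_nonneg (hqn _) (Finset.sum_nonneg fun i _ => hqn _)⟩,
        fun a B x => ?_⟩
      have hx : ‖x‖ ≤ ∑ i, ‖((inner ℝ (b i) x : ℝ) : ℂ)‖ := by
        conv_lhs => rw [← b.sum_repr' x]
        refine (norm_sum_le _ _).trans (Finset.sum_le_sum fun i _ => ?_)
        rw [norm_smul, b.norm_eq_one, mul_one, Complex.norm_real]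
      calc ‖x‖ ^ (k + 1) * ‖twist T a B x‖
          ≤ (∑ i, ‖((inner ℝ (b i) x : ℝ) : ℂ)‖) * (‖x‖ ^ k * ‖twist T a B x‖) := by
            rw [pow_succ', mul_assoc]; gcongr
        _ = ∑ i, ‖x‖ ^ k * ‖((inner ℝ (b i) x : ℝ) : ℂ) * twist T a B x‖ := by
            rw [Finset.sum_mul]; refine Finset.sum_congr rfl fun i _ => ?_
            rw [norm_mul]; ring
        _ ≤ ∑ i, (p (mulLin (b i) a) * q B + p a * q (mulLin (b i) B)) := by
            refine Finset.sum_le_sum fun i _ => ?_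
            rw [mulLin_twist]
            refine (mul_le_mul_of_nonneg_left (norm_sub_le _ _) (by positivity)).trans ?_
            rw [mul_add]
            exact add_le_add (h _ _ _) (h _ _ _)
        _ = (∑ i, p (mulLin (b i) a)) * q B + p a * ∑ i, q (mulLin (b i) B) := by
            rw [Finset.sum_add_distrib, Finset.sum_mul, Finset.mul_sum]
        _ ≤ (p a + ∑ i, p (mulLin (b i) a)) * (q B + ∑ i, q (mulLin (b i) B)) := by
            have h3 : 0 ≤ ∑ i, p (mulLin (b i) a) := Finset.sum_nonneg fun i _ => hpn _
            have h4 : 0 ≤ ∑ i, q (mulLin (b i) B) := Finset.sum_nonneg fun i _ => hqn _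
            nlinarith [mul_nonneg (hpn a) (hqn B), mul_nonneg h3 h4]
  | succ n ih =>
    obtain ⟨p, q, ⟨hp, hp0, hpn⟩, ⟨hq, hq0, hqn⟩, h⟩ := ih
    set b := stdOrthonormalBasis ℝ E
    refine ⟨fun a => p a + ∑ i, p (lineDerivOpCLM ℂ 𝓢(E, ℂ) (b i) a),
      fun B => q B + ∑ i, q (mulDer T (b i) B),
      ⟨hp.add (continuous_finsetSum _ fun i _ =>
        hp.comp (lineDerivOpCLM ℂ 𝓢(E, ℂ) (b i)).continuous),
        by simp only [map_zero, hp0]; simp,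
        fun a => add_nonneg (hpn _) (Finset.sum_nonneg fun i _ => hpn _)⟩,
      ⟨hq.add (continuous_finsetSum _ fun i _ => hq.comp (mulDer T (b i)).continuous),
        by simp [hq0], fun a => add_nonneg (hqn _) (Finset.sum_nonneg fun i _ => hqn _)⟩,
      fun a B x => ?_⟩
    have hn : ‖iteratedFDeriv ℝ (n + 1) (twist T a B) x‖ ≤
        ∑ i, (‖iteratedFDeriv ℝ n (twist T (∂_{b i} a) B) x‖ +
          ‖iteratedFDeriv ℝ n (twist T a (mulDer T (b i) B)) x‖) := by
      have hs : ∀ i, ContDiff ℝ n (fun x => twist T (∂_{b i} a) B x +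
          twist T a (mulDer T (b i) B) x) := fun i =>
        (contDiff_twist T n _ _).add (contDiff_twist T n _ _)
      have hs' : ∀ i, ContDiff ℝ n (fun x => (twist T (∂_{b i} a) B x +
          twist T a (mulDer T (b i) B) x) • (Complex.ofRealCLM.comp (innerSL ℝ (b i)))) :=
        fun i => (hs i).smul contDiff_const
      rw [← norm_iteratedFDeriv_fderiv, fderiv_twist_eq,
        iteratedFDeriv_fun_sum_apply fun i _ => (hs' i).contDiffAt]
      refine (norm_sum_le _ _).trans (Finset.sum_le_sum fun i _ => ?_)
      set L : E →L[ℝ] ℂ := Complex.ofRealCLM.comp (innerSL ℝ (b i))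
      have hL : ‖L‖ ≤ 1 := by
        refine (ContinuousLinearMap.opNorm_comp_le _ _).trans ?_
        rw [Complex.ofRealCLM_norm, one_mul, innerSL_apply_norm, b.norm_eq_one]
      set Λ : ℂ →L[ℝ] (E →L[ℝ] ℂ) := (ContinuousLinearMap.lsmul ℝ ℂ).flip L
      have hΛ : ‖Λ‖ ≤ 1 := ContinuousLinearMap.opNorm_le_bound _ zero_le_one fun z => by
        change ‖z • L‖ ≤ _
        rw [norm_smul, one_mul]
        exact mul_le_of_le_one_right (norm_nonneg _) hL
      have h1 := Λ.norm_iteratedFDeriv_comp_left (x := x) (hs i).contDiffAt le_rfl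
      refine h1.trans ?_
      refine (mul_le_of_le_one_left (norm_nonneg _) hΛ).trans ?_
      have h2 := fun_iteratedFDeriv_add_apply (i := n) (x := x)
        ((contDiff_twist T n (∂_{b i} a) B)).contDiffAt
        ((contDiff_twist T n a (mulDer T (b i) B))).contDiffAt
      rw [h2]
      exact norm_add_le _ _
    calc _ ≤ ‖x‖ ^ k * ∑ i, (‖iteratedFDeriv ℝ n (twist T (∂_{b i} a) B) x‖ +
          ‖iteratedFDeriv ℝ n (twist T a (mulDer T (b i) B)) x‖) := by gcongr
      _ ≤ ∑ i, (p (∂_{b i} a) * q B + p a * q (mulDer T (b i) B)) := by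
          rw [Finset.mul_sum]
          refine Finset.sum_le_sum fun i _ => ?_
          rw [mul_add]
          exact add_le_add (h _ _ _) (h _ _ _)
      _ = (∑ i, p (∂_{b i} a)) * q B + p a * ∑ i, q (mulDer T (b i) B) := by
          rw [Finset.sum_add_distrib, Finset.sum_mul, Finset.mul_sum]
      _ ≤ (p a + ∑ i, p (∂_{b i} a)) * (q B + ∑ i, q (mulDer T (b i) B)) := by
          have h3 : 0 ≤ ∑ i, p (∂_{b i} a) := Finset.sum_nonneg fun i _ => hpn _
          have h4 : 0 ≤ ∑ i, q (mulDer T (b i) B) := Finset.sum_nonneg fun i _ => hqn _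
          nlinarith [mul_nonneg (hpn a) (hqn B), mul_nonneg h3 h4]

/-- `twist T a B` as a Schwartz function. -/
noncomputable def twistS (T : E ≃L[ℝ] E) (a B : 𝓢(E, ℂ)) : 𝓢(E, ℂ) where
  toFun := twist T a B
  smooth' := contDiff_infty.2 fun n => contDiff_twist T n a B
  decay' k n := by
    obtain ⟨p, q, -, -, h⟩ := twist_decay T k n
    exact ⟨_, h a B⟩

lemma twistS_apply (T : E ≃L[ℝ] E) (a B : 𝓢(E, ℂ)) (x : E) : twistS T a B x = twist T a B x := rfl

lemma twistS_add_left (T : E ≃L[ℝ] E) (a a' B : 𝓢(E, ℂ)) :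
    twistS T (a + a') B = twistS T a B + twistS T a' B := by
  ext x
  simp only [twistS_apply, add_apply, twist]
  rw [← integral_add (integrable_twist T _ _ x) (integrable_twist T _ _ x)]
  congr 1; ext y; ring

lemma twistS_add_right (T : E ≃L[ℝ] E) (a B B' : 𝓢(E, ℂ)) :
    twistS T a (B + B') = twistS T a B + twistS T a B' := by
  ext x
  simp only [twistS_apply, add_apply, twist]
  rw [← integral_add (integrable_twist T _ _ x) (integrable_twist T _ _ x)]
  congr 1; ext y; ring

lemma twistS_smul_left (T : E ≃L[ℝ] E) (r : ℂ) (a B : 𝓢(E, ℂ)) :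
    twistS T (r • a) B = r • twistS T a B := by
  ext x
  simp only [twistS_apply, smul_apply, smul_eq_mul, twist]
  rw [← integral_const_mul]
  congr 1; ext y; ring

lemma twistS_smul_right (T : E ≃L[ℝ] E) (r : ℂ) (a B : 𝓢(E, ℂ)) :
    twistS T a (r • B) = r • twistS T a B := by
  ext x
  simp only [twistS_apply, smul_apply, smul_eq_mul, twist]
  rw [← integral_const_mul]
  congr 1; ext y; ring

lemma continuous_of_seminorm_le (L : 𝓢(E, ℂ) →ₗ[ℂ] 𝓢(E, ℂ))
    (h : ∀ k n : ℕ, ∃ p : 𝓢(E, ℂ) → ℝ, Continuous p ∧ p 0 = 0 ∧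
      ∀ a, SchwartzMap.seminorm ℂ k n (L a) ≤ p a) : Continuous L := by
  refine continuous_of_continuousAt_zero L ?_
  rw [ContinuousAt, map_zero, (schwartz_withSeminorms ℂ E ℂ).tendsto_nhds]
  rintro ⟨k, n⟩ ε hε
  obtain ⟨p, hp, hp0, hle⟩ := h k n
  have := (hp.tendsto' 0 0 hp0).eventually_lt_const hε
  filter_upwards [this] with a ha
  simpa using (hle a).trans_lt ha

/-- `twistS` as a separately continuous bilinear map. -/
noncomputable def twistL (T : E ≃L[ℝ] E) (B : 𝓢(E, ℂ)) : 𝓢(E, ℂ) →L[ℂ] 𝓢(E, ℂ) where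
  toFun a := twistS T a B
  map_add' a a' := twistS_add_left T a a' B
  map_smul' r a := twistS_smul_left T r a B
  cont := by
    refine continuous_of_seminorm_le
      ⟨⟨fun a => twistS T a B, fun a a' => twistS_add_left T a a' B⟩,
        fun r a => twistS_smul_left T r a B⟩ fun k n => ?_
    obtain ⟨p, q, ⟨hp, hp0, hpn⟩, ⟨hq, hq0, hqn⟩, h⟩ := twist_decay T k n
    refine ⟨fun a => p a * q B, hp.mul continuous_const, by simp [hp0], fun a => ?_⟩
    exact seminorm_le_bound ℂ k n _ (mul_nonneg (hpn _) (hqn _)) fun x => h a B x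

noncomputable def twistR (T : E ≃L[ℝ] E) (a : 𝓢(E, ℂ)) : 𝓢(E, ℂ) →L[ℂ] 𝓢(E, ℂ) where
  toFun B := twistS T a B
  map_add' B B' := twistS_add_right T a B B'
  map_smul' r B := twistS_smul_right T r a B
  cont := by
    refine continuous_of_seminorm_le
      ⟨⟨fun B => twistS T a B, fun B B' => twistS_add_right T a B B'⟩,
        fun r B => twistS_smul_right T r a B⟩ fun k n => ?_
    obtain ⟨p, q, ⟨hp, hp0, hpn⟩, ⟨hq, hq0, hqn⟩, h⟩ := twist_decay T k n
    refine ⟨fun B => p a * q B, continuous_const.mul hq, by simp [hq0], fun B => ?_⟩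
    exact seminorm_le_bound ℂ k n _ (mul_nonneg (hpn _) (hqn _)) fun x => h a B x

/-- The Fourier transform composed with `T`. -/
noncomputable def sft (T : E ≃L[ℝ] E) : 𝓢(E, ℂ) →L[ℂ] 𝓢(E, ℂ) :=
  (compCLMOfContinuousLinearEquiv ℂ T).comp (fourierCLM ℂ 𝓢(E, ℂ))

/-- The constant `|det T|`. -/
noncomputable def cst (T : E ≃L[ℝ] E) : ℂ := ((|LinearMap.det (T : E →ₗ[ℝ] E)| : ℝ) : ℂ)

lemma wave_add_left (T : E ≃L[ℝ] E) (y z x : E) : wave T (y + z) x = wave T y x * wave T z x := by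
  simp only [wave, ← Complex.exp_add]
  congr 1
  rw [map_add, inner_add_left]; push_cast; ring

lemma wave_add_right (T : E ≃L[ℝ] E) (y x z : E) : wave T y (x + z) = wave T y x * wave T y z := by
  simp only [wave, ← Complex.exp_add]
  congr 1
  rw [inner_add_right]; push_cast; ring

lemma wave_neg_mul (T : E ≃L[ℝ] E) (y x : E) : wave T (-y) x * wave T y x = 1 := by
  rw [← wave_add_left]; simp [wave]

lemma wave_neg_right (T : E ≃L[ℝ] E) (y x : E) : wave T y (-x) = wave T (-y) x := by
  simp [wave]

lemma wave_self (T : E ≃L[ℝ] E) (hT : ∀ y z, inner ℝ (T y) z = -inner ℝ (T z) y) (y : E) :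
    wave T y y = 1 := by
  have : inner ℝ (T y) y = 0 := by have := hT y y; linarith
  simp [wave, this]

lemma wave_swap (T : E ≃L[ℝ] E) (hT : ∀ y z, inner ℝ (T y) z = -inner ℝ (T z) y) (y x : E) :
    wave T (-y) x = wave T x y := by
  have := hT y x
  simp [wave, this]

lemma sft_apply (T : E ≃L[ℝ] E) (b : 𝓢(E, ℂ)) (y : E) :
    sft T b y = ∫ w, b w * wave T (-y) w := by
  change 𝓕 (b : E → ℂ) (T y) = _
  rw [Real.fourier_eq']
  congr 1; ext w
  rw [smul_eq_mul, mul_comm, wave, map_neg, inner_neg_left, real_inner_comm w]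
  congr 3; push_cast; ring

lemma integral_comp_equiv (T : E ≃L[ℝ] E) (f : E → ℂ) :
    cst T * ∫ y, f (T y) = ∫ y, f y := by
  have hdet : LinearMap.det (T : E →ₗ[ℝ] E) ≠ 0 := (LinearEquiv.isUnit_det' T.toLinearEquiv).ne_zero
  have h := Measure.map_linearMap_addHaar_eq_smul_addHaar (volume : Measure E) hdet
  have h2 : ∫ y, f (T y) = ∫ y, f y ∂(Measure.map T volume) :=
    (T.toHomeomorph.toMeasurableEquiv.measurableEmbedding.integral_map f).symm
  have h3 : Measure.map T (volume : Measure E) =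
    ENNReal.ofReal |(LinearMap.det (T : E →ₗ[ℝ] E))⁻¹| • volume := h
  rw [h2, h3, integral_smul_measure, ENNReal.toReal_ofReal (abs_nonneg _), cst, abs_inv,
    Complex.real_smul, ← mul_assoc, ← Complex.ofReal_mul, mul_inv_cancel₀ (abs_ne_zero.2 hdet),
    Complex.ofReal_one, one_mul]

lemma inversion (T : E ≃L[ℝ] E) (b : 𝓢(E, ℂ)) (x : E) :
    cst T * ∫ y, sft T b y * wave T y x = b x := by
  have h1 : (fun y => sft T b y * wave T y x) = fun y => (fun v => 𝓕 (b : E → ℂ) v *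
      Complex.exp (((2 * Real.pi * inner ℝ v x : ℝ) : ℂ) * Complex.I)) (T y) := rfl
  rw [h1, integral_comp_equiv T (fun v => 𝓕 (b : E → ℂ) v *
    Complex.exp (((2 * Real.pi * inner ℝ v x : ℝ) : ℂ) * Complex.I))]
  have h2 : 𝓕⁻ (𝓕 (b : E → ℂ)) x = b x := by
    rw [← fourier_coe, ← fourierInv_coe, FourierPair.fourierInv_fourier_eq]
  rw [← h2, Real.fourierInv_eq']
  congr 1; ext v
  rw [smul_eq_mul, mul_comm]

/-- The star product attached to `T`. -/
noncomputable def starS (T : E ≃L[ℝ] E) (a b : 𝓢(E, ℂ)) : 𝓢(E, ℂ) := cst T • twistS T a (sft T b)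

lemma starS_apply (T : E ≃L[ℝ] E) (a b : 𝓢(E, ℂ)) (x : E) :
    starS T a b x = cst T * ∫ y, a (x + y) * sft T b y * wave T y x := rfl

/-- The star product as an iterated integral. -/
lemma starS_eq (T : E ≃L[ℝ] E) (a b : 𝓢(E, ℂ)) (x : E) :
    starS T a b x = cst T * ∫ y, ∫ z, a (x + y) * b (x + z) * wave T (-y) z := by
  rw [starS_apply]
  congr 2; ext y
  have : ∀ z, a (x + y) * b (x + z) * wave T (-y) z =
      (fun w => a (x + y) * wave T y x * (b w * wave T (-y) w)) (x + z) := by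
    intro z
    simp only [wave_add_right]
    linear_combination (-a (x + y) * b (x + z) * wave T (-y) z) * wave_neg_mul T y x
  simp_rw [this]
  rw [integral_add_left_eq_self (fun w => a (x + y) * wave T y x * (b w * wave T (-y) w)) x,
    integral_const_mul, sft_apply]; ring

lemma integrable_conv (f g : 𝓢(E, ℂ)) (φ : E × E → ℂ) (hφ : Continuous φ) (h1 : ∀ p, ‖φ p‖ = 1) :
    Integrable (fun p : E × E => f (p.1 + p.2) * g p.2 * φ p) (volume.prod volume) := by
  have hc : Continuous (fun p : E × E => f (p.1 + p.2) * g p.2 * φ p) := by fun_prop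
  rw [integrable_prod_iff' hc.aestronglyMeasurable]
  have hn : ∀ p, ‖f (p.1 + p.2) * g p.2 * φ p‖ = ‖f (p.1 + p.2)‖ * ‖g p.2‖ := by
    intro p; rw [norm_mul, norm_mul, h1, mul_one]
  refine ⟨Filter.Eventually.of_forall fun y => ?_, ?_⟩
  · refine Integrable.mono' (g := fun x => ‖f (x + y)‖ * ‖g y‖)
      ((f.integrable.comp_add_right y).norm.mul_const _) (by fun_prop) ?_
    exact Filter.Eventually.of_forall fun x => (hn (x, y)).le
  · refine (g.integrable.norm.const_mul (∫ x, ‖f x‖)).congr (Filter.Eventually.of_forall fun y => ?_)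
    have : ∀ x, ‖f (x + y) * g y * φ (x, y)‖ = ‖f (x + y)‖ * ‖g y‖ := fun x => hn (x, y)
    simp only [this]
    rw [integral_mul_const, integral_add_right_eq_self (fun x => ‖f x‖) y]

/-- The transform turns the star product into a twisted convolution. -/
lemma sft_starS (T : E ≃L[ℝ] E) (hT : ∀ y z, inner ℝ (T y) z = -inner ℝ (T z) y)
    (b c : 𝓢(E, ℂ)) (y : E) :
    sft T (starS T b c) y = cst T * ∫ z, sft T c z * wave T y z * sft T b (y - z) := by
  rw [sft_apply]
  simp_rw [starS_apply, mul_assoc (cst T), ← integral_mul_const]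
  rw [integral_const_mul, integral_integral_swap]
  · congr 2; ext z
    have : ∀ w, b (w + z) * sft T c z * wave T z w * wave T (-y) w =
        sft T c z * wave T y z * (fun u => b u * wave T (-(y - z)) u) (w + z) := by
      intro w
      have e1 : wave T (-(y - z)) w = wave T z w * wave T (-y) w := by
        rw [← wave_add_left]; congr 1; abel
      have e2 : wave T (-(y - z)) z = wave T (-y) z := by
        have : -(y - z) = z + -y := by abel
        rw [this, wave_add_left, wave_self T hT, one_mul]
      simp only [wave_add_right, e1, e2]
      linear_combination (-b (w + z) * sft T c z * wave T z w * wave T (-y) w) * wave_neg_mul T y z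
    simp_rw [this]
    rw [integral_const_mul, integral_add_right_eq_self (fun u => b u * wave T (-(y - z)) u) z,
      ← sft_apply]
  · have := integrable_conv b (sft T c) (fun p => wave T p.2 p.1 * wave T (-y) p.1) (by fun_prop)
      (by intro p; rw [norm_mul, norm_wave, norm_wave, mul_one])
    refine this.congr (Filter.Eventually.of_forall fun p => ?_)
    simp [Function.uncurry]; ring

lemma integrable_conv_sub (f g : 𝓢(E, ℂ)) (φ : E × E → ℂ) (hφ : Continuous φ) (C : ℝ)
    (h1 : ∀ p, ‖φ p‖ ≤ C) :
    Integrable (fun p : E × E => f (p.1 - p.2) * g p.2 * φ p) (volume.prod volume) := by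
  have h2 : Integrable (fun p : E × E => f (p.1 - p.2) * g p.2) (volume.prod volume) := by
    have hc : Continuous (fun p : E × E => f (p.1 - p.2) * g p.2) := by fun_prop
    rw [integrable_prod_iff' hc.aestronglyMeasurable]
    refine ⟨Filter.Eventually.of_forall fun y => (f.integrable.comp_sub_right y).mul_const (g y), ?_⟩
    refine (g.integrable.norm.const_mul (∫ x, ‖f x‖)).congr (Filter.Eventually.of_forall fun y => ?_)
    simp only [norm_mul]
    rw [integral_mul_const, integral_sub_right_eq_self (fun x => ‖f x‖) y]
  exact h2.mul_bdd (c := C) hφ.aestronglyMeasurable (Filter.Eventually.of_forall h1)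

lemma starS_assoc (T : E ≃L[ℝ] E) (hT : ∀ y z, inner ℝ (T y) z = -inner ℝ (T z) y)
    (a b c : 𝓢(E, ℂ)) : starS T (starS T a b) c = starS T a (starS T b c) := by
  ext x
  set B := sft T b with hB
  set C := sft T c with hC
  have hL : starS T (starS T a b) c x = cst T * (cst T * ∫ z, ∫ y,
      (a (x + z + y) * B y * wave T y (x + z)) * C z * wave T z x) := by
    rw [starS_apply]
    refine congrArg (cst T * ·) ?_
    rw [← integral_const_mul]
    refine integral_congr_ae (Filter.Eventually.of_forall fun z => ?_)
    beta_reduce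
    rw [starS_apply, integral_mul_const, integral_mul_const]; ring
  have hR : starS T a (starS T b c) x = cst T * (cst T * ∫ y, ∫ z,
      (B (y - z) * C z * (a (x + y) * wave T y z * wave T y x))) := by
    rw [starS_apply]
    refine congrArg (cst T * ·) ?_
    rw [← integral_const_mul]
    refine integral_congr_ae (Filter.Eventually.of_forall fun y => ?_)
    beta_reduce
    rw [sft_starS T hT, ← hB, ← hC, mul_comm (a (x + y)), mul_assoc, mul_assoc,
      ← integral_mul_const]
    refine congrArg (cst T * ·) ?_
    refine integral_congr_ae (Filter.Eventually.of_forall fun z => ?_)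
    beta_reduce
    ring
  rw [hL, hR]
  refine congrArg (cst T * ·) (congrArg (cst T * ·) ?_)
  symm
  rw [integral_integral_swap]
  · refine integral_congr_ae (Filter.Eventually.of_forall fun z => ?_)
    beta_reduce
    rw [← integral_add_right_eq_self (fun y => B (y - z) * C z *
      (a (x + y) * wave T y z * wave T y x)) z]
    refine integral_congr_ae (Filter.Eventually.of_forall fun y => ?_)
    beta_reduce
    rw [add_sub_cancel_right, wave_add_left, wave_add_left, wave_add_right, wave_self T hT,
      show x + (y + z) = x + z + y by abel]
    ring
  · have hcont : Continuous fun p : E × E => a (x + p.1) * wave T p.1 p.2 * wave T p.1 x := by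
      fun_prop
    refine integrable_conv_sub B C _ hcont (SchwartzMap.seminorm ℂ 0 0 a) fun p => ?_
    rw [norm_mul, norm_mul, norm_wave, norm_wave, mul_one, mul_one]
    exact norm_le_seminorm ℂ a _

/-- The trace property. -/
lemma integral_starS (T : E ≃L[ℝ] E) (hT : ∀ y z, inner ℝ (T y) z = -inner ℝ (T z) y)
    (a b : 𝓢(E, ℂ)) : ∫ x, starS T a b x = ∫ x, a x * b x := by
  simp_rw [starS_apply]
  rw [integral_const_mul, integral_integral_swap]
  · have : ∀ y, ∫ x, a (x + y) * sft T b y * wave T y x =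
        ∫ x, a x * sft T b y * wave T y x := by
      intro y
      rw [← integral_add_right_eq_self (fun x => a x * sft T b y * wave T y x) y]
      congr 1; ext x
      rw [wave_add_right, wave_self T hT, mul_one]
    simp_rw [this]
    rw [← integral_const_mul]
    simp_rw [← integral_const_mul]
    rw [integral_integral_swap]
    · congr 1; ext x
      rw [← inversion T b x, ← integral_const_mul, ← integral_const_mul]
      congr 1; ext y; ring
    · have hc : Continuous fun p : E × E => cst T * wave T p.1 p.2 := by fun_prop
      refine (((sft T b).integrable.mul_prod a.integrable).mul_bdd (c := ‖cst T‖) hc.aestronglyMeasurable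
        (Filter.Eventually.of_forall fun p => ?_)).congr (Filter.Eventually.of_forall fun p => ?_)
      · rw [norm_mul, norm_wave, mul_one]
      · simp only [Function.uncurry]; ring
  · exact integrable_conv a (sft T b) (fun p => wave T p.2 p.1) (by fun_prop) (fun p => norm_wave T _ _)

lemma integral_starS_mul (T : E ≃L[ℝ] E) (hT : ∀ y z, inner ℝ (T y) z = -inner ℝ (T z) y)
    (a b c : 𝓢(E, ℂ)) : ∫ x, starS T a b x * c x = ∫ x, a x * starS T b c x := by
  rw [← integral_starS T hT, ← integral_starS T hT, starS_assoc T hT]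

end Twisted

section Complete

variable {E : Type*} [NormedAddCommGroup E] [NormedSpace ℝ E]

/-- The Schwartz space is complete. -/
lemma completeSpace_schwartz : CompleteSpace 𝓢(E, ℂ) := by
  have : (uniformity 𝓢(E, ℂ)).IsCountablyGenerated :=
    IsUniformAddGroup.uniformity_countably_generated
  refine UniformSpace.complete_of_cauchySeq_tendsto fun u hu => ?_
  have hc : ∀ (k n : ℕ) (ε : ℝ), 0 < ε → ∃ N, ∀ i ≥ N, ∀ j ≥ N,
      SchwartzMap.seminorm ℂ k n (u i - u j) < ε := by
    intro k n ε hε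
    have h1 : Tendsto (fun p : ℕ × ℕ => u p.2 - u p.1) atTop (𝓝 0) := by
      have := hu.tendsto_uniformity
      rw [uniformity_eq_comap_nhds_zero, tendsto_comap_iff] at this
      exact this
    have h2 := ((schwartz_withSeminorms ℂ E ℂ).tendsto_nhds _ _).1 h1 (k, n) ε hε
    obtain ⟨N, hN⟩ := eventually_atTop.1 h2
    refine ⟨max N.1 N.2, fun i hi j hj => ?_⟩
    have := hN (j, i) ⟨(le_max_left _ _).trans hj, (le_max_right _ _).trans hi⟩
    simpa using this
  have hD : ∀ n i j x, iteratedFDeriv ℝ n (u i - u j : 𝓢(E, ℂ)) x =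
      iteratedFDeriv ℝ n (u i) x - iteratedFDeriv ℝ n (u j) x := by
    intro n i j x
    exact iteratedFDeriv_sub_apply ((u i).smooth n).contDiffAt ((u j).smooth n).contDiffAt
  have hlim : ∀ n x, ∃ y, Tendsto (fun i => iteratedFDeriv ℝ n (u i) x) atTop (𝓝 y) := by
    intro n x
    refine cauchySeq_tendsto_of_complete (Metric.cauchySeq_iff.2 fun ε hε => ?_)
    obtain ⟨N, hN⟩ := hc 0 n ε hε
    refine ⟨N, fun i hi j hj => ?_⟩
    rw [dist_eq_norm, ← hD]
    exact ((u i - u j).norm_iteratedFDeriv_le_seminorm ℂ n x).trans_lt (hN i hi j hj)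
  choose g hg using hlim
  have hunif : ∀ (k n : ℕ) (ε : ℝ), 0 < ε → ∃ N, ∀ i ≥ N, ∀ x,
      ‖x‖ ^ k * ‖iteratedFDeriv ℝ n (u i) x - g n x‖ ≤ ε := by
    intro k n ε hε
    obtain ⟨N, hN⟩ := hc k n ε hε
    refine ⟨N, fun i hi x => ?_⟩
    have ht : Tendsto (fun j => ‖x‖ ^ k * ‖iteratedFDeriv ℝ n (u i) x - iteratedFDeriv ℝ n (u j) x‖)
        atTop (𝓝 (‖x‖ ^ k * ‖iteratedFDeriv ℝ n (u i) x - g n x‖)) :=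
      ((tendsto_const_nhds.sub (hg n x)).norm).const_mul _
    refine le_of_tendsto ht (eventually_atTop.2 ⟨N, fun j hj => ?_⟩)
    rw [← hD]
    exact ((u i - u j).le_seminorm ℂ k n x).trans (hN i hi j hj).le
  have htu : ∀ n, TendstoUniformly (fun i x => iteratedFDeriv ℝ n (u i) x) (g n) atTop := by
    intro n
    refine Metric.tendstoUniformly_iff.2 fun ε hε => ?_
    obtain ⟨N, hN⟩ := hunif 0 n (ε / 2) (by positivity)
    filter_upwards [eventually_ge_atTop N] with i hi x
    have := hN i hi x
    rw [pow_zero, one_mul] at this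
    rw [dist_comm, dist_eq_norm]; linarith
  have hser : HasFTaylorSeriesUpTo ∞ (fun x => (g 0 x).curry0) (fun x n => g n x) := by
    refine ⟨fun x => rfl, fun m _ x => ?_, fun m _ => ?_⟩
    · have := hasFDerivAt_of_tendstoUniformly (𝕜 := ℝ) (l := atTop)
        (f := fun i y => iteratedFDeriv ℝ m (u i) y)
        (f' := fun i y => (iteratedFDeriv ℝ (m + 1) (u i) y).curryLeft)
        (g := g m) (g' := fun y => (g (m + 1) y).curryLeft) ?_ ?_ (fun y => hg m y) x
      · exact this
      · exact (continuousMultilinearCurryLeftEquiv ℝ (fun _ : Fin (m + 1) => E)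
          ℂ).isometry.uniformContinuous.comp_tendstoUniformly (htu (m + 1))
      · intro i y
        have h1 := ((u i).smooth (m + 1 : ℕ)).differentiable_iteratedFDeriv (m := m)
          (by norm_cast; exact Nat.lt_succ_self m) y
        convert! h1.hasFDerivAt using 1
    · exact (htu m).continuous (Eventually.of_forall fun i =>
        ((u i).smooth m).continuous_iteratedFDeriv le_rfl).frequently
  have hgs : ContDiff ℝ ∞ (fun x => (g 0 x).curry0) := hser.contDiff
  have heq : ∀ n x, iteratedFDeriv ℝ n (fun x => (g 0 x).curry0) x = g n x := fun n x =>
    (hser.eq_iteratedFDeriv (by exact_mod_cast le_top) x).symm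
  let s : 𝓢(E, ℂ) := ⟨fun x => (g 0 x).curry0, hgs, fun k n => by
    obtain ⟨N, hN⟩ := hunif k n 1 one_pos
    refine ⟨1 + SchwartzMap.seminorm ℂ k n (u N), fun x => ?_⟩
    rw [heq]
    have h1 := hN N le_rfl x
    have h2 := (u N).le_seminorm ℂ k n x
    calc ‖x‖ ^ k * ‖g n x‖ ≤ ‖x‖ ^ k * (‖iteratedFDeriv ℝ n (u N) x - g n x‖ +
          ‖iteratedFDeriv ℝ n (u N) x‖) := by
          gcongr
          rw [norm_sub_rev]
          exact norm_le_norm_sub_add _ _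
      _ ≤ _ := by rw [mul_add]; exact add_le_add h1 h2⟩
  refine ⟨s, ((schwartz_withSeminorms ℂ E ℂ).tendsto_nhds _ _).2 ?_⟩
  rintro ⟨k, n⟩ ε hε
  obtain ⟨N, hN⟩ := hunif k n (ε / 2) (by positivity)
  filter_upwards [eventually_ge_atTop N] with i hi
  refine lt_of_le_of_lt (seminorm_le_bound ℂ k n _ (by positivity : 0 ≤ ε / 2) fun x => ?_)
    (by linarith : ε / 2 < ε)
  have : iteratedFDeriv ℝ n (u i - s : 𝓢(E, ℂ)) x = iteratedFDeriv ℝ n (u i) x - g n x := by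
    rw [← heq n x]
    exact iteratedFDeriv_sub_apply ((u i).smooth n).contDiffAt (s.smooth n).contDiffAt
  rw [this]
  exact hN i hi x

lemma barrelled_schwartz : BarrelledSpace ℂ 𝓢(E, ℂ) := by
  have := completeSpace_schwartz (E := E)
  have : (uniformity 𝓢(E, ℂ)).IsCountablyGenerated :=
    IsUniformAddGroup.uniformity_countably_generated
  let _ := UniformSpace.pseudoMetricSpace 𝓢(E, ℂ)
  infer_instance

end Complete

section ClosedGraph

variable {E : Type*} [NormedAddCommGroup E] [InnerProductSpace ℝ E] [FiniteDimensional ℝ E]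
  [MeasurableSpace E] [BorelSpace E]

lemma integrable_mul_schwartz (a b : 𝓢(E, ℂ)) : Integrable fun x => a x * b x :=
  a.integrable.mul_bdd (c := SchwartzMap.seminorm ℂ 0 0 b) b.continuous.aestronglyMeasurable
    (Eventually.of_forall fun x => norm_le_seminorm ℂ b x)

lemma continuous_weak_deriv (L : 𝓢(E, ℂ) →ₗ[ℂ] 𝓢(E, ℂ))
    (h : ∀ b : 𝓢(E, ℂ), Continuous fun a => ∫ x, L a x * b x) (n : ℕ) (m : Fin n → E)
    (b : 𝓢(E, ℂ)) : Continuous fun a => ∫ x, (∂^{m} (L a)) x * b x := by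
  induction n generalizing b with
  | zero => simpa using h b
  | succ n ih =>
    have := ih (Fin.tail m) (∂_{m 0} b)
    have e : ∀ a, ∫ x, (∂^{m} (L a)) x * b x =
        -∫ x, (∂^{Fin.tail m} (L a)) x * (∂_{m 0} b) x := by
      intro a
      rw [integral_mul_lineDerivOp_right_eq_neg_left, neg_neg]
      rfl
    simp_rw [e]
    exact this.neg

lemma continuous_deriv_eval (L : 𝓢(E, ℂ) →ₗ[ℂ] 𝓢(E, ℂ))
    (h : ∀ b : 𝓢(E, ℂ), Continuous fun a => ∫ x, L a x * b x) (n : ℕ) (m : Fin n → E) (x : E) :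
    Continuous fun a => (∂^{m} (L a)) x := by
  have := barrelled_schwartz (E := E)
  let φ : ℕ → ContDiffBump (0 : E) := fun j =>
    ⟨1 / ((j : ℝ) + 2), 1 / ((j : ℝ) + 1), by positivity,
      one_div_lt_one_div_of_lt (by positivity) (by linarith)⟩
  have hφ : Tendsto (fun j => (φ j).rOut) atTop (𝓝 0) := tendsto_one_div_add_atTop_nhds_zero_nat
  have hsm : ∀ j, ContDiff ℝ ∞ fun y => (((φ j).normed volume (x - y) : ℝ) : ℂ) := fun j =>
    Complex.ofRealCLM.contDiff.comp ((φ j).contDiff_normed.comp (contDiff_const.sub contDiff_id))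
  have hcs : ∀ j, HasCompactSupport fun y => (((φ j).normed volume (x - y) : ℝ) : ℂ) := fun j =>
    (((φ j).hasCompactSupport_normed (μ := volume)).comp_homeomorph (Homeomorph.subLeft x)).comp_left
      Complex.ofReal_zero
  let b : ℕ → 𝓢(E, ℂ) := fun j => (hcs j).toSchwartzMap (hsm j)
  have hb : ∀ s : 𝓢(E, ℂ), Tendsto (fun j => ∫ y, s y * b j y) atTop (𝓝 (s x)) := by
    intro s
    have h1 := ContDiffBump.convolution_tendsto_right_of_continuous (μ := (volume : Measure E)) hφ
      s.continuous x
    refine h1.congr fun j => ?_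
    rw [convolution_def, ← integral_sub_left_eq_self _ _ x]
    congr 1; ext y
    simp [b]; ring
  let G : ℕ → 𝓢(E, ℂ) →L[ℂ] ℂ := fun j =>
    { toFun := fun a => ∫ y, (∂^{m} (L a)) y * b j y
      map_add' := fun a a' => by
        simp only [map_add, iteratedLineDerivOp_add, add_apply, add_mul]
        exact integral_add (integrable_mul_schwartz _ _) (integrable_mul_schwartz _ _)
      map_smul' := fun r a => by
        simp only [map_smul, iteratedLineDerivOp_smul, smul_apply, smul_eq_mul, mul_assoc,
          RingHom.id_apply]
        exact integral_const_mul _ _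
      cont := continuous_weak_deriv L h n m (b j) }
  exact (continuousLinearMapOfTendsto G (f := fun a => (∂^{m} (L a)) x)
    (tendsto_pi_nhds.2 fun a => hb _)).continuous

/-- A closed graph theorem for the Schwartz space. -/
lemma continuous_of_weak (L : 𝓢(E, ℂ) →ₗ[ℂ] 𝓢(E, ℂ))
    (h : ∀ b : 𝓢(E, ℂ), Continuous fun a => ∫ x, L a x * b x) : Continuous L := by
  have := barrelled_schwartz (E := E)
  refine continuous_of_seminorm_le L fun k n => ?_
  let Λ : E × (Fin n → E) → 𝓢(E, ℂ) →ₗ[ℂ] ℂ := fun i =>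
    { toFun := fun a => ((‖i.1‖ ^ k * (∏ j, ‖i.2 j‖)⁻¹ : ℝ) : ℂ) * (∂^{i.2} (L a)) i.1
      map_add' := fun a a' => by
        simp only [map_add, iteratedLineDerivOp_add, add_apply, mul_add]
      map_smul' := fun r a => by
        simp only [map_smul, iteratedLineDerivOp_smul, smul_apply, smul_eq_mul, RingHom.id_apply]
        ring }
  let p : E × (Fin n → E) → Seminorm ℂ 𝓢(E, ℂ) := fun i => (normSeminorm ℂ ℂ).comp (Λ i)
  have hp : ∀ i a, p i a = ‖i.1‖ ^ k * (∏ j, ‖i.2 j‖)⁻¹ * ‖iteratedFDeriv ℝ n (L a) i.1 i.2‖ := by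
    intro i a
    change ‖((‖i.1‖ ^ k * (∏ j, ‖i.2 j‖)⁻¹ : ℝ) : ℂ) * (∂^{i.2} (L a)) i.1‖ = _
    rw [norm_mul, Complex.norm_real, iteratedLineDerivOp_eq_iteratedFDeriv, Real.norm_of_nonneg]
    positivity
  have hle : ∀ i a, p i a ≤ SchwartzMap.seminorm ℂ k n (L a) := by
    intro i a
    rw [hp]
    refine le_trans ?_ ((L a).le_seminorm ℂ k n i.1)
    rw [mul_assoc]
    gcongr
    rcases (Finset.prod_nonneg fun j _ => norm_nonneg (i.2 j) :
      0 ≤ ∏ j, ‖i.2 j‖).eq_or_lt with h0 | h0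
    · rw [← h0, inv_zero, zero_mul]; exact norm_nonneg _
    · rw [inv_mul_le_iff₀ h0, mul_comm]
      exact ContinuousMultilinearMap.le_opNorm _ _
  have hbdd : BddAbove (Set.range p) := by
    rw [Seminorm.bddAbove_range_iff]
    intro a
    exact ⟨_, by rintro _ ⟨i, rfl⟩; exact hle i a⟩
  have hcont : Continuous (⨆ i, p i : Seminorm ℂ 𝓢(E, ℂ)) := by
    rw [Seminorm.coe_iSup_eq hbdd]
    refine Seminorm.continuous_iSup p (fun i => ?_) hbdd
    exact continuous_norm.comp (continuous_const.mul (continuous_deriv_eval L h n i.2 i.1))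
  refine ⟨(⨆ i, p i : Seminorm ℂ 𝓢(E, ℂ)), hcont, map_zero _, fun a => ?_⟩
  have hpi : ∀ i, p i a ≤ (⨆ i, p i : Seminorm ℂ 𝓢(E, ℂ)) a := by
    intro i
    rw [Seminorm.iSup_apply hbdd]
    exact le_ciSup (Seminorm.bddAbove_range_iff.1 hbdd a) i
  refine seminorm_le_bound ℂ k n _ (apply_nonneg _ _) fun x => ?_
  have h1 : ‖x‖ ^ k * ‖iteratedFDeriv ℝ n (L a) x‖ = ‖(‖x‖ ^ k) • iteratedFDeriv ℝ n (L a) x‖ := by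
    rw [norm_smul, Real.norm_of_nonneg (by positivity)]
  rw [h1]
  refine ContinuousMultilinearMap.opNorm_le_bound (apply_nonneg _ _) fun m => ?_
  have := hpi (x, m)
  rw [hp] at this
  change ‖(‖x‖ ^ k) • iteratedFDeriv ℝ n (L a) x m‖ ≤ _
  rw [norm_smul, Real.norm_of_nonneg (by positivity)]
  rcases (Finset.prod_nonneg fun j _ => norm_nonneg (m j) :
      0 ≤ ∏ j, ‖m j‖).eq_or_lt with h0 | h0
  · obtain ⟨j, -, hj⟩ := Finset.prod_eq_zero_iff.1 h0.symm
    rw [ContinuousMultilinearMap.map_coord_zero _ j (norm_eq_zero.1 hj), norm_zero, mul_zero]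
    exact mul_nonneg (apply_nonneg _ _) h0.le
  · rw [← div_le_iff₀ h0]
    refine le_trans (le_of_eq ?_) this
    simp only; ring

end ClosedGraph


section Approx

variable {E : Type*} [NormedAddCommGroup E] [InnerProductSpace ℝ E] [FiniteDimensional ℝ E]
  [MeasurableSpace E] [BorelSpace E]

lemma seminorm_succ_zero_le (k : ℕ) (f : 𝓢(E, ℂ)) : SchwartzMap.seminorm ℂ (k + 1) 0 f ≤
    ∑ i, SchwartzMap.seminorm ℂ k 0 (mulLin (stdOrthonormalBasis ℝ E i) f) := by
  set b := stdOrthonormalBasis ℝ E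
  refine seminorm_le_bound ℂ _ _ _ (Finset.sum_nonneg fun i _ => apply_nonneg _ _) fun x => ?_
  rw [norm_iteratedFDeriv_zero]
  have hx : ‖x‖ ≤ ∑ i, ‖((inner ℝ (b i) x : ℝ) : ℂ)‖ := by
    conv_lhs => rw [← b.sum_repr' x]
    refine (norm_sum_le _ _).trans (Finset.sum_le_sum fun i _ => ?_)
    rw [norm_smul, b.norm_eq_one, mul_one, Complex.norm_real]
  calc ‖x‖ ^ (k + 1) * ‖f x‖
      ≤ (∑ i, ‖((inner ℝ (b i) x : ℝ) : ℂ)‖) * (‖x‖ ^ k * ‖f x‖) := by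
        rw [pow_succ', mul_assoc]; gcongr
    _ = ∑ i, ‖x‖ ^ k * ‖mulLin (b i) f x‖ := by
        rw [Finset.sum_mul]; refine Finset.sum_congr rfl fun i _ => ?_
        rw [mulLin_apply, norm_mul]; ring
    _ ≤ _ := by
        refine Finset.sum_le_sum fun i _ => ?_
        have := (mulLin (b i) f).le_seminorm ℂ k 0 x
        rwa [norm_iteratedFDeriv_zero] at this

lemma fderiv_schwartz_eq (f : 𝓢(E, ℂ)) :
    fderiv ℝ f = fun x => ∑ i, (∂_{stdOrthonormalBasis ℝ E i} f) x •
        (Complex.ofRealCLM.comp (innerSL ℝ (stdOrthonormalBasis ℝ E i))) := by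
  ext x w
  conv_lhs => rw [← (stdOrthonormalBasis ℝ E).sum_repr' w]
  rw [map_sum, _root_.sum_apply]
  refine Finset.sum_congr rfl fun i _ => ?_
  rw [map_smul, lineDerivOp_apply_eq_fderiv]
  simp
  ring

lemma seminorm_succ_right_le (k n : ℕ) (f : 𝓢(E, ℂ)) : SchwartzMap.seminorm ℂ k (n + 1) f ≤
    ∑ i, SchwartzMap.seminorm ℂ k n (∂_{stdOrthonormalBasis ℝ E i} f) := by
  set b := stdOrthonormalBasis ℝ E with hb
  refine seminorm_le_bound ℂ _ _ _ (Finset.sum_nonneg fun i _ => apply_nonneg _ _) fun x => ?_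
  have hn : ‖iteratedFDeriv ℝ (n + 1) f x‖ ≤ ∑ i, ‖iteratedFDeriv ℝ n (∂_{b i} f : 𝓢(E, ℂ)) x‖ := by
    have hs : ∀ i, ContDiff ℝ n (∂_{b i} f : 𝓢(E, ℂ)) := fun i => (∂_{b i} f : 𝓢(E, ℂ)).smooth n
    have hs' : ∀ i, ContDiff ℝ n (fun x => (∂_{b i} f) x •
        (Complex.ofRealCLM.comp (innerSL ℝ (b i)))) :=
      fun i => (hs i).smul contDiff_const
    rw [← norm_iteratedFDeriv_fderiv, fderiv_schwartz_eq,
      iteratedFDeriv_fun_sum_apply fun i _ => (hs' i).contDiffAt]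
    refine (norm_sum_le _ _).trans (Finset.sum_le_sum fun i _ => ?_)
    set L : E →L[ℝ] ℂ := Complex.ofRealCLM.comp (innerSL ℝ (b i))
    have hL : ‖L‖ ≤ 1 := by
      refine (ContinuousLinearMap.opNorm_comp_le _ _).trans ?_
      rw [Complex.ofRealCLM_norm, one_mul, innerSL_apply_norm, b.norm_eq_one]
    set Λ : ℂ →L[ℝ] (E →L[ℝ] ℂ) := (ContinuousLinearMap.lsmul ℝ ℂ).flip L
    have hΛ : ‖Λ‖ ≤ 1 := ContinuousLinearMap.opNorm_le_bound _ zero_le_one fun z => by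
      change ‖z • L‖ ≤ _
      rw [norm_smul, one_mul]
      exact mul_le_of_le_one_right (norm_nonneg _) hL
    have h1 := Λ.norm_iteratedFDeriv_comp_left (x := x) (hs i).contDiffAt le_rfl
    exact h1.trans (mul_le_of_le_one_left (norm_nonneg _) hΛ)
  calc _ ≤ ‖x‖ ^ k * ∑ i, ‖iteratedFDeriv ℝ n (∂_{b i} f : 𝓢(E, ℂ)) x‖ := by gcongr
    _ ≤ _ := by
      rw [Finset.mul_sum]
      exact Finset.sum_le_sum fun i _ => (∂_{b i} f : 𝓢(E, ℂ)).le_seminorm ℂ k n x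

lemma mulLin_twistS (T : E ≃L[ℝ] E) (a B : 𝓢(E, ℂ)) (v : E) :
    mulLin v (twistS T a B) = twistS T (mulLin v a) B - twistS T a (mulLin v B) := by
  ext x
  rw [mulLin_apply, sub_apply]
  exact mulLin_twist T a B v x

lemma deriv_twistS (T : E ≃L[ℝ] E) (a B : 𝓢(E, ℂ)) (w : E) :
    ∂_{w} (twistS T a B) = twistS T (∂_{w} a) B + twistS T a (mulDer T w B) := by
  ext x
  rw [lineDerivOp_apply_eq_fderiv, add_apply]
  exact (hasFDerivAt_twist T a B x).2 w

/-- A sequence of Schwartz functions concentrating at the origin with total mass tending to `c`. -/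
def Conc (B : ℕ → 𝓢(E, ℂ)) (c : ℂ) : Prop :=
  (∀ m, Tendsto (fun j => ∫ y, ‖y‖ ^ (m + 1) * ‖B j y‖) atTop (𝓝 0)) ∧
    Tendsto (fun j => ∫ y, B j y) atTop (𝓝 c)

lemma Conc.mulLin {B : ℕ → 𝓢(E, ℂ)} {c : ℂ} (h : Conc B c) (v : E) :
    Conc (fun j => Moyal.mulLin v (B j)) 0 := by
  have hv : ∀ j y, ‖Moyal.mulLin v (B j) y‖ ≤ ‖v‖ * (‖y‖ * ‖B j y‖) := by
    intro j y
    rw [mulLin_apply, norm_mul, Complex.norm_real, ← mul_assoc]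
    gcongr
    exact norm_inner_le_norm v y
  have key : ∀ m, Tendsto (fun j => ∫ y, ‖y‖ ^ m * ‖Moyal.mulLin v (B j) y‖) atTop (𝓝 0) := by
    intro m
    have h1 := (h.1 m).const_mul ‖v‖
    rw [mul_zero] at h1
    refine squeeze_zero (fun j => integral_nonneg fun y => by positivity) (fun j => ?_) h1
    rw [← integral_const_mul]
    refine integral_mono ((Moyal.mulLin v (B j)).integrable_pow_mul volume m)
      (((B j).integrable_pow_mul volume (m + 1)).const_mul _) fun y => ?_
    calc ‖y‖ ^ m * ‖Moyal.mulLin v (B j) y‖ ≤ ‖y‖ ^ m * (‖v‖ * (‖y‖ * ‖B j y‖)) := by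
          gcongr; exact hv j y
      _ = _ := by ring
  refine ⟨fun m => key (m + 1), ?_⟩
  refine squeeze_zero_norm (fun j => ?_) (key 0)
  refine (norm_integral_le_integral_norm _).trans (le_of_eq ?_)
  simp

lemma Conc.mulDer {B : ℕ → 𝓢(E, ℂ)} {c : ℂ} (h : Conc B c) (T : E ≃L[ℝ] E) (w : E) :
    Conc (fun j => Moyal.mulDer T w (B j)) 0 := by
  have h1 := h.mulLin (ContinuousLinearMap.adjoint (T : E →L[ℝ] E) w)
  have hv : ∀ j y, Moyal.mulDer T w (B j) y = (2 * Real.pi * Complex.I : ℂ) *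
      Moyal.mulLin (ContinuousLinearMap.adjoint (T : E →L[ℝ] E) w) (B j) y := fun j y => rfl
  refine ⟨fun m => ?_, ?_⟩
  · have := (h1.1 m).const_mul ‖(2 * Real.pi * Complex.I : ℂ)‖
    rw [mul_zero] at this
    refine this.congr fun j => ?_
    rw [← integral_const_mul]
    congr 1; ext y
    rw [hv, norm_mul _ (Moyal.mulLin _ _ _)]; ring
  · have := h1.2.const_mul (2 * Real.pi * Complex.I : ℂ)
    rw [mul_zero] at this
    refine this.congr fun j => ?_
    rw [← integral_const_mul]
    rfl

lemma norm_wave_sub_one (T : E ≃L[ℝ] E) (y x : E) :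
    ‖wave T y x - 1‖ ≤ 2 * Real.pi * ‖(T : E →L[ℝ] E)‖ * ‖y‖ * ‖x‖ := by
  unfold wave
  rw [mul_comm _ Complex.I]
  refine (Real.norm_exp_I_mul_ofReal_sub_one_le).trans ?_
  rw [norm_mul, norm_mul, Real.norm_ofNat, Real.norm_of_nonneg Real.pi_pos.le, mul_assoc, mul_assoc,
    mul_assoc, mul_assoc]
  gcongr
  refine (norm_inner_le_norm _ _).trans ?_
  rw [← mul_assoc]
  gcongr
  exact (T : E →L[ℝ] E).le_opNorm y

lemma norm_schwartz_sub_le (a : 𝓢(E, ℂ)) (x y : E) :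
    ‖a (x + y) - a x‖ ≤ SchwartzMap.seminorm ℂ 0 1 a * ‖y‖ := by
  have := Convex.norm_image_sub_le_of_norm_fderiv_le (𝕜 := ℝ) (f := a) (s := Set.univ)
    (C := SchwartzMap.seminorm ℂ 0 1 a) (fun z _ => a.differentiableAt) (fun z _ => ?_)
    convex_univ (Set.mem_univ x) (Set.mem_univ (x + y))
  · simpa using this
  · have := a.norm_iteratedFDeriv_le_seminorm ℂ 1 z
    rwa [norm_iteratedFDeriv_one] at this

lemma Conc.tendsto_zero_zero (T : E ≃L[ℝ] E) {B : ℕ → 𝓢(E, ℂ)} {c : ℂ} (h : Conc B c)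
    (a : 𝓢(E, ℂ)) : Tendsto (fun j => SchwartzMap.seminorm ℂ 0 0 (twistS T a (B j) - c • a))
      atTop (𝓝 0) := by
  set K := SchwartzMap.seminorm ℂ 0 1 a + 2 * Real.pi * ‖(T : E →L[ℝ] E)‖ *
    SchwartzMap.seminorm ℂ 1 0 a with hK
  have hK0 : 0 ≤ K := add_nonneg (apply_nonneg _ _)
    (mul_nonneg (by positivity) (apply_nonneg _ _))
  have hlim : Tendsto (fun j => K * (∫ y, ‖y‖ ^ (0 + 1) * ‖B j y‖) +
      SchwartzMap.seminorm ℂ 0 0 a * ‖(∫ y, B j y) - c‖) atTop (𝓝 0) := by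
    have h1 := (h.1 0).const_mul K
    have h2 := ((h.2.sub_const c).norm).const_mul (SchwartzMap.seminorm ℂ 0 0 a)
    simpa using h1.add h2
  refine squeeze_zero (fun j => apply_nonneg _ _) (fun j => ?_) hlim
  refine seminorm_le_bound ℂ _ _ _ ?_ fun x => ?_
  · exact add_nonneg (mul_nonneg hK0 (integral_nonneg fun y => by positivity))
      (mul_nonneg (apply_nonneg _ _) (norm_nonneg _))
  rw [norm_iteratedFDeriv_zero, pow_zero, one_mul, sub_apply, smul_apply, smul_eq_mul,
    twistS_apply, twist]
  have e : (∫ y, a (x + y) * B j y * wave T y x) - c * a x =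
      (∫ y, (a (x + y) * wave T y x - a x) * B j y) + a x * ((∫ y, B j y) - c) := by
    have h1 : (fun y => (a (x + y) * wave T y x - a x) * B j y) =
        fun y => a (x + y) * B j y * wave T y x - a x * B j y := by ext y; ring
    rw [h1, integral_sub (integrable_twist T _ _ x) ((B j).integrable.const_mul _),
      integral_const_mul]
    ring
  rw [e]
  refine (norm_add_le _ _).trans (add_le_add ?_ ?_)
  · rw [← integral_const_mul]
    refine norm_integral_le_of_norm_le (((B j).integrable_pow_mul volume (0 + 1)).const_mul _)
      (Eventually.of_forall fun y => ?_)
    rw [norm_mul, ← mul_assoc]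
    gcongr
    have e2 : a (x + y) * wave T y x - a x =
        (a (x + y) - a x) * wave T y x + a x * (wave T y x - 1) := by ring
    rw [e2]
    refine (norm_add_le _ _).trans ?_
    rw [norm_mul, norm_mul, norm_wave, mul_one, hK, add_mul, zero_add, pow_one]
    refine add_le_add (norm_schwartz_sub_le a x y) ?_
    have h3 := a.le_seminorm ℂ 1 0 x
    rw [norm_iteratedFDeriv_zero, pow_one] at h3
    calc ‖a x‖ * ‖wave T y x - 1‖ ≤ ‖a x‖ * (2 * Real.pi * ‖(T : E →L[ℝ] E)‖ * ‖y‖ * ‖x‖) := by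
          gcongr; exact norm_wave_sub_one T y x
      _ = 2 * Real.pi * ‖(T : E →L[ℝ] E)‖ * (‖x‖ * ‖a x‖) * ‖y‖ := by ring
      _ ≤ _ := by gcongr
  · rw [norm_mul]
    gcongr
    exact norm_le_seminorm ℂ a x

lemma Conc.tendsto_seminorm (T : E ≃L[ℝ] E) (k n : ℕ) :
    ∀ (B : ℕ → 𝓢(E, ℂ)) (c : ℂ), Conc B c → ∀ a : 𝓢(E, ℂ),
    Tendsto (fun j => SchwartzMap.seminorm ℂ k n (twistS T a (B j) - c • a)) atTop (𝓝 0) := by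
  induction n with
  | zero =>
    induction k with
    | zero => exact fun B c h a => h.tendsto_zero_zero T a
    | succ k ih =>
      intro B c h a
      set b := stdOrthonormalBasis ℝ E with hb
      have h1 : Tendsto (fun j => ∑ i,
          (SchwartzMap.seminorm ℂ k 0 (twistS T (Moyal.mulLin (b i) a) (B j) -
            c • Moyal.mulLin (b i) a) +
          SchwartzMap.seminorm ℂ k 0 (twistS T a (Moyal.mulLin (b i) (B j)) - (0 : ℂ) • a)))
          atTop (𝓝 0) := by
        have := tendsto_finsetSum Finset.univ fun i _ =>
          (ih B c h (Moyal.mulLin (b i) a)).add (ih _ 0 (h.mulLin (b i)) a)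
        simpa using this
      refine squeeze_zero (fun j => apply_nonneg _ _) (fun j => ?_) h1
      refine (seminorm_succ_zero_le k _).trans (Finset.sum_le_sum fun i _ => ?_)
      rw [map_sub, map_smul, mulLin_twistS, zero_smul, sub_zero, sub_right_comm]
      exact map_sub_le_add _ _ _
  | succ n ih =>
    intro B c h a
    set b := stdOrthonormalBasis ℝ E with hb
    have h1 : Tendsto (fun j => ∑ i,
        (SchwartzMap.seminorm ℂ k n (twistS T (∂_{b i} a) (B j) - c • ∂_{b i} a) +
        SchwartzMap.seminorm ℂ k n (twistS T a (Moyal.mulDer T (b i) (B j)) - (0 : ℂ) • a)))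
        atTop (𝓝 0) := by
      have := tendsto_finsetSum Finset.univ fun i _ =>
        (ih B c h (∂_{b i} a)).add (ih _ 0 (h.mulDer T (b i)) a)
      simpa using this
    refine squeeze_zero (fun j => apply_nonneg _ _) (fun j => ?_) h1
    refine (seminorm_succ_right_le k n _).trans (Finset.sum_le_sum fun i _ => ?_)
    have e : ∂_{b i} (twistS T a (B j) - c • a) = (twistS T (∂_{b i} a) (B j) - c • ∂_{b i} a) +
        (twistS T a (Moyal.mulDer T (b i) (B j)) - (0 : ℂ) • a) := by
      have := map_sub (lineDerivOpCLM ℂ 𝓢(E, ℂ) (b i)) (twistS T a (B j)) (c • a)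
      rw [map_smul] at this
      simp only [lineDerivOpCLM_apply] at this
      rw [this, deriv_twistS]
      simp only [zero_smul, sub_zero]; abel
    rw [e]
    exact map_add_le_add _ _ _

lemma Conc.tendsto (T : E ≃L[ℝ] E) {B : ℕ → 𝓢(E, ℂ)} {c : ℂ} (h : Conc B c) (a : 𝓢(E, ℂ)) :
    Tendsto (fun j => twistS T a (B j)) atTop (𝓝 (c • a)) := by
  refine ((schwartz_withSeminorms ℂ E ℂ).tendsto_nhds _ _).2 ?_
  rintro ⟨k, n⟩ ε hε
  exact (Conc.tendsto_seminorm T k n B c h a).eventually_lt_const hε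

lemma exists_conc : ∃ B : ℕ → 𝓢(E, ℂ), Conc B 1 := by
  let φ : ℕ → ContDiffBump (0 : E) := fun j =>
    ⟨1 / ((j : ℝ) + 2), 1 / ((j : ℝ) + 1), by positivity,
      one_div_lt_one_div_of_lt (by positivity) (by linarith)⟩
  have hφ : Tendsto (fun j => (φ j).rOut) atTop (𝓝 0) := tendsto_one_div_add_atTop_nhds_zero_nat
  have hsm : ∀ j, ContDiff ℝ ∞ fun y => (((φ j).normed volume y : ℝ) : ℂ) := fun j =>
    Complex.ofRealCLM.contDiff.comp (φ j).contDiff_normed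
  have hcs : ∀ j, HasCompactSupport fun y => (((φ j).normed volume y : ℝ) : ℂ) := fun j =>
    (((φ j).hasCompactSupport_normed (μ := volume))).comp_left Complex.ofReal_zero
  let b : ℕ → 𝓢(E, ℂ) := fun j => (hcs j).toSchwartzMap (hsm j)
  have hb : ∀ j y, b j y = (((φ j).normed volume y : ℝ) : ℂ) := fun j y => rfl
  have hn : ∀ j y, ‖b j y‖ = (φ j).normed volume y := fun j y => by
    rw [hb, Complex.norm_real, Real.norm_of_nonneg ((φ j).nonneg_normed y)]
  refine ⟨b, fun m => ?_, ?_⟩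
  · have h1 := hφ.pow (m + 1)
    rw [zero_pow (by omega)] at h1
    refine squeeze_zero (fun j => integral_nonneg fun y => by positivity) (fun j => ?_) h1
    have h2 : ∫ y, (φ j).rOut ^ (m + 1) * (φ j).normed volume y = (φ j).rOut ^ (m + 1) := by
      rw [integral_const_mul, (φ j).integral_normed, mul_one]
    rw [← h2]
    refine integral_mono ((b j).integrable_pow_mul volume (m + 1))
      ((φ j).integrable_normed.const_mul _) fun y => ?_
    beta_reduce
    rw [hn]
    by_cases hy : y ∈ Metric.ball (0 : E) (φ j).rOut
    · have := mem_ball_zero_iff.1 hy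
      have := (φ j).nonneg_normed (μ := volume) y
      gcongr
    · rw [← (φ j).support_normed_eq (μ := volume), Function.mem_support, not_not] at hy
      rw [hy, mul_zero, mul_zero]
  · have : ∀ j, ∫ y, b j y = 1 := fun j => by
      simp_rw [hb]
      rw [integral_complex_ofReal, (φ j).integral_normed, Complex.ofReal_one]
    simp_rw [this]
    exact tendsto_const_nhds

lemma cst_ne_zero (T : E ≃L[ℝ] E) : cst T ≠ 0 := by
  have hdet : LinearMap.det (T : E →ₗ[ℝ] E) ≠ 0 := (LinearEquiv.isUnit_det' T.toLinearEquiv).ne_zero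
  exact Complex.ofReal_ne_zero.2 (abs_ne_zero.2 hdet)

lemma sft_surjective (T : E ≃L[ℝ] E) (B : 𝓢(E, ℂ)) : ∃ b, sft T b = B := by
  refine ⟨𝓕⁻ (compCLMOfContinuousLinearEquiv ℂ T.symm B), ?_⟩
  ext x
  change (𝓕 (𝓕⁻ (compCLMOfContinuousLinearEquiv ℂ T.symm B)) : 𝓢(E, ℂ)) (T x) = B x
  rw [FourierInvPair.fourier_fourierInv_eq]
  change B (T.symm (T x)) = _
  rw [T.symm_apply_apply]

/-- Products are dense in the Schwartz space. -/
lemma eq_of_starS (T : E ≃L[ℝ] E) {u v : 𝓢(E, ℂ) → ℂ} (hu : Continuous u) (hv : Continuous v)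
    (h : ∀ a b, u (starS T a b) = v (starS T a b)) (a : 𝓢(E, ℂ)) : u a = v a := by
  obtain ⟨B, hB⟩ := exists_conc (E := E)
  choose c hc using fun j => sft_surjective T (B j)
  have h1 : Tendsto (fun j => starS T ((cst T)⁻¹ • a) (c j)) atTop (𝓝 a) := by
    have h2 := (hB.tendsto T a)
    rw [one_smul] at h2
    refine h2.congr fun j => ?_
    rw [starS, hc, twistS_smul_left, smul_smul, mul_inv_cancel₀ (cst_ne_zero T), one_smul]
  have h2 := (hu.tendsto a).comp h1
  have h3 := (hv.tendsto a).comp h1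
  refine tendsto_nhds_unique h2 (h3.congr fun j => (h _ _).symm)

end Approx

section Star

/-- The index set of the `D = 2n` coordinates: `(i, k)` is the `i`-th coordinate of the `k`-th
`2 × 2` block. -/
abbrev Idx (n : ℕ) : Type := Fin 2 × Fin n

/-- The Euclidean space `ℝ^D`, `D = 2n`. -/
abbrev Space (n : ℕ) : Type := EuclideanSpace ℝ (Idx n)

/-- The block-diagonal matrix `Σ = diag(J, …, J)`, `J = (0 -1; 1 0)`. -/
def sigmaMatrix (n : ℕ) : Matrix (Idx n) (Idx n) ℝ :=
  Matrix.blockDiagonal fun _ : Fin n => !![0, -1; 1, 0]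

/-- The matrix `Θ = θ Σ`. -/
noncomputable def thetaMatrix (n : ℕ) (θ : ℝ) : Matrix (Idx n) (Idx n) ℝ := θ • sigmaMatrix n

/-- The Moyal product
`(a ⋆ b)(x) = (πθ)^{-D} ∫∫ a(x + y) b(x + z) exp(-2i y Θ⁻¹ z) dy dz`. -/
noncomputable def moyalProduct {n : ℕ} (θ : ℝ) (a b : Space n → ℂ) (x : Space n) : ℂ :=
  (((Real.pi * θ) ^ (2 * n) : ℝ) : ℂ)⁻¹ * ∫ y : Space n, ∫ z : Space n,
    a (x + y) * b (x + z) *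
      Complex.exp (-2 * Complex.I *
        ((∑ μ, ∑ ν, y μ * (thetaMatrix n θ)⁻¹ μ ν * z ν : ℝ) : ℂ))

lemma sigmaMatrix_mul_self (n : ℕ) : sigmaMatrix n * sigmaMatrix n = -1 := by
  unfold sigmaMatrix
  rw [← Matrix.blockDiagonal_mul]
  have : (fun _ : Fin n => (!![0, -1; 1, 0] : Matrix (Fin 2) (Fin 2) ℝ) * !![0, -1; 1, 0]) =
      -1 := by
    ext k i j
    fin_cases i <;> fin_cases j <;> simp [Matrix.mul_apply]
  rw [this, Matrix.blockDiagonal_neg, Matrix.blockDiagonal_one]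

lemma sigmaMatrix_transpose (n : ℕ) : (sigmaMatrix n).transpose = -sigmaMatrix n := by
  unfold sigmaMatrix
  rw [Matrix.blockDiagonal_transpose, ← Matrix.blockDiagonal_neg]
  congr 1
  ext k i j
  fin_cases i <;> fin_cases j <;> simp

lemma sigmaMatrix_swap (n : ℕ) (μ ν : Idx n) : sigmaMatrix n ν μ = -sigmaMatrix n μ ν := by
  have := congrFun (congrFun (sigmaMatrix_transpose n) μ) ν
  simpa using this

lemma det_sigmaMatrix (n : ℕ) : (sigmaMatrix n).det = 1 := by
  unfold sigmaMatrix
  rw [Matrix.det_blockDiagonal]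
  simp [Matrix.det_fin_two]

lemma thetaMatrix_inv (n : ℕ) (θ : ℝ) [NeZero θ] :
    (thetaMatrix n θ)⁻¹ = (-θ⁻¹) • sigmaMatrix n := by
  refine Matrix.inv_eq_right_inv ?_
  rw [thetaMatrix, smul_mul_smul_comm, sigmaMatrix_mul_self, mul_neg,
    mul_inv_cancel₀ (NeZero.ne θ)]
  simp

lemma thetaMatrix_swap (n : ℕ) (θ : ℝ) (μ ν : Idx n) :
    thetaMatrix n θ ν μ = -thetaMatrix n θ μ ν := by
  simp [thetaMatrix, sigmaMatrix_swap n μ ν]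

lemma thetaMatrix_inv_swap (n : ℕ) (θ : ℝ) [NeZero θ] (μ ν : Idx n) :
    (thetaMatrix n θ)⁻¹ ν μ = -(thetaMatrix n θ)⁻¹ μ ν := by
  simp [thetaMatrix_inv, sigmaMatrix_swap n μ ν]

lemma thetaMatrix_mul_inv (n : ℕ) (θ : ℝ) [NeZero θ] :
    thetaMatrix n θ * (thetaMatrix n θ)⁻¹ = 1 := by
  rw [thetaMatrix_inv, thetaMatrix, smul_mul_smul_comm, sigmaMatrix_mul_self, mul_neg,
    mul_inv_cancel₀ (NeZero.ne θ)]
  simp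

/-- The map `T` with `⟨T y, z⟩ = π⁻¹ y Θ⁻¹ z`. -/
noncomputable def symp (n : ℕ) (θ : ℝ) [NeZero θ] : Space n ≃L[ℝ] Space n :=
  (LinearEquiv.ofLinearMap (Matrix.toEuclideanLin ((Real.pi * θ)⁻¹ • sigmaMatrix n))
    (Matrix.toEuclideanLin (-(Real.pi * θ) • sigmaMatrix n))
    (by
      rw [← Matrix.toLpLin_mul_same, smul_mul_smul_comm, sigmaMatrix_mul_self, mul_neg,
        inv_mul_cancel₀ (mul_ne_zero Real.pi_ne_zero (NeZero.ne θ))]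
      simp)
    (by
      rw [← Matrix.toLpLin_mul_same, smul_mul_smul_comm, sigmaMatrix_mul_self, neg_mul,
        mul_inv_cancel₀ (mul_ne_zero Real.pi_ne_zero (NeZero.ne θ))]
      simp)).toContinuousLinearEquiv

variable {n : ℕ} {θ : ℝ} [NeZero θ]

lemma symp_apply (y : Space n) (μ : Idx n) :
    symp n θ y μ = ∑ ν, (Real.pi * θ)⁻¹ * sigmaMatrix n μ ν * y ν := by
  change Matrix.toEuclideanLin ((Real.pi * θ)⁻¹ • sigmaMatrix n) y μ = _
  simp [Matrix.toLpLin_apply, Matrix.mulVec, dotProduct, Finset.mul_sum, mul_assoc]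

lemma inner_symp (y z : Space n) :
    inner ℝ (symp n θ y) z = Real.pi⁻¹ * ∑ μ, ∑ ν, y μ * (thetaMatrix n θ)⁻¹ μ ν * z ν := by
  rw [PiLp.inner_apply, Finset.mul_sum]
  simp_rw [symp_apply, Finset.mul_sum]
  simp only [RCLike.inner_apply, conj_trivial, Finset.mul_sum]
  rw [Finset.sum_comm]
  refine Finset.sum_congr rfl fun μ _ => Finset.sum_congr rfl fun ν _ => ?_
  rw [thetaMatrix_inv, Matrix.smul_apply, sigmaMatrix_swap n μ ν, smul_eq_mul, mul_inv]
  ring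

lemma symp_antisymm (y z : Space n) : inner ℝ (symp n θ y) z = -inner ℝ (symp n θ z) y := by
  rw [inner_symp, inner_symp, Finset.sum_comm, ← mul_neg, ← Finset.sum_neg_distrib]
  refine congrArg _ (Finset.sum_congr rfl fun μ _ => ?_)
  rw [← Finset.sum_neg_distrib]
  refine Finset.sum_congr rfl fun ν _ => ?_
  rw [thetaMatrix_inv_swap n θ μ ν]; ring

lemma cst_symp : cst (symp n θ) = (((Real.pi * θ) ^ (2 * n) : ℝ) : ℂ)⁻¹ := by
  unfold cst
  rw [← Complex.ofReal_inv]
  congr 1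
  change |LinearMap.det (Matrix.toLpLin 2 2 ((Real.pi * θ)⁻¹ • sigmaMatrix n))| = _
  rw [Matrix.toLpLin_eq_toLin, LinearMap.det_toLin, Matrix.det_smul, det_sigmaMatrix, mul_one, Fintype.card_prod,
    Fintype.card_fin, Fintype.card_fin, inv_pow, abs_inv, abs_of_nonneg]
  rw [pow_mul]; positivity

lemma wave_symp (y z : Space n) : wave (symp n θ) (-y) z = Complex.exp (-2 * Complex.I *
        ((∑ μ, ∑ ν, y μ * (thetaMatrix n θ)⁻¹ μ ν * z ν : ℝ) : ℂ)) := by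
  unfold wave
  rw [map_neg, inner_neg_left, inner_symp]
  congr 1
  have h : (Real.pi : ℂ) ≠ 0 := by exact_mod_cast Real.pi_ne_zero
  push_cast
  field_simp

lemma starS_symp (a b : 𝓢(Space n, ℂ)) : ⇑(starS (symp n θ) a b) = moyalProduct θ a b := by
  ext x
  rw [starS_eq, cst_symp, moyalProduct]
  simp_rw [wave_symp]

/-- The Moyal product of two Schwartz functions, as a Schwartz function. -/
noncomputable def moyalS (θ : ℝ) [NeZero θ] (a b : 𝓢(Space n, ℂ)) : 𝓢(Space n, ℂ) where
  toFun := moyalProduct θ a b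
  smooth' := starS_symp (θ := θ) a b ▸ (starS (symp n θ) a b).smooth'
  decay' := starS_symp (θ := θ) a b ▸ (starS (symp n θ) a b).decay'

lemma moyalS_eq (a b : 𝓢(Space n, ℂ)) : moyalS θ a b = starS (symp n θ) a b := by
  ext x
  rw [starS_symp]; rfl

/-- Left and right multiplication by a Schwartz function, as continuous linear maps. -/
noncomputable def moyalL (θ : ℝ) [NeZero θ] (a : 𝓢(Space n, ℂ)) :
    𝓢(Space n, ℂ) →L[ℂ] 𝓢(Space n, ℂ) where
  toFun b := moyalS θ a b
  map_add' b b' := by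
    simp only [moyalS_eq, starS, map_add, twistS_add_right, smul_add]
  map_smul' r b := by
    simp only [moyalS_eq, starS, map_smul, twistS_smul_right, RingHom.id_apply]
    rw [smul_comm]
  cont := by
    have : (fun b => moyalS θ a b) =
        fun b => (cst (symp n θ) • (twistR (symp n θ) a).comp (sft (symp n θ))) b := by
      ext1 b; rw [moyalS_eq]; rfl
    change Continuous fun b => moyalS θ a b
    rw [this]
    exact ContinuousLinearMap.continuous _

noncomputable def moyalR (θ : ℝ) [NeZero θ] (b : 𝓢(Space n, ℂ)) :
    𝓢(Space n, ℂ) →L[ℂ] 𝓢(Space n, ℂ) where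
  toFun a := moyalS θ a b
  map_add' a a' := by
    simp only [moyalS_eq, starS, twistS_add_left, smul_add]
  map_smul' r a := by
    simp only [moyalS_eq, starS, twistS_smul_left, RingHom.id_apply]
    rw [smul_comm]
  cont := by
    have : (fun a => moyalS θ a b) =
        fun a => (cst (symp n θ) • (twistL (symp n θ) (sft (symp n θ) b))) a := by
      ext1 a; rw [moyalS_eq]; rfl
    change Continuous fun a => moyalS θ a b
    rw [this]
    exact ContinuousLinearMap.continuous _

@[simp] lemma moyalL_apply (a b : 𝓢(Space n, ℂ)) : moyalL θ a b = moyalS θ a b := rfl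
@[simp] lemma moyalR_apply (a b : 𝓢(Space n, ℂ)) : moyalR θ b a = moyalS θ a b := rfl

lemma moyalS_assoc (a b c : 𝓢(Space n, ℂ)) :
    moyalS θ (moyalS θ a b) c = moyalS θ a (moyalS θ b c) := by
  simp only [moyalS_eq]
  exact starS_assoc _ symp_antisymm a b c

lemma integral_moyalS (a b : 𝓢(Space n, ℂ)) : ∫ x, moyalS θ a b x = ∫ x, a x * b x := by
  rw [moyalS_eq]
  exact integral_starS _ symp_antisymm a b

lemma integral_moyalS_mul (a b c : 𝓢(Space n, ℂ)) :
    ∫ x, moyalS θ a b x * c x = ∫ x, a x * moyalS θ b c x := by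
  simp only [moyalS_eq]
  exact integral_starS_mul _ symp_antisymm a b c

lemma integral_mul_moyalS (a b c : 𝓢(Space n, ℂ)) :
    ∫ x, moyalS θ a b x * c x = ∫ x, b x * moyalS θ c a x := by
  have h : ∀ f g : 𝓢(Space n, ℂ), ∫ x, f x * g x = ∫ x, g x * f x := fun f g => by
    congr 1; ext x; ring
  rw [h, ← integral_moyalS_mul, h]

lemma eq_of_moyalS {u v : 𝓢(Space n, ℂ) → ℂ} (hu : Continuous u) (hv : Continuous v)
    (h : ∀ a b, u (moyalS θ a b) = v (moyalS θ a b)) : u = v :=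
  funext (eq_of_starS (symp n θ) hu hv fun a b => by rw [← moyalS_eq]; exact h a b)

end Star

section Algebra

variable {n : ℕ}

/-- The distribution `T ⋆ a`, `⟨T ⋆ a, b⟩ = ⟨T, a ⋆ b⟩`. -/
noncomputable def distMul (θ : ℝ) [NeZero θ] (T : 𝓢'(Space n, ℂ)) (a : 𝓢(Space n, ℂ)) :
    𝓢'(Space n, ℂ) :=
  PointwiseConvergenceCLM.precomp ℂ (moyalL θ a) T

/-- The distribution `a ⋆ T`, `⟨a ⋆ T, b⟩ = ⟨T, b ⋆ a⟩`. -/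
noncomputable def mulDist (θ : ℝ) [NeZero θ] (a : 𝓢(Space n, ℂ)) (T : 𝓢'(Space n, ℂ)) :
    𝓢'(Space n, ℂ) :=
  PointwiseConvergenceCLM.precomp ℂ (moyalR θ a) T

/-- `ℳ_L = {T ∈ 𝓢' | a ⋆ T ∈ 𝓢 for all a ∈ 𝓢}`. -/
noncomputable def leftMultipliers (n : ℕ) (θ : ℝ) [NeZero θ] : Submodule ℂ 𝓢'(Space n, ℂ) where
  carrier := {T | ∀ a : 𝓢(Space n, ℂ), mulDist θ a T ∈
    Set.range (toTemperedDistributionCLM (Space n) ℂ volume)}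
  add_mem' {S T} hS hT a := by
    obtain ⟨s, hs⟩ := hS a
    obtain ⟨t, ht⟩ := hT a
    exact ⟨s + t, by rw [map_add, hs, ht]; exact (map_add _ _ _).symm⟩
  zero_mem' a := ⟨0, by rw [map_zero]; exact (map_zero _).symm⟩
  smul_mem' c T hT a := by
    obtain ⟨t, ht⟩ := hT a
    exact ⟨c • t, by rw [map_smul, ht]; exact (map_smul _ _ _).symm⟩

/-- `ℳ_R = {T ∈ 𝓢' | T ⋆ a ∈ 𝓢 for all a ∈ 𝓢}`. -/
noncomputable def rightMultipliers (n : ℕ) (θ : ℝ) [NeZero θ] : Submodule ℂ 𝓢'(Space n, ℂ) where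
  carrier := {T | ∀ a : 𝓢(Space n, ℂ), distMul θ T a ∈
    Set.range (toTemperedDistributionCLM (Space n) ℂ volume)}
  add_mem' {S T} hS hT a := by
    obtain ⟨s, hs⟩ := hS a
    obtain ⟨t, ht⟩ := hT a
    exact ⟨s + t, by rw [map_add, hs, ht]; exact (map_add _ _ _).symm⟩
  zero_mem' a := ⟨0, by rw [map_zero]; exact (map_zero _).symm⟩
  smul_mem' c T hT a := by
    obtain ⟨t, ht⟩ := hT a
    exact ⟨c • t, by rw [map_smul, ht]; exact (map_smul _ _ _).symm⟩

/-- The Moyal algebra `ℳ = ℳ_L ∩ ℳ_R`, as a space of tempered distributions. -/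
noncomputable def moyalSubmodule (n : ℕ) (θ : ℝ) [NeZero θ] : Submodule ℂ 𝓢'(Space n, ℂ) :=
  leftMultipliers n θ ⊓ rightMultipliers n θ

/-- The Moyal algebra `ℳ`. -/
abbrev MoyalAlgebra (n : ℕ) (θ : ℝ) [NeZero θ] : Type := moyalSubmodule n θ

lemma schwartz_ext {f g : 𝓢(Space n, ℂ)} (h : ∀ b : 𝓢(Space n, ℂ), ∫ x, f x * b x = ∫ x, g x * b x) :
    f = g := by
  have h1 : toTemperedDistributionCLM (Space n) ℂ volume f =
      toTemperedDistributionCLM (Space n) ℂ volume g := by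
    ext b
    simp only [toTemperedDistributionCLM_apply_apply, smul_eq_mul]
    simpa only [mul_comm] using h b
  rw [← Lp.toTemperedDistribution_toLp_eq (p := 2), ← Lp.toTemperedDistribution_toLp_eq (p := 2),
    ← Lp.toTemperedDistributionCLM_apply, ← Lp.toTemperedDistributionCLM_apply] at h1
  have h2 := LinearMap.ker_eq_bot.1 (Lp.ker_toTemperedDistributionCLM_eq_bot (E := Space n) (F := ℂ)
    (μ := volume) (p := 2)) h1
  exact injective_toLp 2 volume h2

variable {θ : ℝ} [NeZero θ]

lemma mem_moyal_of {T : 𝓢'(Space n, ℂ)} (L R : 𝓢(Space n, ℂ) → 𝓢(Space n, ℂ))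
    (hL : ∀ a b, T (moyalS θ b a) = ∫ x, L a x * b x)
    (hR : ∀ a b, T (moyalS θ a b) = ∫ x, R a x * b x) : T ∈ moyalSubmodule n θ := by
  refine ⟨fun a => ⟨L a, ?_⟩, fun a => ⟨R a, ?_⟩⟩
  · ext b
    simp only [toTemperedDistributionCLM_apply_apply, smul_eq_mul]
    refine Eq.trans ?_ (hL a b).symm
    simp only [mul_comm]
  · ext b
    simp only [toTemperedDistributionCLM_apply_apply, smul_eq_mul]
    refine Eq.trans ?_ (hR a b).symm
    simp only [mul_comm]

/-- The Schwartz function `T ⋆ a`, for `T ∈ ℳ`. -/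
noncomputable def actL (T : MoyalAlgebra n θ) (a : 𝓢(Space n, ℂ)) : 𝓢(Space n, ℂ) :=
  (T.2.2 a).choose

/-- The Schwartz function `a ⋆ T`, for `T ∈ ℳ`. -/
noncomputable def actR (T : MoyalAlgebra n θ) (a : 𝓢(Space n, ℂ)) : 𝓢(Space n, ℂ) :=
  (T.2.1 a).choose

lemma integral_actL (T : MoyalAlgebra n θ) (a b : 𝓢(Space n, ℂ)) :
    ∫ x, actL T a x * b x = T.1 (moyalS θ a b) := by
  have h := congrArg (fun S : 𝓢'(Space n, ℂ) => S b) (T.2.2 a).choose_spec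
  simp only [toTemperedDistributionCLM_apply_apply, smul_eq_mul] at h
  refine Eq.trans ?_ h
  simp only [mul_comm]
  rfl

lemma integral_actR (T : MoyalAlgebra n θ) (a b : 𝓢(Space n, ℂ)) :
    ∫ x, actR T a x * b x = T.1 (moyalS θ b a) := by
  have h := congrArg (fun S : 𝓢'(Space n, ℂ) => S b) (T.2.1 a).choose_spec
  simp only [toTemperedDistributionCLM_apply_apply, smul_eq_mul] at h
  refine Eq.trans ?_ h
  simp only [mul_comm]
  rfl

lemma actL_eq_iff (T : MoyalAlgebra n θ) (a s : 𝓢(Space n, ℂ)) :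
    actL T a = s ↔ ∀ b, T.1 (moyalS θ a b) = ∫ x, s x * b x := by
  refine ⟨fun h b => by rw [← h, integral_actL], fun h => schwartz_ext fun b => ?_⟩
  rw [integral_actL, h]

lemma actR_eq_iff (T : MoyalAlgebra n θ) (a s : 𝓢(Space n, ℂ)) :
    actR T a = s ↔ ∀ b, T.1 (moyalS θ b a) = ∫ x, s x * b x := by
  refine ⟨fun h b => by rw [← h, integral_actR], fun h => schwartz_ext fun b => ?_⟩
  rw [integral_actR, h]

lemma moyalS_add_left (a a' b : 𝓢(Space n, ℂ)) :
    moyalS θ (a + a') b = moyalS θ a b + moyalS θ a' b := map_add (moyalR θ b) a a'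

lemma moyalS_add_right (a b b' : 𝓢(Space n, ℂ)) :
    moyalS θ a (b + b') = moyalS θ a b + moyalS θ a b' := map_add (moyalL θ a) b b'

lemma moyalS_smul_left (r : ℂ) (a b : 𝓢(Space n, ℂ)) :
    moyalS θ (r • a) b = r • moyalS θ a b := map_smul (moyalR θ b) r a

lemma moyalS_smul_right (r : ℂ) (a b : 𝓢(Space n, ℂ)) :
    moyalS θ a (r • b) = r • moyalS θ a b := map_smul (moyalL θ a) r b

lemma actL_add_right (T : MoyalAlgebra n θ) (a a' : 𝓢(Space n, ℂ)) :
    actL T (a + a') = actL T a + actL T a' := by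
  rw [actL_eq_iff]
  intro b
  simp only [moyalS_add_left, map_add, add_apply, add_mul]
  rw [integral_add (integrable_mul_schwartz _ _) (integrable_mul_schwartz _ _), integral_actL,
    integral_actL]

lemma actL_smul_right (T : MoyalAlgebra n θ) (r : ℂ) (a : 𝓢(Space n, ℂ)) :
    actL T (r • a) = r • actL T a := by
  rw [actL_eq_iff]
  intro b
  simp only [moyalS_smul_left, map_smul, smul_apply, smul_eq_mul, mul_assoc]
  rw [integral_const_mul, integral_actL]

/-- `a ↦ T ⋆ a` as a continuous linear map. -/
noncomputable def actLCLM (T : MoyalAlgebra n θ) : 𝓢(Space n, ℂ) →L[ℂ] 𝓢(Space n, ℂ) where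
  toFun := actL T
  map_add' := actL_add_right T
  map_smul' := actL_smul_right T
  cont := by
    refine continuous_of_weak ⟨⟨actL T, actL_add_right T⟩, actL_smul_right T⟩ fun b => ?_
    change Continuous fun a => ∫ x, actL T a x * b x
    simp_rw [integral_actL]
    exact (T.1 : 𝓢(Space n, ℂ) →Lₚₜ[ℂ] ℂ).continuous.comp (moyalR θ b).continuous

@[simp] lemma actLCLM_apply (T : MoyalAlgebra n θ) (a : 𝓢(Space n, ℂ)) :
    actLCLM T a = actL T a := rfl

lemma actL_moyalS (T : MoyalAlgebra n θ) (a b : 𝓢(Space n, ℂ)) :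
    actL T (moyalS θ a b) = moyalS θ (actL T a) b := by
  rw [actL_eq_iff]
  intro c
  rw [integral_moyalS_mul, integral_actL, moyalS_assoc]

lemma actL_actR (T : MoyalAlgebra n θ) (a b : 𝓢(Space n, ℂ)) :
    moyalS θ (actR T a) b = moyalS θ a (actL T b) := by
  refine schwartz_ext fun c => ?_
  rw [integral_moyalS_mul, integral_actR, integral_mul_moyalS, integral_actL, moyalS_assoc]

/-- The product of `ℳ`: `⟨S ⋆ T, a⟩ = ⟨S, T ⋆ a⟩`. -/
noncomputable def moyalMul (S T : MoyalAlgebra n θ) : MoyalAlgebra n θ :=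
  ⟨PointwiseConvergenceCLM.precomp ℂ (actLCLM T) S.1,
    mem_moyal_of (fun a => actR T (actR S a)) (fun a => actL S (actL T a))
      (fun a b => by
        change S.1 (actL T (moyalS θ b a)) = _
        rw [actL_moyalS, ← integral_actR, integral_actR T, ← integral_actL]
        simp only [mul_comm])
      (fun a b => by
        change S.1 (actL T (moyalS θ a b)) = _
        rw [actL_moyalS, integral_actL])⟩

noncomputable instance : Mul (MoyalAlgebra n θ) := ⟨moyalMul⟩

lemma mul_apply (S T : MoyalAlgebra n θ) (a : 𝓢(Space n, ℂ)) : (S * T).1 a = S.1 (actL T a) := rfl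

/-- The unit: integration against the constant function `1`. -/
noncomputable instance : One (MoyalAlgebra n θ) :=
  ⟨⟨(volume : Measure (Space n)).toTemperedDistribution,
    mem_moyal_of (fun a => a) (fun a => a)
      (fun a b => by
        change ∫ x, moyalS θ b a x = _
        rw [integral_moyalS]; congr 1; ext x; ring)
      (fun a b => integral_moyalS a b)⟩⟩

lemma one_apply (a : 𝓢(Space n, ℂ)) : (1 : MoyalAlgebra n θ).1 a = ∫ x, a x := rfl

lemma actL_one (a : 𝓢(Space n, ℂ)) : actL (1 : MoyalAlgebra n θ) a = a := by
  rw [actL_eq_iff]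
  exact fun b => integral_moyalS a b

lemma actL_mul (S T : MoyalAlgebra n θ) (a : 𝓢(Space n, ℂ)) :
    actL (S * T) a = actL S (actL T a) := by
  rw [actL_eq_iff]
  intro b
  rw [mul_apply, actL_moyalS, integral_actL]

lemma actL_add (S T : MoyalAlgebra n θ) (a : 𝓢(Space n, ℂ)) :
    actL (S + T) a = actL S a + actL T a := by
  rw [actL_eq_iff]
  intro b
  simp only [add_apply, add_mul]
  rw [integral_add (integrable_mul_schwartz _ _) (integrable_mul_schwartz _ _), integral_actL,
      integral_actL]
  rfl

lemma actL_smul (r : ℂ) (T : MoyalAlgebra n θ) (a : 𝓢(Space n, ℂ)) :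
    actL (r • T) a = r • actL T a := by
  rw [actL_eq_iff]
  intro b
  simp only [smul_apply, smul_eq_mul, mul_assoc]
  rw [integral_const_mul, integral_actL]
  rfl

lemma moyal_ext {S T : MoyalAlgebra n θ} (h : ∀ a, S.1 a = T.1 a) : S = T :=
  Subtype.ext (DFunLike.ext _ _ h)

lemma moyal_continuous (T : MoyalAlgebra n θ) : Continuous fun a => T.1 a :=
  (T.1 : 𝓢(Space n, ℂ) →Lₚₜ[ℂ] ℂ).continuous

lemma moyal_ext_mul {S T : MoyalAlgebra n θ} (h : ∀ a b, S.1 (moyalS θ a b) = T.1 (moyalS θ a b)) :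
    S = T :=
  moyal_ext fun a => congrFun (eq_of_moyalS (θ := θ) (moyal_continuous S) (moyal_continuous T) h) a

/-- The Moyal algebra is an associative unital algebra. -/
noncomputable instance : Ring (MoyalAlgebra n θ) :=
  { (inferInstance : AddCommGroup (MoyalAlgebra n θ)),
    (inferInstance : Mul (MoyalAlgebra n θ)),
    (inferInstance : One (MoyalAlgebra n θ)) with
    left_distrib := fun R S T => moyal_ext fun a => by
      rw [mul_apply, actL_add]
      exact map_add _ _ _
    right_distrib := fun R S T => moyal_ext fun a => rfl
    zero_mul := fun T => moyal_ext fun a => rfl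
    mul_zero := fun T => moyal_ext fun a => by
      have : actL (0 : MoyalAlgebra n θ) a = 0 := by
        rw [actL_eq_iff]; intro b; simp
      rw [mul_apply, this]
      exact map_zero _
    mul_assoc := fun R S T => moyal_ext fun a => by
      rw [mul_apply, mul_apply, mul_apply, actL_mul]
    mul_one := fun T => moyal_ext fun a => by rw [mul_apply, actL_one]
    one_mul := fun T => moyal_ext_mul fun a b => by
      rw [mul_apply, one_apply, actL_moyalS, integral_moyalS, integral_actL] }

noncomputable instance : Algebra ℂ (MoyalAlgebra n θ) :=
  Algebra.ofModule (fun r S T => moyal_ext fun a => rfl)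
    (fun r S T => moyal_ext fun a => by
      rw [mul_apply, actL_smul]
      exact map_smul _ _ _)

end Algebra

section Coordinates

variable {n : ℕ} {θ : ℝ} [NeZero θ]

/-- Multiplication of Schwartz functions by the coordinate `x_μ`. -/
noncomputable def coordS (μ : Idx n) : 𝓢(Space n, ℂ) →L[ℂ] 𝓢(Space n, ℂ) :=
  mulLin (EuclideanSpace.single μ 1)

lemma coordS_apply (μ : Idx n) (a : 𝓢(Space n, ℂ)) (x : Space n) :
    coordS μ a x = (x μ : ℂ) * a x := by
  rw [coordS, mulLin_apply, EuclideanSpace.inner_single_left]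
  simp

/-- The direction `∑ ν, Θ μ ν e_ν`. -/
noncomputable def thetaDir (n : ℕ) (θ : ℝ) (μ : Idx n) : Space n :=
  WithLp.toLp 2 fun ν => thetaMatrix n θ μ ν

/-- The operator `∑ ν, Θ μ ν ∂_ν` on Schwartz functions. -/
noncomputable def derivS (θ : ℝ) (μ : Idx n) : 𝓢(Space n, ℂ) →L[ℂ] 𝓢(Space n, ℂ) :=
  lineDerivOpCLM ℂ 𝓢(Space n, ℂ) (thetaDir n θ μ)

lemma inner_symp_thetaDir (y : Space n) (μ : Idx n) :
    inner ℝ (symp n θ y) (thetaDir n θ μ) = -Real.pi⁻¹ * y μ := by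
  rw [inner_symp]
  have h : ∀ ρ, ∑ ν, y ρ * (thetaMatrix n θ)⁻¹ ρ ν * thetaDir n θ μ ν = -(y ρ * (1 : Matrix _ _ ℝ) μ ρ) := by
    intro ρ
    rw [← thetaMatrix_mul_inv n θ, Matrix.mul_apply, Finset.mul_sum, ← Finset.sum_neg_distrib]
    refine Finset.sum_congr rfl fun ν _ => ?_
    rw [thetaMatrix_inv_swap n θ ν ρ]
    simp only [thetaDir]; ring
  simp_rw [h, Matrix.one_apply]
  simp

lemma sft_lineDeriv (T : Space n ≃L[ℝ] Space n) (w : Space n) (b : 𝓢(Space n, ℂ)) :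
    sft T (∂_{w} b) = mulDer T w (sft T b) := by
  ext y
  have h : (fun x : Space n => inner ℝ x w).HasTemperateGrowth :=
    Function.hasTemperateGrowth_inner_left w
  rw [mulDer_apply]
  change (𝓕 (∂_{w} b) : 𝓢(Space n, ℂ)) (T y) = _
  rw [SchwartzMap.fourier_lineDerivOp_eq, smul_apply, smulLeftCLM_apply_apply h]
  change _ = _ * ((𝓕 b : 𝓢(Space n, ℂ)) (T y))
  simp [mul_assoc]

lemma deriv_moyalS (μ : Idx n) (a b : 𝓢(Space n, ℂ)) :
    derivS θ μ (moyalS θ a b) = moyalS θ (derivS θ μ a) b + moyalS θ a (derivS θ μ b) := by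
  simp only [moyalS_eq, starS, derivS, map_smul, lineDerivOpCLM_apply]
  rw [deriv_twistS, sft_lineDeriv, smul_add]

lemma coord_moyalS_left (μ : Idx n) (a b : 𝓢(Space n, ℂ)) :
    coordS μ (moyalS θ a b) =
      moyalS θ (coordS μ a) b - (Complex.I / 2) • moyalS θ a (derivS θ μ b) := by
  have key : mulLin (EuclideanSpace.single μ 1) (sft (symp n θ) b) =
      (Complex.I / 2) • mulDer (symp n θ) (thetaDir n θ μ) (sft (symp n θ) b) := by
    ext y
    rw [smul_apply, mulDer_apply, mulLin_apply, inner_symp_thetaDir,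
      EuclideanSpace.inner_single_left, smul_eq_mul]
    have h : (Real.pi : ℂ) ≠ 0 := by exact_mod_cast Real.pi_ne_zero
    push_cast
    field_simp
    simp
  simp only [moyalS_eq, starS, derivS, coordS, map_smul, lineDerivOpCLM_apply]
  rw [mulLin_twistS, sft_lineDeriv, key, twistS_smul_right, smul_sub, smul_comm (Complex.I / 2)]

lemma integral_coordS (μ : Idx n) (a b : 𝓢(Space n, ℂ)) :
    ∫ x, coordS μ a x * b x = ∫ x, a x * coordS μ b x := by
  congr 1; ext x
  rw [coordS_apply, coordS_apply]; ring

lemma integral_derivS (μ : Idx n) (a b : 𝓢(Space n, ℂ)) :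
    ∫ x, derivS θ μ a x * b x = -∫ x, a x * derivS θ μ b x := by
  simp only [derivS, lineDerivOpCLM_apply]
  rw [integral_mul_lineDerivOp_right_eq_neg_left, neg_neg]

lemma coord_moyalS_right (μ : Idx n) (a b : 𝓢(Space n, ℂ)) :
    coordS μ (moyalS θ a b) =
      moyalS θ a (coordS μ b) + (Complex.I / 2) • moyalS θ (derivS θ μ a) b := by
  refine schwartz_ext fun c => ?_
  have h : moyalS θ (coordS μ c) a =
      coordS μ (moyalS θ c a) + (Complex.I / 2) • moyalS θ c (derivS θ μ a) := by
    rw [coord_moyalS_left, sub_add_cancel]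
  have e1 : ∀ x, (moyalS θ a (coordS μ b) + (Complex.I / 2) • moyalS θ (derivS θ μ a) b :
      𝓢(Space n, ℂ)) x * c x = moyalS θ a (coordS μ b) x * c x +
        (Complex.I / 2) * (moyalS θ (derivS θ μ a) b x * c x) := fun x => by
    simp only [add_apply, smul_apply, smul_eq_mul]; ring
  have e2 : ∀ x, b x * (coordS μ (moyalS θ c a) + (Complex.I / 2) • moyalS θ c (derivS θ μ a) :
      𝓢(Space n, ℂ)) x = b x * coordS μ (moyalS θ c a) x +
        (Complex.I / 2) * (b x * moyalS θ c (derivS θ μ a) x) := fun x => by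
    simp only [add_apply, smul_apply, smul_eq_mul]; ring
  simp_rw [e1]
  rw [integral_coordS, integral_mul_moyalS, h]
  simp_rw [e2]
  rw [integral_add (integrable_mul_schwartz _ _) ((integrable_mul_schwartz _ _).const_mul _),
    integral_add (integrable_mul_schwartz _ _) ((integrable_mul_schwartz _ _).const_mul _),
    integral_const_mul, integral_const_mul, integral_mul_moyalS, integral_mul_moyalS,
    integral_coordS]

lemma derivS_coordS (μ : Idx n) (ν : Idx n) (a : 𝓢(Space n, ℂ)) :
    derivS θ ν (coordS μ a) = coordS μ (derivS θ ν a) + (thetaMatrix n θ ν μ : ℂ) • a := by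
  ext x
  have h1 : HasFDerivAt (fun y : Space n => (y μ : ℂ) * a y) _ x :=
    (Complex.ofRealCLM.hasFDerivAt.comp x
      (EuclideanSpace.proj (𝕜 := ℝ) μ : Space n →L[ℝ] ℝ).hasFDerivAt).mul (a.hasFDerivAt x)
  have h2 : ⇑(coordS μ a) = fun y : Space n => (y μ : ℂ) * a y := funext (coordS_apply μ a)
  simp only [derivS, lineDerivOpCLM_apply, add_apply, smul_apply, smul_eq_mul, coordS_apply,
    lineDerivOp_apply_eq_fderiv]
  rw [h2, h1.fderiv]
  simp [thetaDir]
  ring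

lemma integral_derivS_self (μ : Idx n) (a : 𝓢(Space n, ℂ)) : ∫ x, derivS θ μ a x = 0 := by
  rw [derivS, lineDerivOpCLM_apply]
  simp_rw [lineDerivOp_apply_eq_fderiv]
  have h := integral_mul_fderiv_eq_neg_fderiv_mul_of_integrable (μ := (volume : Measure (Space n)))
    (f := fun _ => (1 : ℂ)) (g := a) (v := thetaDir n θ μ)
  have h1 : Integrable fun x => fderiv ℝ a x (thetaDir n θ μ) := by
    have := (∂_{thetaDir n θ μ} a : 𝓢(Space n, ℂ)).integrable (μ := volume)
    refine this.congr (Eventually.of_forall fun x => ?_)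
    rw [lineDerivOp_apply_eq_fderiv]
  have h2 := h (by simp) (by simpa using h1) (by simpa using a.integrable) (fun x _ => by fun_prop)
    (fun x _ => a.differentiable x)
  simpa using h2

/-- The polynomial function on `ℝ^D` defined by a polynomial in the coordinates. -/
noncomputable def polyFun (p : MvPolynomial (Idx n) ℂ) (x : Space n) : ℂ :=
  MvPolynomial.eval (fun μ => (x μ : ℂ)) p

lemma hasTemperateGrowth_coord (μ : Idx n) :
    (fun x : Space n => (x μ : ℂ)).HasTemperateGrowth :=
  Function.HasTemperateGrowth.comp (g := Complex.ofReal) (by fun_prop)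
    (EuclideanSpace.proj (𝕜 := ℝ) μ : Space n →L[ℝ] ℝ).hasTemperateGrowth

lemma hasTemperateGrowth_polyFun (p : MvPolynomial (Idx n) ℂ) : (polyFun p).HasTemperateGrowth := by
  induction p using MvPolynomial.induction_on with
  | C c =>
    have : polyFun (n := n) (MvPolynomial.C c) = fun _ => c := by ext x; simp [polyFun]
    rw [this]; exact Function.HasTemperateGrowth.const c
  | add p q hp hq =>
    have : polyFun (p + q) = polyFun p + polyFun q := by ext x; simp [polyFun]
    rw [this]; exact hp.add hq
  | mul_X p μ hp =>
    have : polyFun (p * MvPolynomial.X μ) = fun x => polyFun p x * (x μ : ℂ) := by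
      ext x; simp [polyFun]
    rw [this]; exact hp.mul (hasTemperateGrowth_coord μ)

/-- The tempered distribution `a ↦ ∫ a(x) p(x) dx` defined by a polynomial function. -/
noncomputable def polyDist (p : MvPolynomial (Idx n) ℂ) : 𝓢'(Space n, ℂ) :=
  (hasTemperateGrowth_polyFun p).toTemperedDistribution volume

lemma polyDist_apply (p : MvPolynomial (Idx n) ℂ) (a : 𝓢(Space n, ℂ)) :
    polyDist p a = ∫ x, a x * polyFun p x := rfl

lemma integrable_mul_polyFun (p : MvPolynomial (Idx n) ℂ) (a : 𝓢(Space n, ℂ)) :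
    Integrable fun x => a x * polyFun p x := by
  have := (smulLeftCLM ℂ (polyFun p) a).integrable (μ := volume)
  refine this.congr (Eventually.of_forall fun x => ?_)
  simp only [smulLeftCLM_apply_apply (hasTemperateGrowth_polyFun p), smul_eq_mul, mul_comm]

lemma polyDist_add (p q : MvPolynomial (Idx n) ℂ) : polyDist (p + q) = polyDist p + polyDist q := by
  ext a
  rw [add_apply, polyDist_apply, polyDist_apply, polyDist_apply, ← integral_add
    (integrable_mul_polyFun p a) (integrable_mul_polyFun q a)]
  congr 1; ext x
  simp [polyFun]; ring

lemma polyDist_smul (c : ℂ) (p : MvPolynomial (Idx n) ℂ) : polyDist (c • p) = c • polyDist p := by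
  ext a
  rw [smul_apply, polyDist_apply, polyDist_apply, smul_eq_mul, ← integral_const_mul]
  congr 1; ext x
  simp [polyFun]; ring

lemma polyDist_mul_X (p : MvPolynomial (Idx n) ℂ) (μ : Idx n) (a : 𝓢(Space n, ℂ)) :
    polyDist (p * MvPolynomial.X μ) a = polyDist p (coordS μ a) := by
  rw [polyDist_apply, polyDist_apply]
  congr 1; ext x
  simp [polyFun, coordS_apply]; ring

lemma polyDist_C (c : ℂ) : polyDist (MvPolynomial.C c) = c • (1 : MoyalAlgebra n θ).1 := by
  ext a
  rw [smul_apply, polyDist_apply, one_apply, smul_eq_mul, ← integral_const_mul]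
  congr 1; ext x
  simp [polyFun]; ring

/-- The Moyal algebra contains the polynomial functions. -/
lemma polyDist_mem (p : MvPolynomial (Idx n) ℂ) : polyDist p ∈ moyalSubmodule n θ := by
  induction p using MvPolynomial.induction_on with
  | C c =>
    rw [polyDist_C (θ := θ)]
    exact (moyalSubmodule n θ).smul_mem c (1 : MoyalAlgebra n θ).2
  | add p q hp hq =>
    rw [polyDist_add]
    exact (moyalSubmodule n θ).add_mem hp hq
  | mul_X p μ hp =>
    let T : MoyalAlgebra n θ := ⟨polyDist p, hp⟩
    have hT : ∀ a, polyDist p a = T.1 a := fun _ => rfl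
    refine mem_moyal_of
      (fun a => actR T (coordS μ a) - (Complex.I / 2) • derivS θ μ (actR T a))
      (fun a => actL T (coordS μ a) + (Complex.I / 2) • derivS θ μ (actL T a))
      (fun a b => ?_) (fun a b => ?_)
    · rw [polyDist_mul_X, coord_moyalS_right, map_add, map_smul, hT, hT (moyalS θ _ a), ← integral_actR,
        ← integral_actR, smul_eq_mul]
      have e : ∀ x, (actR T (coordS μ a) - (Complex.I / 2) • derivS θ μ (actR T a) :
          𝓢(Space n, ℂ)) x * b x = actR T (coordS μ a) x * b x -
          (Complex.I / 2) * (derivS θ μ (actR T a) x * b x) := fun x => by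
        simp only [sub_apply, smul_apply, smul_eq_mul]; ring
      simp_rw [e]
      rw [integral_sub (integrable_mul_schwartz _ _) ((integrable_mul_schwartz _ _).const_mul _),
        integral_const_mul, integral_derivS]
      ring
    · rw [polyDist_mul_X, coord_moyalS_left, map_sub, map_smul, hT, hT (moyalS θ a _), ← integral_actL,
        ← integral_actL, smul_eq_mul]
      have e : ∀ x, (actL T (coordS μ a) + (Complex.I / 2) • derivS θ μ (actL T a) :
          𝓢(Space n, ℂ)) x * b x = actL T (coordS μ a) x * b x +
          (Complex.I / 2) * (derivS θ μ (actL T a) x * b x) := fun x => by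
        simp only [add_apply, smul_apply, smul_eq_mul]; ring
      simp_rw [e]
      rw [integral_add (integrable_mul_schwartz _ _) ((integrable_mul_schwartz _ _).const_mul _),
        integral_const_mul, integral_derivS]
      ring

/-- A polynomial function as an element of the Moyal algebra. -/
noncomputable def poly (θ : ℝ) [NeZero θ] : MvPolynomial (Idx n) ℂ →ₗ[ℂ] MoyalAlgebra n θ where
  toFun p := ⟨polyDist p, polyDist_mem p⟩
  map_add' p q := Subtype.ext (polyDist_add p q)
  map_smul' c p := Subtype.ext (polyDist_smul c p)

lemma poly_apply (p : MvPolynomial (Idx n) ℂ) (a : 𝓢(Space n, ℂ)) :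
    (poly θ p).1 a = polyDist p a := rfl

lemma poly_C (c : ℂ) : poly θ (MvPolynomial.C c : MvPolynomial (Idx n) ℂ) = c • 1 :=
  Subtype.ext (polyDist_C c)

lemma poly_one : poly θ (1 : MvPolynomial (Idx n) ℂ) = 1 := by
  have := poly_C (n := n) (θ := θ) 1
  rwa [map_one, one_smul] at this

lemma polyDist_X (μ : Idx n) (a : 𝓢(Space n, ℂ)) :
    polyDist (MvPolynomial.X μ) a = ∫ x, coordS μ a x := by
  rw [polyDist_apply]
  congr 1; ext x
  simp [polyFun, coordS_apply]; ring

lemma actL_X (μ : Idx n) (a : 𝓢(Space n, ℂ)) :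
    actL (poly θ (MvPolynomial.X μ)) a = coordS μ a + (Complex.I / 2) • derivS θ μ a := by
  rw [actL_eq_iff]
  intro b
  rw [poly_apply, polyDist_X, coord_moyalS_left]
  have e : ∀ x, (coordS μ a + (Complex.I / 2) • derivS θ μ a : 𝓢(Space n, ℂ)) x * b x =
      coordS μ a x * b x + (Complex.I / 2) * (derivS θ μ a x * b x) := fun x => by
    simp only [add_apply, smul_apply, smul_eq_mul]; ring
  simp_rw [e]
  simp only [sub_apply, smul_apply, smul_eq_mul]
  rw [integral_add (integrable_mul_schwartz _ _) ((integrable_mul_schwartz _ _).const_mul _),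
    integral_sub (moyalS θ (coordS μ a) b).integrable
      ((moyalS θ a (derivS θ μ b)).integrable.const_mul _),
    integral_const_mul, integral_const_mul, integral_moyalS, integral_moyalS, integral_derivS]
  ring

lemma mul_X_apply (T : MoyalAlgebra n θ) (μ : Idx n) (a : 𝓢(Space n, ℂ)) :
    (T * poly θ (MvPolynomial.X μ)).1 a = T.1 (coordS μ a) + (Complex.I / 2) * T.1 (derivS θ μ a) := by
  rw [mul_apply, actL_X, map_add, map_smul, smul_eq_mul]

lemma X_mul_apply (T : MoyalAlgebra n θ) (μ : Idx n) (a : 𝓢(Space n, ℂ)) :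
    (poly θ (MvPolynomial.X μ) * T).1 a = T.1 (coordS μ a) - (Complex.I / 2) * T.1 (derivS θ μ a) := by
  have h := eq_of_moyalS (θ := θ) (u := fun a => (poly θ (MvPolynomial.X μ) * T).1 a)
    (v := fun a => T.1 (coordS μ a) - (Complex.I / 2) * T.1 (derivS θ μ a))
    (moyal_continuous _) (((moyal_continuous T).comp (coordS μ).continuous).sub
      (continuous_const.mul ((moyal_continuous T).comp (derivS θ μ).continuous))) fun a b => by
    rw [mul_apply, actL_moyalS, poly_apply, polyDist_X, coord_moyalS_right, coord_moyalS_right,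
      deriv_moyalS]
    simp only [add_apply, smul_apply, smul_eq_mul, map_add, map_smul]
    rw [integral_add (moyalS θ (actL T a) (coordS μ b)).integrable
      ((moyalS θ (derivS θ μ (actL T a)) b).integrable.const_mul _), integral_const_mul,
      integral_moyalS, integral_moyalS, integral_derivS, integral_actL, integral_actL]
    ring
  exact congrFun h a

/-- Integration by parts against a polynomial. -/
lemma polyDist_derivS (p : MvPolynomial (Idx n) ℂ) (μ : Idx n) (a : 𝓢(Space n, ℂ)) :
    polyDist p (derivS θ μ a) =
      -polyDist (∑ ν, (thetaMatrix n θ μ ν : ℂ) • MvPolynomial.pderiv ν p) a := by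
  induction p using MvPolynomial.induction_on generalizing a with
  | C c =>
    have h0 : polyDist (0 : MvPolynomial (Idx n) ℂ) a = 0 := by simp [polyDist_apply, polyFun]
    simp only [MvPolynomial.pderiv_C, smul_zero, Finset.sum_const_zero, h0, neg_zero]
    rw [polyDist_C (θ := θ), smul_apply, one_apply, integral_derivS_self, smul_zero]
  | add p q hp hq =>
    simp only [map_add, smul_add, Finset.sum_add_distrib, polyDist_add, add_apply, hp, hq]
    ring
  | mul_X p ρ hp =>
    rw [polyDist_mul_X]
    have h := derivS_coordS (θ := θ) ρ μ a
    have h2 : coordS ρ (derivS θ μ a) = derivS θ μ (coordS ρ a) - (thetaMatrix n θ μ ρ : ℂ) • a := by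
      rw [h, add_sub_cancel_right]
    rw [h2, map_sub, map_smul, hp, smul_eq_mul]
    have e : (∑ ν, (thetaMatrix n θ μ ν : ℂ) • MvPolynomial.pderiv ν (p * MvPolynomial.X ρ)) =
        (∑ ν, (thetaMatrix n θ μ ν : ℂ) • MvPolynomial.pderiv ν p) * MvPolynomial.X ρ +
          (thetaMatrix n θ μ ρ : ℂ) • p := by
      simp only [MvPolynomial.pderiv_mul, MvPolynomial.pderiv_X, smul_add, Finset.sum_add_distrib,
        Finset.sum_mul, smul_mul_assoc]
      congr 1
      rw [Finset.sum_eq_single ρ]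
      · simp
      · intro ν _ hν
        simp [hν.symm]
      · simp
    rw [e, polyDist_add, polyDist_smul, add_apply, smul_apply, polyDist_mul_X, smul_eq_mul]
    ring

lemma X_mul_poly (p : MvPolynomial (Idx n) ℂ) (μ : Idx n) :
    poly θ (MvPolynomial.X μ) * poly θ p = poly θ (MvPolynomial.X μ * p +
      (Complex.I / 2) • ∑ ν, (thetaMatrix n θ μ ν : ℂ) • MvPolynomial.pderiv ν p) :=
  moyal_ext fun a => by
    rw [X_mul_apply, poly_apply, poly_apply, poly_apply, polyDist_derivS, polyDist_add,
      polyDist_smul, mul_comm (MvPolynomial.X μ), add_apply, smul_apply, polyDist_mul_X,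
      smul_eq_mul]
    ring

lemma poly_mul_X (p : MvPolynomial (Idx n) ℂ) (μ : Idx n) :
    poly θ p * poly θ (MvPolynomial.X μ) = poly θ (MvPolynomial.X μ * p -
      (Complex.I / 2) • ∑ ν, (thetaMatrix n θ μ ν : ℂ) • MvPolynomial.pderiv ν p) :=
  moyal_ext fun a => by
    rw [mul_X_apply, map_sub, map_smul, poly_apply, poly_apply, polyDist_derivS]
    change _ = polyDist _ a - (Complex.I / 2) * polyDist _ a
    rw [mul_comm (MvPolynomial.X μ), polyDist_mul_X]
    ring

lemma poly_injective : Function.Injective (poly (n := n) θ) := by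
  rw [← LinearMap.ker_eq_bot, LinearMap.ker_eq_bot']
  intro p hp
  have h0 : ∀ a : 𝓢(Space n, ℂ), ∫ x, a x * polyFun p x = 0 := fun a => by
    have : (poly θ p).1 a = 0 := by rw [hp]; rfl
    exact this
  have hc : Continuous (polyFun p) := (hasTemperateGrowth_polyFun p).1.continuous
  have h1 : polyFun p =ᵐ[volume] fun _ => 0 := by
    refine ae_eq_zero_of_integral_contDiff_smul_eq_zero hc.locallyIntegrable
      fun g hg hgc => ?_
    have hg₁ : HasCompactSupport (Complex.ofRealCLM ∘ g) := hgc.comp_left rfl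
    have hg₂ : ContDiff ℝ ∞ (Complex.ofRealCLM ∘ g) := by fun_prop
    have := h0 (hg₁.toSchwartzMap hg₂)
    refine Eq.trans ?_ this
    congr 1
  have h2 : polyFun p = fun _ => 0 := Continuous.ae_eq_iff_eq volume hc continuous_const |>.1 h1
  refine MvPolynomial.funext_set (fun _ => Set.range Complex.ofReal)
    (fun _ => Set.infinite_range_of_injective Complex.ofReal_injective) fun x hx => ?_
  choose y hy using fun μ => hx μ (Set.mem_univ μ)
  have h3 := congrFun h2 (WithLp.toLp 2 y)
  have : x = fun μ => ((y μ : ℝ) : ℂ) := funext fun μ => (hy μ).symm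
  rw [map_zero, this]
  exact h3

end Coordinates
end Moyal

end MoyalAnalysis

namespace Moyal

section GradedCalculus

/-- The sign `(-1)^{αβ}`. -/
def gradedSign (α β : ZMod 2) : ℂ := (-1) ^ (α.val * β.val)

lemma gradedSign_zero_left (β : ZMod 2) : gradedSign 0 β = 1 := by simp [gradedSign]
lemma gradedSign_zero_right (α : ZMod 2) : gradedSign α 0 = 1 := by simp [gradedSign]
lemma gradedSign_one_one : gradedSign 1 1 = -1 := by simp [gradedSign, ZMod.val_one]

variable {A : Type*} [Ring A] [Algebra ℂ A]

/-- `Der^α`: the linear maps `X` with `X (𝒜^β) ⊆ 𝒜^{α+β}` and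
`X (a b) = X (a) b + (-1)^{αβ} a X (b)` for all `a` of degree `β` and all `b`. -/
noncomputable def gradedDerivations (𝒜 : ZMod 2 → Submodule ℂ A) (α : ZMod 2) :
    Submodule ℂ (Module.End ℂ A) where
  carrier := {X | ∀ β, ∀ a ∈ 𝒜 β, X a ∈ 𝒜 (α + β) ∧
    ∀ b, X (a * b) = X a * b + gradedSign α β • (a * X b)}
  add_mem' {X Y} hX hY β a ha := by
    refine ⟨(𝒜 _).add_mem (hX β a ha).1 (hY β a ha).1, fun b => ?_⟩
    rw [LinearMap.add_apply, LinearMap.add_apply, LinearMap.add_apply, (hX β a ha).2,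
      (hY β a ha).2, add_mul, mul_add, smul_add]
    abel
  zero_mem' β a ha := by simp
  smul_mem' c X hX β a ha := by
    refine ⟨(𝒜 _).smul_mem c (hX β a ha).1, fun b => ?_⟩
    rw [LinearMap.smul_apply, LinearMap.smul_apply, LinearMap.smul_apply, (hX β a ha).2,
      smul_add, smul_mul_assoc, mul_smul_comm, smul_comm c]

/-- The graded bracket `[X, Y]_• = X Y - (-1)^{|X||Y|} Y X` of linear maps of degrees `α`, `β`. -/
noncomputable def gradedCommutator (α β : ZMod 2) (X Y : Module.End ℂ A) : Module.End ℂ A :=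
  X * Y - gradedSign α β • (Y * X)

/-- A `ℤ₂`-graded Lie subalgebra of the graded Lie algebra of derivations of `𝒜`. -/
structure GradedLieSubalgebra (𝒜 : ZMod 2 → Submodule ℂ A) where
  carrier : ZMod 2 → Submodule ℂ (Module.End ℂ A)
  le_derivations : ∀ α, carrier α ≤ gradedDerivations 𝒜 α
  commutator_mem : ∀ {α β X Y}, X ∈ carrier α → Y ∈ carrier β →
    gradedCommutator α β X Y ∈ carrier (α + β)

variable {𝒜 : ZMod 2 → Submodule ℂ A}

/-- The bracket of two homogeneous elements of a graded Lie subalgebra. -/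
noncomputable def GradedLieSubalgebra.bracket (𝒢 : GradedLieSubalgebra 𝒜) {α β : ZMod 2}
    (X : 𝒢.carrier α) (Y : 𝒢.carrier β) : 𝒢.carrier (α + β) :=
  ⟨gradedCommutator α β X.1 Y.1, 𝒢.commutator_mem X.2 Y.2⟩

/-- The 1-forms of degree `0` of the restricted differential calculus based on `𝒢`: the linear maps
`ω` from `𝒢^•` to the algebra with `ω (X)` of degree `|X|`. -/
@[ext]
structure OneForm (𝒢 : GradedLieSubalgebra 𝒜) where
  toFun : ∀ {α : ZMod 2}, 𝒢.carrier α →ₗ[ℂ] A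
  mem : ∀ {α : ZMod 2} (X : 𝒢.carrier α), toFun X ∈ 𝒜 α

namespace OneForm

variable {𝒢 : GradedLieSubalgebra 𝒜}

noncomputable instance : Add (OneForm 𝒢) :=
  ⟨fun ω η => ⟨ω.toFun + η.toFun, fun X => (𝒜 _).add_mem (ω.mem X) (η.mem X)⟩⟩

noncomputable instance : SMul ℂ (OneForm 𝒢) :=
  ⟨fun c ω => ⟨c • ω.toFun, fun X => (𝒜 _).smul_mem c (ω.mem X)⟩⟩

@[simp] lemma add_apply (ω η : OneForm 𝒢) {α : ZMod 2} (X : 𝒢.carrier α) :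
    (ω + η).toFun X = ω.toFun X + η.toFun X := rfl

@[simp] lemma smul_apply (c : ℂ) (ω : OneForm 𝒢) {α : ZMod 2} (X : 𝒢.carrier α) :
    (c • ω).toFun X = c • ω.toFun X := rfl

/-- The 2-form `d̂ω` on homogeneous derivations. -/
noncomputable def d (ω : OneForm 𝒢) {α β : ZMod 2} (X : 𝒢.carrier α) (Y : 𝒢.carrier β) : A :=
  X.1 (ω.toFun Y) - gradedSign α β • Y.1 (ω.toFun X) - ω.toFun (𝒢.bracket X Y)

/-- The product `ω × η` of two 1-forms of degree `0` on homogeneous derivations. -/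
noncomputable def prod (ω η : OneForm 𝒢) {α β : ZMod 2} (X : 𝒢.carrier α) (Y : 𝒢.carrier β) : A :=
  ω.toFun X * η.toFun Y - gradedSign α β • (ω.toFun Y * η.toFun X)

/-- The NC connection `∇_X (a) = X (a) + ω (X) a` with 1-form connection `ω`. -/
noncomputable def nabla (ω : OneForm 𝒢) {α : ZMod 2} (X : 𝒢.carrier α) : Module.End ℂ A :=
  X.1 + LinearMap.mulLeft ℂ (ω.toFun X)

/-- The curvature 2-form `F = d̂ω + ω × ω` of the NC connection with 1-form connection `ω`. -/
noncomputable def curvature (ω : OneForm 𝒢) {α β : ZMod 2} (X : 𝒢.carrier α)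
    (Y : 𝒢.carrier β) : A :=
  ω.d X Y + ω.prod ω X Y

end OneForm

end GradedCalculus

section GradedDouble

/-- The graded vector space `R ⊕ R`, with elements `(a₀, a₁)`. -/
@[ext]
structure GradedDouble (R : Type*) where
  fst : R
  snd : R

namespace GradedDouble

variable {R : Type*} [Ring R] [Algebra ℂ R]

noncomputable instance : Zero (GradedDouble R) := ⟨mk 0 0⟩
noncomputable instance : Add (GradedDouble R) := ⟨fun a b => mk (a.1 + b.1) (a.2 + b.2)⟩
noncomputable instance : Neg (GradedDouble R) := ⟨fun a => mk (-a.1) (-a.2)⟩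
noncomputable instance : Sub (GradedDouble R) := ⟨fun a b => mk (a.1 - b.1) (a.2 - b.2)⟩
noncomputable instance : SMul ℕ (GradedDouble R) := ⟨fun k a => mk (k • a.1) (k • a.2)⟩
noncomputable instance : SMul ℤ (GradedDouble R) := ⟨fun k a => mk (k • a.1) (k • a.2)⟩
noncomputable instance : SMul ℂ (GradedDouble R) := ⟨fun c a => mk (c • a.1) (c • a.2)⟩

lemma fst_mk (a₀ a₁ : R) : (mk a₀ a₁).1 = a₀ := rfl
lemma snd_mk (a₀ a₁ : R) : (mk a₀ a₁).2 = a₁ := rfl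
@[simp] lemma fst_add (a b : GradedDouble R) : (a + b).1 = a.1 + b.1 := rfl
@[simp] lemma snd_add (a b : GradedDouble R) : (a + b).2 = a.2 + b.2 := rfl
@[simp] lemma fst_sub (a b : GradedDouble R) : (a - b).1 = a.1 - b.1 := rfl
@[simp] lemma snd_sub (a b : GradedDouble R) : (a - b).2 = a.2 - b.2 := rfl
@[simp] lemma fst_neg (a : GradedDouble R) : (-a).1 = -a.1 := rfl
@[simp] lemma snd_neg (a : GradedDouble R) : (-a).2 = -a.2 := rfl
@[simp] lemma fst_zero : (0 : GradedDouble R).1 = 0 := rfl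
@[simp] lemma snd_zero : (0 : GradedDouble R).2 = 0 := rfl
@[simp] lemma fst_smul (c : ℂ) (a : GradedDouble R) : (c • a).1 = c • a.1 := rfl
@[simp] lemma snd_smul (c : ℂ) (a : GradedDouble R) : (c • a).2 = c • a.2 := rfl

/-- The bijection between `R ⊕ R` and pairs. -/
def toProd (a : GradedDouble R) : R × R := (a.1, a.2)

lemma toProd_injective : Function.Injective (toProd (R := R)) := fun a b h =>
  GradedDouble.ext (congrArg Prod.fst h) (congrArg Prod.snd h)

noncomputable instance : AddCommGroup (GradedDouble R) :=
  toProd_injective.addCommGroup toProd rfl (fun _ _ => rfl) (fun _ => rfl) (fun _ _ => rfl)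
    (fun _ _ => rfl) (fun _ _ => rfl)

noncomputable instance : Module ℂ (GradedDouble R) :=
  toProd_injective.module ℂ ⟨⟨toProd, rfl⟩, fun _ _ => rfl⟩ (fun _ _ => rfl)

/-- The product `a b = (a₀ b₀ + a₁ b₁, a₀ b₁ + a₁ b₀)`. -/
noncomputable instance : Mul (GradedDouble R) :=
  ⟨fun a b => mk (a.1 * b.1 + a.2 * b.2) (a.1 * b.2 + a.2 * b.1)⟩

/-- The unit `(1, 0)`. -/
noncomputable instance : One (GradedDouble R) := ⟨mk 1 0⟩

@[simp] lemma fst_mul (a b : GradedDouble R) : (a * b).1 = a.1 * b.1 + a.2 * b.2 := rfl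
@[simp] lemma snd_mul (a b : GradedDouble R) : (a * b).2 = a.1 * b.2 + a.2 * b.1 := rfl
@[simp] lemma fst_one : (1 : GradedDouble R).1 = 1 := rfl
@[simp] lemma snd_one : (1 : GradedDouble R).2 = 0 := rfl

noncomputable instance : Ring (GradedDouble R) :=
  { (inferInstance : AddCommGroup (GradedDouble R)),
    (inferInstance : Mul (GradedDouble R)),
    (inferInstance : One (GradedDouble R)) with
    left_distrib := fun a b c => by ext <;> simp [mul_add] <;> abel
    right_distrib := fun a b c => by ext <;> simp [add_mul] <;> abel
    zero_mul := fun a => by ext <;> simp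
    mul_zero := fun a => by ext <;> simp
    mul_assoc := fun a b c => by ext <;> simp [mul_add, add_mul, mul_assoc] <;> abel
    mul_one := fun a => by ext <;> simp
    one_mul := fun a => by ext <;> simp }

noncomputable instance : Algebra ℂ (GradedDouble R) :=
  Algebra.ofModule (fun r a b => by ext <;> simp) (fun r a b => by ext <;> simp)

/-- The homogeneous parts: degree `0` is `R ⊕ 0`, degree `1` is `0 ⊕ R`. -/
noncomputable def homogeneous (R : Type*) [Ring R] [Algebra ℂ R] (α : ZMod 2) :
    Submodule ℂ (GradedDouble R) where
  carrier := {a | if α = 0 then a.2 = 0 else a.1 = 0}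
  add_mem' {a b} ha hb := by
    by_cases h : α = 0 <;> simp only [h, if_true, if_false, Set.mem_ofPred_eq] at * <;> simp [ha, hb]
  zero_mem' := by simp
  smul_mem' c a ha := by
    by_cases h : α = 0 <;> simp only [h, if_true, if_false, Set.mem_ofPred_eq] at * <;> simp [ha]

lemma mem_homogeneous_zero {a : GradedDouble R} : a ∈ homogeneous R 0 ↔ a.2 = 0 := by
  change (if (0 : ZMod 2) = 0 then a.2 = 0 else a.1 = 0) ↔ _
  rw [if_pos rfl]

lemma mem_homogeneous_one {a : GradedDouble R} : a ∈ homogeneous R 1 ↔ a.1 = 0 := by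
  change (if (1 : ZMod 2) = 0 then a.2 = 0 else a.1 = 0) ↔ _
  rw [if_neg one_ne_zero]

/-- The homogeneous component of degree `α` of an element. -/
def component (α : ZMod 2) (a : GradedDouble R) : GradedDouble R :=
  if α = 0 then mk a.1 0 else mk 0 a.2

/-- The graded bracket, the bilinear extension of `[a, b]_• = a b - (-1)^{|a||b|} b a`. -/
noncomputable def gradedBracket (a b : GradedDouble R) : GradedDouble R :=
  ∑ α : ZMod 2, ∑ β : ZMod 2, (component α a * component β b -
    gradedSign α β • (component β b * component α a))

lemma gradedBracket_eq (a b : GradedDouble R) : gradedBracket a b =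
    mk (a.1 * b.1 - b.1 * a.1 + (a.2 * b.2 + b.2 * a.2))
      (a.1 * b.2 - b.2 * a.1 + (a.2 * b.1 - b.1 * a.2)) := by
  have h : ∀ f : ZMod 2 → GradedDouble R, ∑ α, f α = f 0 + f 1 := fun f => Fin.sum_univ_two f
  unfold gradedBracket
  simp only [h, gradedSign_zero_left, gradedSign_zero_right, gradedSign_one_one, component,
    if_true, one_ne_zero, if_false]
  ext <;> simp

/-- The map `Ad_a (b) = [a, b]_•`. -/
noncomputable def Ad : GradedDouble R →ₗ[ℂ] Module.End ℂ (GradedDouble R) :=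
  LinearMap.mk₂ ℂ gradedBracket
    (fun a a' b => by
      simp only [gradedBracket_eq]; ext <;> simp [mul_add, add_mul] <;> abel)
    (fun c a b => by
      simp only [gradedBracket_eq]; ext <;> simp [smul_sub, smul_add])
    (fun a b b' => by
      simp only [gradedBracket_eq]; ext <;> simp [mul_add, add_mul] <;> abel)
    (fun c a b => by
      simp only [gradedBracket_eq]; ext <;> simp [smul_sub, smul_add])

lemma Ad_apply (a b : GradedDouble R) : Ad a b = gradedBracket a b := rfl

lemma Ad_mem_derivations {α : ZMod 2} {a : GradedDouble R} (ha : a ∈ homogeneous R α) :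
    Ad a ∈ gradedDerivations (homogeneous R) α := by
  have hz : ∀ γ : ZMod 2, γ = 0 ∨ γ = 1 := by decide
  have h11 : (1 : ZMod 2) + 1 = 0 := by decide
  intro β b hb
  rcases hz α with rfl | rfl <;> rcases hz β with rfl | rfl <;>
    simp only [mem_homogeneous_zero, mem_homogeneous_one, h11, zero_add, add_zero,
      gradedSign_zero_left, gradedSign_zero_right, gradedSign_one_one, Ad_apply,
      gradedBracket_eq] at * <;>
    refine ⟨by simp [ha, hb], fun c => ?_⟩ <;>
    ext <;> simp [ha, hb] <;> noncomm_ring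

lemma gradedCommutator_Ad {α β : ZMod 2} {a b : GradedDouble R} (ha : a ∈ homogeneous R α)
    (hb : b ∈ homogeneous R β) :
    gradedCommutator α β (Ad a) (Ad b) = Ad (gradedBracket a b) := by
  have hz : ∀ γ : ZMod 2, γ = 0 ∨ γ = 1 := by decide
  refine LinearMap.ext fun c => ?_
  rcases hz α with rfl | rfl <;> rcases hz β with rfl | rfl <;>
    simp only [mem_homogeneous_zero, mem_homogeneous_one, gradedCommutator, LinearMap.sub_apply,
      LinearMap.smul_apply, Module.End.mul_apply,
      gradedSign_zero_left, gradedSign_zero_right, gradedSign_one_one, Ad_apply,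
      gradedBracket_eq] at * <;>
    ext <;> simp [ha, hb] <;> noncomm_ring

end GradedDouble

end GradedDouble


section Quadratic

open MvPolynomial

variable {n : ℕ} {θ : ℝ} [NeZero θ]

/-- The polynomials of degree at most `d` in the coordinates. -/
noncomputable abbrev polyDeg (n d : ℕ) : Submodule ℂ (MvPolynomial (Idx n) ℂ) :=
  restrictTotalDegree (Idx n) ℂ d

lemma C_mem_polyDeg (d : ℕ) (c : ℂ) : (C c : MvPolynomial (Idx n) ℂ) ∈ polyDeg n d := by
  rw [mem_restrictTotalDegree, totalDegree_C]; exact Nat.zero_le _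

lemma X_mul_mem_polyDeg {d : ℕ} (μ : Idx n) {p : MvPolynomial (Idx n) ℂ} (hp : p ∈ polyDeg n d) :
    X μ * p ∈ polyDeg n (d + 1) := by
  rw [mem_restrictTotalDegree] at *
  refine (totalDegree_mul _ _).trans ?_
  rw [totalDegree_X]; omega

lemma X_mem_polyDeg (μ : Idx n) : (X μ : MvPolynomial (Idx n) ℂ) ∈ polyDeg n 1 := by
  rw [mem_restrictTotalDegree, totalDegree_X]

lemma polyDeg_mono {d e : ℕ} (h : d ≤ e) : polyDeg n d ≤ polyDeg n e := fun p hp => by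
  rw [mem_restrictTotalDegree] at *; omega

lemma polyDeg_succ_le {d : ℕ} {S : Submodule ℂ (MvPolynomial (Idx n) ℂ)} (h1 : 1 ∈ S)
    (hX : ∀ μ, ∀ p ∈ polyDeg n d, X μ * p ∈ S) : polyDeg n (d + 1) ≤ S := by
  intro p hp
  rw [mem_restrictTotalDegree] at hp
  rw [p.as_sum]
  refine S.sum_mem fun m hm => ?_
  by_cases h0 : m = 0
  · rw [h0, monomial_zero', C_eq_smul_one]
    exact S.smul_mem _ h1
  · obtain ⟨μ, hμ⟩ := Finsupp.ne_iff.1 h0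
    have hle : Finsupp.single μ 1 ≤ m := Finsupp.single_le_iff.2 (Nat.one_le_iff_ne_zero.2 hμ)
    obtain ⟨k, rfl⟩ := exists_add_of_le hle
    have e : monomial (Finsupp.single μ 1 + k) (coeff (Finsupp.single μ 1 + k) p) =
        X μ * monomial k (coeff (Finsupp.single μ 1 + k) p) := by
      rw [X, monomial_mul, one_mul]
    rw [e]
    refine hX μ _ ?_
    rw [mem_restrictTotalDegree]
    have h2 := le_totalDegree hm
    rw [Finsupp.sum_add_index' (fun _ => rfl) (fun _ _ _ => rfl), Finsupp.sum_single_index rfl] at h2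
    have h3 : (monomial k (coeff (Finsupp.single μ 1 + k) p)).totalDegree ≤ k.sum fun _ e => e :=
      totalDegree_monomial_le k _
    omega

lemma pderiv_mem_polyDeg {d : ℕ} (μ : Idx n) {p : MvPolynomial (Idx n) ℂ}
    (hp : p ∈ polyDeg n (d + 1)) : pderiv μ p ∈ polyDeg n d := by
  rw [mem_restrictTotalDegree] at *
  refine Finset.sup_le fun m hm => ?_
  rw [mem_support_iff, coeff_pderiv] at hm
  have h1 := le_totalDegree (mem_support_iff.2 (left_ne_zero_of_mul hm))
  rw [Finsupp.sum_add_index' (fun _ => rfl) (fun _ _ _ => rfl), Finsupp.sum_single_index rfl] at h1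
  omega

lemma eq_C_of_pderiv {p : MvPolynomial (Idx n) ℂ} (h : ∀ μ, pderiv μ p = 0) :
    p = C (eval 0 p) := by
  have h1 : ∀ m, m ≠ 0 → coeff m p = 0 := by
    intro m hm
    obtain ⟨μ, hμ⟩ := Finsupp.ne_iff.1 hm
    have hle : Finsupp.single μ 1 ≤ m := Finsupp.single_le_iff.2 (Nat.one_le_iff_ne_zero.2 hμ)
    obtain ⟨k, rfl⟩ := exists_add_of_le hle
    have h2 := coeff_pderiv (i := μ) p k
    rw [h μ, coeff_zero, add_comm] at h2
    rcases mul_eq_zero.1 h2.symm with h3 | h3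
    · exact h3
    · exact absurd h3 (Nat.cast_add_one_ne_zero _)
  have h2 : p = C (coeff 0 p) := by
    ext m
    rw [coeff_C]
    split_ifs with h
    · rw [h]
    · exact h1 m (Ne.symm h)
  conv_lhs => rw [h2]
  conv_rhs => rw [h2, eval_C]

/-- The operator `∑ ν, Θ μ ν ∂_ν` on polynomials. -/
noncomputable def thetaDeriv (θ : ℝ) (μ : Idx n) (p : MvPolynomial (Idx n) ℂ) :
    MvPolynomial (Idx n) ℂ :=
  ∑ ν, (thetaMatrix n θ μ ν : ℂ) • pderiv ν p

lemma thetaDeriv_mem {d : ℕ} (μ : Idx n) {p : MvPolynomial (Idx n) ℂ}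
    (hp : p ∈ polyDeg n (d + 1)) : thetaDeriv θ μ p ∈ polyDeg n d :=
  Submodule.sum_mem _ fun ν _ => Submodule.smul_mem _ _ (pderiv_mem_polyDeg ν hp)

lemma commutator_X (μ : Idx n) (p : MvPolynomial (Idx n) ℂ) :
    poly θ (X μ) * poly θ p - poly θ p * poly θ (X μ) =
      Complex.I • poly θ (thetaDeriv θ μ p) := by
  rw [X_mul_poly, poly_mul_X, ← map_sub, ← map_smul]
  congr 1
  rw [thetaDeriv, add_sub_sub_cancel, ← add_smul, add_halves]

/-- The space of polynomial functions of degree at most `d`, inside the Moyal algebra. -/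
noncomputable def polySpace (n : ℕ) (θ : ℝ) [NeZero θ] (d : ℕ) : Submodule ℂ (MoyalAlgebra n θ) :=
  (polyDeg n d).map (poly θ)

lemma poly_mem_polySpace {d : ℕ} {p : MvPolynomial (Idx n) ℂ} (hp : p ∈ polyDeg n d) :
    poly θ p ∈ polySpace n θ d := Submodule.mem_map_of_mem hp

lemma polySpace_mono {d e : ℕ} (h : d ≤ e) : polySpace n θ d ≤ polySpace n θ e :=
  Submodule.map_mono (polyDeg_mono h)

lemma polySpace_succ_le {d : ℕ} {S : Submodule ℂ (MoyalAlgebra n θ)} (h1 : 1 ∈ S)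
    (hX : ∀ μ, ∀ p ∈ polyDeg n d, poly θ (X μ * p) ∈ S) : polySpace n θ (d + 1) ≤ S := by
  rw [polySpace, Submodule.map_le_iff_le_comap]
  refine polyDeg_succ_le ?_ fun μ p hp => hX μ p hp
  rw [Submodule.mem_comap, poly_one]
  exact h1

lemma one_mem_polySpace (d : ℕ) : 1 ∈ polySpace n θ d := by
  rw [← poly_one]
  refine poly_mem_polySpace ?_
  have := C_mem_polyDeg (n := n) d 1
  rwa [map_one] at this

lemma polySpace_zero {T : MoyalAlgebra n θ} (hT : T ∈ polySpace n θ 0) : ∃ c : ℂ, T = c • 1 := by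
  obtain ⟨p, hp, rfl⟩ := hT
  have hp' : p.totalDegree ≤ 0 := (mem_restrictTotalDegree _ _ _).1 hp
  refine ⟨coeff 0 p, ?_⟩
  rw [← poly_C, ← (totalDegree_eq_zero_iff_eq_C.1 (Nat.le_zero.1 hp'))]

lemma X_mul_mem {d : ℕ} (μ : Idx n) {T : MoyalAlgebra n θ} (hT : T ∈ polySpace n θ d) :
    poly θ (X μ) * T ∈ polySpace n θ (d + 1) := by
  obtain ⟨p, hp, rfl⟩ := hT
  rw [X_mul_poly]
  refine poly_mem_polySpace (Submodule.add_mem _ (X_mul_mem_polyDeg μ hp)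
    (Submodule.smul_mem _ _ (polyDeg_mono (Nat.le_succ d) (thetaDeriv_mem μ ?_))))
  exact polyDeg_mono (Nat.le_succ d) hp

lemma polySpace_one_mul {d : ℕ} {S T : MoyalAlgebra n θ} (hS : S ∈ polySpace n θ 1)
    (hT : T ∈ polySpace n θ d) : S * T ∈ polySpace n θ (d + 1) := by
  have h : polySpace n θ (0 + 1) ≤ (polySpace n θ (d + 1)).comap (LinearMap.mulRight ℂ T) := by
    refine polySpace_succ_le ?_ fun μ p hp => ?_
    · rw [Submodule.mem_comap, LinearMap.mulRight_apply, one_mul]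
      exact polySpace_mono (Nat.le_succ d) hT
    · obtain ⟨c, hc⟩ := polySpace_zero (poly_mem_polySpace (θ := θ) hp)
      have hp' : p = C c := poly_injective (θ := θ) (by rw [hc, poly_C])
      rw [Submodule.mem_comap, LinearMap.mulRight_apply, hp', mul_comm, ← smul_eq_C_mul, map_smul,
        smul_mul_assoc]
      exact Submodule.smul_mem _ _ (X_mul_mem μ hT)
  exact h hS

lemma commutator_X_mem {d : ℕ} (μ : Idx n) {T : MoyalAlgebra n θ} (hT : T ∈ polySpace n θ (d + 1)) :
    poly θ (X μ) * T - T * poly θ (X μ) ∈ polySpace n θ d := by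
  obtain ⟨p, hp, rfl⟩ := hT
  rw [commutator_X]
  exact Submodule.smul_mem _ _ (poly_mem_polySpace (thetaDeriv_mem μ hp))

lemma commutator_one_mem {d : ℕ} {S T : MoyalAlgebra n θ} (hS : S ∈ polySpace n θ 1)
    (hT : T ∈ polySpace n θ (d + 1)) : S * T - T * S ∈ polySpace n θ d := by
  have h : polySpace n θ (0 + 1) ≤ (polySpace n θ d).comap
      (LinearMap.mulRight ℂ T - LinearMap.mulLeft ℂ T) := by
    refine polySpace_succ_le ?_ fun μ p hp => ?_
    · rw [Submodule.mem_comap]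
      simp
    · obtain ⟨c, hc⟩ := polySpace_zero (poly_mem_polySpace (θ := θ) hp)
      have hp' : p = C c := poly_injective (θ := θ) (by rw [hc, poly_C])
      rw [Submodule.mem_comap, hp', mul_comm, ← smul_eq_C_mul, map_smul, map_smul]
      exact Submodule.smul_mem _ _ (commutator_X_mem μ hT)
  exact h hS

lemma X_mul_eq (μ : Idx n) (p : MvPolynomial (Idx n) ℂ) : poly θ (X μ * p) =
    poly θ (X μ) * poly θ p - (Complex.I / 2) • poly θ (thetaDeriv θ μ p) := by
  rw [X_mul_poly, map_add, map_smul, thetaDeriv, add_sub_cancel_right]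

lemma commutator_two_mem {S T : MoyalAlgebra n θ} (hS : S ∈ polySpace n θ 2)
    (hT : T ∈ polySpace n θ 2) : S * T - T * S ∈ polySpace n θ 2 := by
  have h : polySpace n θ (1 + 1) ≤ (polySpace n θ 2).comap
      (LinearMap.mulRight ℂ T - LinearMap.mulLeft ℂ T) := by
    refine polySpace_succ_le ?_ fun μ p hp => ?_
    · rw [Submodule.mem_comap]
      simp
    · obtain ⟨c, hc⟩ := polySpace_zero (poly_mem_polySpace (θ := θ) (thetaDeriv_mem (θ := θ) μ hp))
      rw [Submodule.mem_comap, X_mul_eq, hc]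
      have e : (LinearMap.mulRight ℂ T - LinearMap.mulLeft ℂ T)
          (poly θ (X μ) * poly θ p - (Complex.I / 2) • c • 1) =
          poly θ (X μ) * (poly θ p * T - T * poly θ p) +
            (poly θ (X μ) * T - T * poly θ (X μ)) * poly θ p := by
        simp [sub_mul, mul_sub, mul_assoc]
      rw [e]
      exact Submodule.add_mem _
        (X_mul_mem μ (commutator_one_mem (d := 1) (poly_mem_polySpace hp) hT))
        (polySpace_one_mul (commutator_X_mem (d := 1) μ hT) (poly_mem_polySpace hp))
  exact h hS

lemma const_of_commute {p : MvPolynomial (Idx n) ℂ}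
    (h : ∀ μ, poly θ (X μ) * poly θ p - poly θ p * poly θ (X μ) = 0) : p = C (eval 0 p) := by
  refine eq_C_of_pderiv fun ρ => ?_
  have h1 : ∀ μ, thetaDeriv θ μ p = 0 := fun μ => by
    have := h μ
    rw [commutator_X, smul_eq_zero] at this
    exact poly_injective (θ := θ) ((this.resolve_left Complex.I_ne_zero).trans (map_zero _).symm)
  have h2 : ∑ μ, ((thetaMatrix n θ)⁻¹ ρ μ : ℂ) • thetaDeriv θ μ p = pderiv ρ p := by
    have hm : (thetaMatrix n θ)⁻¹ * thetaMatrix n θ = 1 :=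
      mul_eq_one_comm.1 (thetaMatrix_mul_inv n θ)
    simp only [thetaDeriv, Finset.smul_sum, smul_smul]
    rw [Finset.sum_comm]
    simp only [← Finset.sum_smul]
    have : ∀ ν, ∑ μ, (((thetaMatrix n θ)⁻¹ ρ μ : ℝ) : ℂ) * (thetaMatrix n θ μ ν : ℂ) =
        (((1 : Matrix (Idx n) (Idx n) ℝ) ρ ν : ℝ) : ℂ) := fun ν => by
      rw [← hm, Matrix.mul_apply]; push_cast; rfl
    simp only [this, Matrix.one_apply]
    rw [Finset.sum_eq_single ρ]
    · simp
    · intro ν _ hν; simp [hν.symm]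
    · simp
  rw [← h2]
  simp [h1]

end Quadratic

open GradedDouble

section GradedMoyal

/-- The graded algebra `𝔸^• = ℳ^0 ⊕ ℳ^1`. -/
abbrev GradedMoyal (n : ℕ) (θ : ℝ) [NeZero θ] : Type := GradedDouble (MoyalAlgebra n θ)

/-- `𝒫_2^0 ⊕ 𝒫_1^1`: pairs of polynomial functions of degrees at most `2` and at most `1`. -/
noncomputable def polyPairs (n : ℕ) (θ : ℝ) [NeZero θ] : Submodule ℂ (GradedMoyal n θ) where
  carrier := {a | a.1 ∈ polySpace n θ 2 ∧ a.2 ∈ polySpace n θ 1}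
  add_mem' ha hb := ⟨Submodule.add_mem _ ha.1 hb.1, Submodule.add_mem _ ha.2 hb.2⟩
  zero_mem' := ⟨Submodule.zero_mem _, Submodule.zero_mem _⟩
  smul_mem' c _ ha := ⟨Submodule.smul_mem _ c ha.1, Submodule.smul_mem _ c ha.2⟩

/-- The homogeneous parts of `𝒫_2^0 ⊕ 𝒫_1^1`. -/
noncomputable def homPolyPairs (n : ℕ) (θ : ℝ) [NeZero θ] (α : ZMod 2) :
    Submodule ℂ (GradedMoyal n θ) :=
  polyPairs n θ ⊓ homogeneous (MoyalAlgebra n θ) α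

variable {n : ℕ} {θ : ℝ} [NeZero θ]

lemma gradedBracket_mem {α β : ZMod 2} {a b : GradedMoyal n θ} (ha : a ∈ homPolyPairs n θ α)
    (hb : b ∈ homPolyPairs n θ β) : gradedBracket a b ∈ homPolyPairs n θ (α + β) := by
  have hz : ∀ γ : ZMod 2, γ = 0 ∨ γ = 1 := by decide
  have h11 : (1 : ZMod 2) + 1 = 0 := by decide
  obtain ⟨⟨ha0, ha1⟩, hah⟩ := ha
  obtain ⟨⟨hb0, hb1⟩, hbh⟩ := hb
  rw [gradedBracket_eq]
  refine ⟨⟨?_, ?_⟩, ?_⟩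
  · rw [fst_mk]
    exact Submodule.add_mem _ (commutator_two_mem ha0 hb0) (Submodule.add_mem _
      (polySpace_one_mul ha1 hb1) (polySpace_one_mul hb1 ha1))
  · rw [snd_mk, ← neg_sub (b.2 * a.1)]
    exact Submodule.add_mem _ (Submodule.neg_mem _ (commutator_one_mem hb1 ha0))
      (commutator_one_mem ha1 hb0)
  · rcases hz α with rfl | rfl <;> rcases hz β with rfl | rfl <;>
    simp only [mem_homogeneous_zero, mem_homogeneous_one, h11, zero_add, add_zero, SetLike.mem_coe] at * <;> simp [hah, hbh]

/-- `𝒢_2^•`, the image of `𝒫_2^0 ⊕ 𝒫_1^1` under `Ad`, a graded Lie subalgebra of `Der (𝔸^•)`. -/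
noncomputable def gradedG2 (n : ℕ) (θ : ℝ) [NeZero θ] :
    GradedLieSubalgebra (homogeneous (MoyalAlgebra n θ)) where
  carrier α := (homPolyPairs n θ α).map Ad
  le_derivations α := by
    rintro _ ⟨a, ha, rfl⟩
    exact Ad_mem_derivations ha.2
  commutator_mem := by
    rintro α β _ _ ⟨a, ha, rfl⟩ ⟨b, hb, rfl⟩
    rw [gradedCommutator_Ad ha.2 hb.2]
    exact Submodule.mem_map_of_mem (gradedBracket_mem ha hb)

/-- The value `P (0)` of a polynomial function `P` of degree at most `d`. -/
noncomputable def evalZero (n : ℕ) (θ : ℝ) [NeZero θ] (d : ℕ) : polySpace n θ d →ₗ[ℂ] ℂ :=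
  (MvPolynomial.aeval (R := ℂ) (fun _ : Idx n => (0 : ℂ))).toLinearMap ∘ₗ
    (polyDeg n d).subtype ∘ₗ
      (Submodule.equivMapOfInjective (poly θ) poly_injective (polyDeg n d)).symm.toLinearMap

lemma evalZero_poly {d : ℕ} (p : MvPolynomial (Idx n) ℂ) (hp : poly θ p ∈ polySpace n θ d) :
    evalZero n θ d ⟨poly θ p, hp⟩ = MvPolynomial.eval 0 p := by
  obtain ⟨q, hq, hqp⟩ := hp
  obtain rfl := poly_injective hqp
  have h : (Submodule.equivMapOfInjective (poly θ) poly_injective (polyDeg n d)).symm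
      ⟨poly θ q, Submodule.mem_map_of_mem hq⟩ = ⟨q, hq⟩ := by
    rw [LinearEquiv.symm_apply_eq]; rfl
  change MvPolynomial.aeval _ (((Submodule.equivMapOfInjective (poly θ) poly_injective
    (polyDeg n d)).symm ⟨poly θ q, Submodule.mem_map_of_mem hq⟩ : polyDeg n d) :
      MvPolynomial (Idx n) ℂ) = _
  rw [h, MvPolynomial.aeval_def]
  rfl

lemma fst_mem_polySpace {α : ZMod 2} {a : GradedMoyal n θ} (ha : a ∈ homPolyPairs n θ α) :
    a.1 ∈ polySpace n θ 2 := ha.1.1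

lemma mem_homogeneous_of_mem {α : ZMod 2} {a : GradedMoyal n θ} (ha : a ∈ homPolyPairs n θ α) :
    a ∈ homogeneous (MoyalAlgebra n θ) α := ha.2

lemma evalZero_eq {d : ℕ} {p : MvPolynomial (Idx n) ℂ} {b : MoyalAlgebra n θ} (h : poly θ p = b)
    (hb : b ∈ polySpace n θ d) : evalZero n θ d ⟨b, hb⟩ = MvPolynomial.eval 0 p := by
  subst h
  exact evalZero_poly p hb

/-- The map `(P_0, P_1) ↦ (P_0 - P_0 (0), P_1)` on homogeneous elements. -/
noncomputable def subZero (n : ℕ) (θ : ℝ) [NeZero θ] (α : ZMod 2) :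
    homPolyPairs n θ α →ₗ[ℂ] GradedMoyal n θ where
  toFun a := mk (a.1.1 - evalZero n θ 2 ⟨a.1.1, fst_mem_polySpace a.2⟩ • 1) a.1.2
  map_add' a b := by
    have := map_add (evalZero n θ 2) ⟨a.1.1, fst_mem_polySpace a.2⟩ ⟨b.1.1, fst_mem_polySpace b.2⟩
    rw [AddMemClass.mk_add_mk] at this
    refine GradedDouble.ext ?_ rfl
    refine Eq.trans (congrArg (fun c : ℂ => (a.1.1 + b.1.1) - c • (1 : MoyalAlgebra n θ)) this) ?_
    rw [add_smul]
    exact add_sub_add_comm _ _ _ _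
  map_smul' c a := by
    have := map_smul (evalZero n θ 2) c ⟨a.1.1, fst_mem_polySpace a.2⟩
    rw [SetLike.mk_smul_mk] at this
    refine GradedDouble.ext ?_ rfl
    refine Eq.trans (congrArg (fun c' : ℂ => c • a.1.1 - c' • (1 : MoyalAlgebra n θ)) this) ?_
    rw [fst_smul, smul_sub, smul_smul]
    rfl

lemma subZero_eq_zero {α : ZMod 2} (a : homPolyPairs n θ α) (h : Ad a.1 = 0) :
    subZero n θ α a = 0 := by
  obtain ⟨a, ha⟩ := a
  change Ad a = 0 at h
  obtain ⟨p, -, hpa⟩ := fst_mem_polySpace ha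
  have h2 : a.2 = 0 := by
    have := congrArg GradedDouble.fst (LinearMap.congr_fun h (mk 0 1))
    change (Ad a (mk 0 1)).1 = 0 at this
    rw [Ad_apply, gradedBracket_eq] at this
    simp only [mul_zero, zero_mul, sub_zero, zero_add, mul_one, one_mul] at this
    rw [← two_smul ℂ, smul_eq_zero] at this
    exact this.resolve_left two_ne_zero
  have h3 : p = MvPolynomial.C (MvPolynomial.eval 0 p) := by
    refine const_of_commute (θ := θ) fun μ => ?_
    have := congrArg GradedDouble.fst (LinearMap.congr_fun h (mk (poly θ (MvPolynomial.X μ)) 0))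
    change (Ad a (mk (poly θ (MvPolynomial.X μ)) 0)).1 = 0 at this
    rw [Ad_apply, gradedBracket_eq] at this
    simp only [mul_zero, zero_mul, add_zero, ← hpa] at this
    rw [← neg_sub, this, neg_zero]
  refine GradedDouble.ext ?_ h2
  change a.1 - evalZero n θ 2 ⟨a.1, fst_mem_polySpace ha⟩ • 1 = 0
  rw [evalZero_eq hpa, ← poly_C, ← h3, hpa, sub_self]

/-- A linear map descends along a surjective linear map whose kernel it annihilates. -/
noncomputable def descend {V W U : Type*} [AddCommGroup V] [AddCommGroup W] [AddCommGroup U]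
    [Module ℂ V] [Module ℂ W] [Module ℂ U] (f : V →ₗ[ℂ] W) (hf : Function.Surjective f)
    (g : V →ₗ[ℂ] U) (h : ∀ v, f v = 0 → g v = 0) : W →ₗ[ℂ] U :=
  (LinearMap.ker f).liftQ g (fun v hv => h v hv) ∘ₗ (f.quotKerEquivOfSurjective hf).symm.toLinearMap

lemma descend_apply {V W U : Type*} [AddCommGroup V] [AddCommGroup W] [AddCommGroup U]
    [Module ℂ V] [Module ℂ W] [Module ℂ U] (f : V →ₗ[ℂ] W) (hf : Function.Surjective f)
    (g : V →ₗ[ℂ] U) (h : ∀ v, f v = 0 → g v = 0) (v : V) : descend f hf g h (f v) = g v := by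
  have : (f.quotKerEquivOfSurjective hf).symm (f v) = Submodule.Quotient.mk v := by
    rw [LinearEquiv.symm_apply_eq]; rfl
  rw [descend, LinearMap.comp_apply, LinearEquiv.coe_coe, this]
  rfl

/-- The element `Ad_a` of `𝒢_2^•`, for a homogeneous element `a` of `𝒫_2^0 ⊕ 𝒫_1^1`. -/
noncomputable def adG2 {α : ZMod 2} (a : GradedMoyal n θ) (ha : a ∈ homPolyPairs n θ α) :
    (gradedG2 n θ).carrier α :=
  ⟨Ad a, Submodule.mem_map_of_mem ha⟩

lemma etaFun_aux (α : ZMod 2) (v : homPolyPairs n θ α)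
    (hv : (Ad (R := MoyalAlgebra n θ)).submoduleMap (homPolyPairs n θ α) v = 0) :
    subZero n θ α v = 0 :=
  subZero_eq_zero v (congrArg Subtype.val hv)

/-- The linear map `η : 𝒢_2^• → 𝔸^•` with `η (Ad_{(P_0, P_1)}) = (P_0 - P_0 (0), P_1)`, in each
degree. -/
noncomputable def etaFun (n : ℕ) (θ : ℝ) [NeZero θ] (α : ZMod 2) :
    (gradedG2 n θ).carrier α →ₗ[ℂ] GradedMoyal n θ :=
  descend ((Ad (R := MoyalAlgebra n θ)).submoduleMap (homPolyPairs n θ α))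
    (LinearMap.submoduleMap_surjective _ _) (subZero n θ α) (etaFun_aux α)

lemma etaFun_adG2 {α : ZMod 2} (a : GradedMoyal n θ) (ha : a ∈ homPolyPairs n θ α) :
    etaFun n θ α (adG2 a ha) =
      mk (a.1 - evalZero n θ 2 ⟨a.1, fst_mem_polySpace ha⟩ • 1) a.2 :=
  descend_apply _ _ _ _ (⟨a, ha⟩ : homPolyPairs n θ α)

/-- The 1-form `η` of degree `0`. -/
noncomputable def eta (n : ℕ) (θ : ℝ) [NeZero θ] : OneForm (gradedG2 n θ) where
  toFun {α} := etaFun n θ α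
  mem {α} X := by
    have hz : ∀ γ : ZMod 2, γ = 0 ∨ γ = 1 := by decide
    obtain ⟨_, a, ha, rfl⟩ := X
    change etaFun n θ α (adG2 a ha) ∈ _
    rw [etaFun_adG2]
    rcases hz α with rfl | rfl
    · rw [mem_homogeneous_zero]
      exact (mem_homogeneous_zero (a := a)).1 (mem_homogeneous_of_mem ha)
    · have h0 := mem_homogeneous_one.1 (mem_homogeneous_of_mem ha)
      rw [mem_homogeneous_one]
      have h1 : poly θ 0 = a.1 := by rw [h0, map_zero]
      change a.1 - evalZero n θ 2 ⟨a.1, fst_mem_polySpace ha⟩ • 1 = 0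
      rw [evalZero_eq h1, map_zero, zero_smul, sub_zero, h0]

/-- `η (Ad_{(P_0, P_1)}) = (P_0 - P_0 (0), P_1)` for polynomials `P_0`, `P_1`. -/
lemma eta_Ad {α : ZMod 2} (p q : MvPolynomial (Idx n) ℂ)
    (h : mk (poly θ p) (poly θ q) ∈ homPolyPairs n θ α) :
    (eta n θ).toFun (adG2 _ h) = mk (poly θ p - MvPolynomial.eval 0 p • 1) (poly θ q) := by
  change etaFun n θ α (adG2 _ h) = _
  rw [etaFun_adG2]
  refine GradedDouble.ext ?_ rfl
  change poly θ p - evalZero n θ 2 ⟨poly θ p, fst_mem_polySpace h⟩ • 1 = _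
  rw [evalZero_poly]

/-- The polynomial `ξ_μ = -∑ ν, Θ⁻¹ μ ν x_ν`. -/
noncomputable def xiPoly (θ : ℝ) (μ : Idx n) : MvPolynomial (Idx n) ℂ :=
  -∑ ν, (((thetaMatrix n θ)⁻¹ μ ν : ℝ) : ℂ) • MvPolynomial.X ν

/-- `ξ_μ` as an element of the Moyal algebra. -/
noncomputable def xi (n : ℕ) (θ : ℝ) [NeZero θ] (μ : Idx n) : MoyalAlgebra n θ :=
  poly θ (xiPoly θ μ)

/-- The pointwise product `ξ_μ ξ_ν` as an element of the Moyal algebra. -/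
noncomputable def xiSq (n : ℕ) (θ : ℝ) [NeZero θ] (μ ν : Idx n) : MoyalAlgebra n θ :=
  poly θ (xiPoly θ μ * xiPoly θ ν)

/-- `T_μ = (η_μ, 0)`, `η_μ = i ξ_μ`. -/
noncomputable def genT (n : ℕ) (θ : ℝ) [NeZero θ] (μ : Idx n) : GradedMoyal n θ :=
  mk (Complex.I • xi n θ μ) 0

/-- `U_μ = (0, η_μ)`. -/
noncomputable def genU (n : ℕ) (θ : ℝ) [NeZero θ] (μ : Idx n) : GradedMoyal n θ :=
  mk 0 (Complex.I • xi n θ μ)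

/-- `M_{μν} = (η_{μν}, 0)`, `η_{μν} = i ξ_μ ξ_ν`. -/
noncomputable def genM (n : ℕ) (θ : ℝ) [NeZero θ] (μ ν : Idx n) : GradedMoyal n θ :=
  mk (Complex.I • xiSq n θ μ ν) 0

/-- `J = (0, i)`. -/
noncomputable def genJ (n : ℕ) (θ : ℝ) [NeZero θ] : GradedMoyal n θ := mk 0 (Complex.I • 1)

lemma xiPoly_mem (θ : ℝ) (μ : Idx n) : xiPoly θ μ ∈ polyDeg n 1 :=
  Submodule.neg_mem _ (Submodule.sum_mem _ fun ν _ => Submodule.smul_mem _ _ (X_mem_polyDeg ν))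

lemma xi_mem (μ : Idx n) : xi n θ μ ∈ polySpace n θ 1 := poly_mem_polySpace (xiPoly_mem θ μ)

lemma xiSq_mem (μ ν : Idx n) : xiSq n θ μ ν ∈ polySpace n θ 2 := by
  refine poly_mem_polySpace ?_
  have h1 := xiPoly_mem θ μ
  have h2 := xiPoly_mem θ ν
  rw [MvPolynomial.mem_restrictTotalDegree] at *
  refine (MvPolynomial.totalDegree_mul _ _).trans ?_
  omega

lemma genT_mem (μ : Idx n) : genT n θ μ ∈ homPolyPairs n θ 0 :=
  ⟨⟨Submodule.smul_mem _ _ (polySpace_mono one_le_two (xi_mem μ)), Submodule.zero_mem _⟩,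
    mem_homogeneous_zero.2 rfl⟩

lemma genU_mem (μ : Idx n) : genU n θ μ ∈ homPolyPairs n θ 1 :=
  ⟨⟨Submodule.zero_mem _, Submodule.smul_mem _ _ (xi_mem μ)⟩, mem_homogeneous_one.2 rfl⟩

lemma genM_mem (μ ν : Idx n) : genM n θ μ ν ∈ homPolyPairs n θ 0 :=
  ⟨⟨Submodule.smul_mem _ _ (xiSq_mem μ ν), Submodule.zero_mem _⟩, mem_homogeneous_zero.2 rfl⟩

lemma genJ_mem : genJ n θ ∈ homPolyPairs n θ 1 :=
  ⟨⟨Submodule.zero_mem _, Submodule.smul_mem _ _ (one_mem_polySpace 1)⟩,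
    mem_homogeneous_one.2 rfl⟩

/-- `Ad_{T_μ}`. -/
noncomputable def adT (n : ℕ) (θ : ℝ) [NeZero θ] (μ : Idx n) : (gradedG2 n θ).carrier 0 :=
  adG2 (genT n θ μ) (genT_mem μ)

/-- `Ad_{U_μ}`. -/
noncomputable def adU (n : ℕ) (θ : ℝ) [NeZero θ] (μ : Idx n) : (gradedG2 n θ).carrier 1 :=
  adG2 (genU n θ μ) (genU_mem μ)

/-- `Ad_{M_{μν}}`. -/
noncomputable def adM (n : ℕ) (θ : ℝ) [NeZero θ] (μ ν : Idx n) : (gradedG2 n θ).carrier 0 :=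
  adG2 (genM n θ μ ν) (genM_mem μ ν)

/-- `Ad_J`. -/
noncomputable def adJ (n : ℕ) (θ : ℝ) [NeZero θ] : (gradedG2 n θ).carrier 1 :=
  adG2 (genJ n θ) genJ_mem

/-- The 1-form connection `-i A` obtained from `A` by the rescaling `A ↦ -i A`. -/
noncomputable def connectionForm (A : OneForm (gradedG2 n θ)) : OneForm (gradedG2 n θ) :=
  (-Complex.I) • A

/-- The tensor 1-form `𝒜 = -i A + η`, whose values are the covariant coordinates. -/
noncomputable def tensorForm (A : OneForm (gradedG2 n θ)) : OneForm (gradedG2 n θ) :=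
  connectionForm A + eta n θ

end GradedMoyal

section CovariantCoordinates

variable {n : ℕ} {θ : ℝ} [NeZero θ]

/-- `A^0_μ`, with `A (Ad_{T_μ}) = (A^0_μ, 0)`. -/
noncomputable def compT (A : OneForm (gradedG2 n θ)) (μ : Idx n) : MoyalAlgebra n θ := (A.toFun (adT n θ μ)).1

/-- `A^1_μ`, with `A (Ad_{U_μ}) = (0, A^1_μ)`. -/
noncomputable def compU (A : OneForm (gradedG2 n θ)) (μ : Idx n) : MoyalAlgebra n θ := (A.toFun (adU n θ μ)).2

/-- `G^0_{μν}`, with `A (Ad_{M_{μν}}) = (G^0_{μν}, 0)`. -/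
noncomputable def compM (A : OneForm (gradedG2 n θ)) (μ ν : Idx n) : MoyalAlgebra n θ :=
  (A.toFun (adM n θ μ ν)).1

/-- `φ`, with `A (Ad_J) = (0, φ)`. -/
noncomputable def compJ (A : OneForm (gradedG2 n θ)) : MoyalAlgebra n θ := (A.toFun (adJ n θ)).2

/-- The covariant coordinate `𝒜^0_μ = A^0_μ - ξ_μ`. -/
noncomputable def covT (A : OneForm (gradedG2 n θ)) (μ : Idx n) : MoyalAlgebra n θ :=
  compT A μ - xi n θ μ

/-- The covariant coordinate `𝒜^1_μ = A^1_μ - ξ_μ`. -/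
noncomputable def covU (A : OneForm (gradedG2 n θ)) (μ : Idx n) : MoyalAlgebra n θ :=
  compU A μ - xi n θ μ

/-- The covariant coordinate `𝒢^0_{μν} = G^0_{μν} - ξ_μ ξ_ν`. -/
noncomputable def covM (A : OneForm (gradedG2 n θ)) (μ ν : Idx n) : MoyalAlgebra n θ :=
  compM A μ ν - xiSq n θ μ ν

/-- The covariant coordinate `Φ = φ - 1`. -/
noncomputable def covJ (A : OneForm (gradedG2 n θ)) : MoyalAlgebra n θ := compJ A - 1

/-- The entry `Θ⁻¹ μ ν`, as a complex number. -/
noncomputable def thetaInv (n : ℕ) (θ : ℝ) (μ ν : Idx n) : ℂ := ((thetaMatrix n θ)⁻¹ μ ν : ℝ)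

end CovariantCoordinates

end Moyal

open Moyal

set_option linter.unusedSimpArgs false
set_option linter.unnecessarySeqFocus false

namespace Moyal

/-! Every derivation in `gradedG2` is inner, and this turns the curvature into a bracket of
covariant coordinates. Write `ω = -iA` and let `X = Ad_a`, `Y = Ad_b` be homogeneous with `η(X) =
a`, `η(Y) = b`. Then `X(ω(Y)) = [a, ω(Y)]_•`, while `-(-1)^{|X||Y|} Y(ω(X)) = [ω(X), b]_•` by graded
antisymmetry. Together with `[ω(X), ω(Y)]_•`, which is the term `ωω`, these are the expansion of
`[ω(X) + a, ω(Y) + b]_•` with the single term `[a, b]_•` missing. Now split `[a, b]_• = c + k·1`,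
where `η(Ad_c) = c`. The unit is central, so `[X, Y]_• = Ad_c`, and with `𝒜 = ω + η` F(Ad_a, Ad_b) =
[𝒜(Ad_a), 𝒜(Ad_b)]_• - 𝒜(Ad_c) - k. This is `curvature_eq`. The number `k` measures how far `η` is
from respecting brackets. It is also minus the curvature at `ω = -η`, where `𝒜` vanishes.

The ten components are ten instances of this formula, so what remains is the multiplication table of
the generators. It rests on two facts about the Moyal product: `[x_μ, x_ν]_⋆ = iΘ_{μν}`, which gives
`[ξ_μ, ξ_ν]_⋆ = -iΘ⁻¹_{μν}` (`xi_mul_xi_sub`), and the identification of the pointwise product `ξ_μ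
ξ_ν` with the symmetrised star product (`xiSq_eq`). Commutators with quadratic elements then follow
from the Leibniz rule (`xiSq_mul_xi_sub`, `xiSq_mul_xiSq_sub`). A bracket of two odd elements is an
anticommutator, and all other brackets are commutators. Hence `[U_μ, U_ν] = 2i M_{μν}`, `[U_μ, J] =
2i T_μ` and `[T_μ, U_ν] = Θ⁻¹_{μν} J`, the elements `M_{μν}` act linearly on the `T`, on the `U` and
on the `M`, and `J` commutes with `T_μ` and `M_{μν}`. Only `[T_μ, T_ν] = iΘ⁻¹_{μν}` and `[J, J] =
-2` contribute a constant `k`.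

The description of the curvature as `[∇_X, ∇_Y]_• - ∇_{[X,Y]_•}` needs none of this: it holds for
every graded Lie algebra of derivations, by the graded Leibniz rule (`gradedCommutator_nabla_sub`).
-/

lemma gradedSign_mul_swap (α β : ZMod 2) : gradedSign α β * gradedSign β α = 1 := by
  rw [gradedSign, gradedSign, mul_comm β.val, ← mul_pow]
  simp

/-! ### Curvature of a graded connection -/

namespace OneForm

variable {A : Type*} [Ring A] [Algebra ℂ A] {𝒜 : ZMod 2 → Submodule ℂ A}
  {𝒢 : GradedLieSubalgebra 𝒜}

/-- The operator on the left looks like a first-order one, but its first-order terms cancel.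
Expanding `X(ω(Y)a)` gives a term `(-1)^{|X||Y|} ω(Y)X(a)`, which the product `∇_Y ∇_X` removes.
Symmetrically, `ω(X)Y(a)` is removed because the signs for `(X, Y)` and `(Y, X)` multiply to `1`.
What survives is left multiplication by an element of the algebra. -/
lemma gradedCommutator_nabla_sub (ω : OneForm 𝒢) {α β : ZMod 2} (X : 𝒢.carrier α)
    (Y : 𝒢.carrier β) :
    gradedCommutator α β (ω.nabla X) (ω.nabla Y) - ω.nabla (𝒢.bracket X Y) =
      LinearMap.mulLeft ℂ (ω.curvature X Y) := by
  refine LinearMap.ext fun a => ?_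
  -- A 1-form of degree `0` gives `ω(Y)` the degree of `Y`, so the sign in the graded Leibniz rule
  -- is the one that appears in the graded commutator.
  have hX := (𝒢.le_derivations α X.2 β _ (ω.mem Y)).2 a
  have hY := (𝒢.le_derivations β Y.2 α _ (ω.mem X)).2 a
  simp only [gradedCommutator, nabla, curvature, d, prod, GradedLieSubalgebra.bracket,
    LinearMap.sub_apply, LinearMap.add_apply, LinearMap.smul_apply, Module.End.mul_apply,
    LinearMap.mulLeft_apply, hX, hY, smul_add, smul_smul, gradedSign_mul_swap,
    one_smul, add_mul, sub_mul, mul_add, smul_mul_assoc, mul_assoc]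
  abel

/-- The bracket of `X` and `Y` lives in degree `α + β`, whereas the generators are declared in
degree `0` or `1`. This allows the two to be compared through their underlying linear maps, without
casts. -/
lemma toFun_congr (ω : OneForm 𝒢) {α β : ZMod 2} (h : α = β) {X : 𝒢.carrier α}
    {Y : 𝒢.carrier β} (hXY : X.1 = Y.1) : ω.toFun X = ω.toFun Y := by
  subst h
  rw [Subtype.ext hXY]

end OneForm

/-! ### Star commutators of the linear and quadratic coordinate polynomials -/

section Generators

variable {n : ℕ} {θ : ℝ} [NeZero θ]

/-- The star products of `x_μ` with `p` from the left and from the right differ from the pointwise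
product by opposite first-order terms `±(i/2) ∑ Θ_{μν} ∂_ν p`, and all higher terms vanish because
one factor is linear. The mean of the two is therefore the pointwise product. -/
lemma poly_X_mul (μ : Idx n) (p : MvPolynomial (Idx n) ℂ) :
    poly θ (MvPolynomial.X μ * p) = (2⁻¹ : ℂ) • (poly θ (MvPolynomial.X μ) * poly θ p +
      poly θ p * poly θ (MvPolynomial.X μ)) := by
  have h := commutator_X (θ := θ) μ p
  -- The correction `(i/2) ∑ Θ_{μν} ∂_ν p` is half of the star commutator of `x_μ` and `p`.
  rw [X_mul_eq, div_eq_inv_mul, mul_smul, ← h, ← sub_eq_zero]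
  module

lemma xi_eq_sum (μ : Idx n) :
    xi n θ μ = ∑ ν, (-thetaInv n θ μ ν) • poly θ (MvPolynomial.X ν) := by
  simp [xi, xiPoly, thetaInv]

/-- This replaces the pointwise product by star products, after which the commutators of quadratic
elements become pure algebra. It is `poly_X_mul` extended linearly in the first factor. -/
lemma xiSq_eq (μ ν : Idx n) :
    xiSq n θ μ ν = (2⁻¹ : ℂ) • (xi n θ μ * xi n θ ν + xi n θ ν * xi n θ μ) := by
  -- Only the first factor is written out in coordinates; `ξ_ν` stays whole and plays the role of
  -- `p` in `poly_X_mul`.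
  have h : xiPoly θ μ * xiPoly θ ν =
      ∑ ρ, (-thetaInv n θ μ ρ) • (MvPolynomial.X ρ * xiPoly θ ν) := by
    conv_lhs => rw [xiPoly]
    simp [Finset.sum_mul, thetaInv]
  rw [xiSq, h, xi_eq_sum μ, map_sum, Finset.sum_mul, Finset.mul_sum, ← Finset.sum_add_distrib,
    Finset.smul_sum]
  refine Finset.sum_congr rfl fun ρ _ => ?_
  rw [map_smul, poly_X_mul, smul_mul_assoc, mul_smul_comm, ← smul_add, smul_comm, xi]

/-- The commutator with `x_μ` is `i ∑ Θ_{μρ} ∂_ρ`, and on `x_ν` only the term `ρ = ν` is nonzero. -/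
lemma commutator_X_X (μ ν : Idx n) :
    poly θ (MvPolynomial.X μ) * poly θ (MvPolynomial.X ν) -
      poly θ (MvPolynomial.X ν) * poly θ (MvPolynomial.X μ) =
        (Complex.I * thetaMatrix n θ μ ν) • (1 : MoyalAlgebra n θ) := by
  rw [commutator_X, mul_smul, ← poly_one, ← map_smul (poly θ) (thetaMatrix n θ μ ν : ℂ)]
  congr 2
  rw [thetaDeriv, Finset.sum_eq_single ν]
  · rw [MvPolynomial.pderiv_X_self]
  · intro ρ _ h
    rw [MvPolynomial.pderiv_X_of_ne h.symm, smul_zero]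
  · simp

/-- By bilinearity the commutator is `i` times the matrix `Θ⁻¹ Θ (Θ⁻¹)ᵀ`. Since `Θ⁻¹` is
antisymmetric this matrix equals `-Θ⁻¹`. The minus signs in the two `ξ` cancel. -/
lemma xi_mul_xi_sub (μ ν : Idx n) :
    xi n θ μ * xi n θ ν - xi n θ ν * xi n θ μ =
      (-(Complex.I * thetaInv n θ μ ν)) • (1 : MoyalAlgebra n θ) := by
  -- This is `Θ (Θ⁻¹)ᵀ = -1`: transposing the antisymmetric inverse produces the sign.
  have h1 : ∀ ρ, ∑ σ, (thetaMatrix n θ ρ σ : ℂ) * thetaInv n θ ν σ = if ρ = ν then -1 else 0 := by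
    intro ρ
    have h := congrFun (congrFun (thetaMatrix_mul_inv n θ) ρ) ν
    rw [Matrix.mul_apply, Matrix.one_apply] at h
    have h2 : ∑ σ, thetaMatrix n θ ρ σ * (thetaMatrix n θ)⁻¹ ν σ = if ρ = ν then -1 else 0 := by
      simp only [thetaMatrix_inv_swap n θ _ ν, mul_neg, Finset.sum_neg_distrib, h]
      split_ifs <;> simp
    have h3 := congrArg (fun r : ℝ => (r : ℂ)) h2
    simp only [thetaInv]
    push_cast at h3
    rw [h3]
    split_ifs <;> simp
  have h2 : xi n θ μ * xi n θ ν - xi n θ ν * xi n θ μ =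
      ∑ ρ, ∑ σ, (thetaInv n θ μ ρ * thetaInv n θ ν σ * (Complex.I * thetaMatrix n θ ρ σ)) •
        (1 : MoyalAlgebra n θ) := by
    -- The order of summation is exchanged in the second product only, so that both double sums run
    -- over the same pairs of coordinates and can be subtracted termwise.
    rw [xi_eq_sum μ, xi_eq_sum ν, Finset.sum_mul_sum, Finset.sum_mul_sum,
      Finset.sum_comm (f := fun i j => (-thetaInv n θ ν i) • poly θ (MvPolynomial.X i) *
        (-thetaInv n θ μ j) • poly θ (MvPolynomial.X j)), ← Finset.sum_sub_distrib]
    refine Finset.sum_congr rfl fun ρ _ => ?_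
    rw [← Finset.sum_sub_distrib]
    refine Finset.sum_congr rfl fun σ _ => ?_
    rw [mul_smul, ← commutator_X_X]
    simp only [smul_mul_assoc, mul_smul_comm, smul_smul, smul_sub, neg_mul_neg]
    rw [mul_comm (thetaInv n θ ν σ)]
  rw [h2]
  simp only [← Finset.sum_smul]
  congr 1
  calc _ = Complex.I * ∑ ρ, thetaInv n θ μ ρ *
        ∑ σ, (thetaMatrix n θ ρ σ : ℂ) * thetaInv n θ ν σ := by
        simp only [Finset.mul_sum]
        refine Finset.sum_congr rfl fun ρ _ => Finset.sum_congr rfl fun σ _ => ?_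
        ring
    _ = _ := by simp [h1]

/-- A commutator is a derivation, and the commutators of the linear coordinates are scalars. Each of
the two orderings in the symmetrised product contributes the same result, which cancels the factor
`1/2`. -/
lemma xiSq_mul_xi_sub (μ ν ρ : Idx n) :
    xiSq n θ μ ν * xi n θ ρ - xi n θ ρ * xiSq n θ μ ν =
      (-(Complex.I * thetaInv n θ ν ρ)) • xi n θ μ +
        (-(Complex.I * thetaInv n θ μ ρ)) • xi n θ ν := by
  have h1 := xi_mul_xi_sub (θ := θ) μ ρ
  have h2 := xi_mul_xi_sub (θ := θ) ν ρ
  rw [xiSq_eq]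
  set a := xi n θ μ
  set b := xi n θ ν
  set c := xi n θ ρ
  -- The Leibniz rule for `[·, c]`, arranged so that only the commutators of single coordinates,
  -- known from `h1` and `h2`, remain.
  have h : (2⁻¹ : ℂ) • (a * b + b * a) * c - c * (2⁻¹ : ℂ) • (a * b + b * a) = (2⁻¹ : ℂ) •
      (a * (b * c - c * b) + (a * c - c * a) * b + b * (a * c - c * a) + (b * c - c * b) * a) := by
    rw [smul_mul_assoc, mul_smul_comm, ← smul_sub]
    congr 1
    noncomm_ring
  rw [h, h1, h2]
  simp only [mul_smul_comm, smul_mul_assoc, mul_one, one_mul]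
  module

/-- The commutator with a quadratic element is a derivation that sends linear coordinates to linear
coordinates by `xiSq_mul_xi_sub`. Applied to a symmetrised product it replaces each factor in turn,
and the outcome is again symmetrised, hence a combination of pointwise products. -/
lemma xiSq_mul_xiSq_sub (μ ν ρ σ : Idx n) :
    xiSq n θ μ ν * xiSq n θ ρ σ - xiSq n θ ρ σ * xiSq n θ μ ν =
      (-Complex.I) • (thetaInv n θ ν σ • xiSq n θ μ ρ + thetaInv n θ ν ρ • xiSq n θ μ σ +
        thetaInv n θ μ σ • xiSq n θ ν ρ + thetaInv n θ μ ρ • xiSq n θ ν σ) := by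
  have h1 := xiSq_mul_xi_sub (θ := θ) μ ν ρ
  have h2 := xiSq_mul_xi_sub (θ := θ) μ ν σ
  -- The first quadratic element is kept opaque: only its action on the linear coordinates is used.
  -- The rewriting by `xiSq_eq` that follows thus affects only the second factor and the right-hand
  -- side.
  set s := xiSq n θ μ ν
  simp only [xiSq_eq]
  set c := xi n θ ρ
  set d := xi n θ σ
  -- The Leibniz rule for `[s, ·]` on the symmetrised product of `c` and `d`.
  have h : s * (2⁻¹ : ℂ) • (c * d + d * c) - (2⁻¹ : ℂ) • (c * d + d * c) * s = (2⁻¹ : ℂ) •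
      ((s * c - c * s) * d + c * (s * d - d * s) + (s * d - d * s) * c + d * (s * c - c * s)) := by
    rw [smul_mul_assoc, mul_smul_comm, ← smul_sub]
    congr 1
    noncomm_ring
  rw [h, h1, h2]
  simp only [mul_smul_comm, smul_mul_assoc, mul_add, add_mul]
  module

end Generators

/-! ### The graded bracket on homogeneous elements -/

namespace GradedDouble

variable {R : Type*} [Ring R] [Algebra ℂ R]

/-- Of the four terms in the definition of the bracket only the one in the degrees of `a` and `b`
survives. This form, with its explicit sign, is the one that matches the definition of the
curvature. -/
lemma gradedBracket_homogeneous {α β : ZMod 2} {a b : GradedDouble R} (ha : a ∈ homogeneous R α)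
    (hb : b ∈ homogeneous R β) : gradedBracket a b = a * b - gradedSign α β • (b * a) := by
  have hz : ∀ γ : ZMod 2, γ = 0 ∨ γ = 1 := by decide
  rcases hz α with rfl | rfl <;> rcases hz β with rfl | rfl <;>
    simp only [mem_homogeneous_zero, mem_homogeneous_one, gradedSign_zero_left,
      gradedSign_zero_right, gradedSign_one_one, gradedBracket_eq] at * <;>
    refine GradedDouble.ext ?_ ?_ <;> simp [ha, hb]

/-- The unit is even and central. Consequently a scalar in the bracket of two generators is
invisible to the bracket of the derivations, and this is where the constant terms of the curvature
come from. -/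
lemma Ad_add_smul_one (c : GradedDouble R) (k : ℂ) : Ad (c + k • 1) = Ad c := by
  refine LinearMap.ext fun a => ?_
  rw [Ad_apply, Ad_apply, gradedBracket_eq, gradedBracket_eq]
  refine GradedDouble.ext ?_ ?_ <;> simp [add_mul, mul_add]

/-- This lemma and the next two serve twice: with `z = i` for the generators and with `z = -i` for
the components of the tensor 1-form. In both cases `z * z = -1`. -/
lemma gradedBracket_smul_even_even (z : ℂ) (a b : R) :
    gradedBracket (z • mk a 0) (z • mk b 0) = (z * z) • mk (a * b - b * a) 0 := by
  rw [gradedBracket_eq]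
  refine GradedDouble.ext ?_ ?_ <;> simp [mul_smul, smul_sub]

lemma gradedBracket_smul_even_odd (z : ℂ) (a b : R) :
    gradedBracket (z • mk a 0) (z • mk 0 b) = (z * z) • mk 0 (a * b - b * a) := by
  rw [gradedBracket_eq]
  refine GradedDouble.ext ?_ ?_ <;> simp [mul_smul, smul_sub]

lemma gradedBracket_smul_odd_odd (z : ℂ) (a b : R) :
    gradedBracket (z • mk 0 a) (z • mk 0 b) = (z * z) • mk (a * b + b * a) 0 := by
  rw [gradedBracket_eq]
  refine GradedDouble.ext ?_ ?_ <;> simp [mul_smul, smul_add]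

end GradedDouble

open GradedDouble

/-! ### Covariant coordinates and the general curvature formula -/

section Covariant

variable {n : ℕ} {θ : ℝ} [NeZero θ]

/-- The only thing `η` removes is the value at the origin of the even component, so it returns the
chosen representative as soon as that value is zero. No condition is put on the odd component. -/
lemma eta_adG2 {α : ZMod 2} {a : GradedMoyal n θ} (ha : a ∈ homPolyPairs n θ α)
    {p : MvPolynomial (Idx n) ℂ} (hp : poly θ p = a.1) (hp0 : MvPolynomial.eval 0 p = 0) :
    (eta n θ).toFun (adG2 a ha) = a := by
  change etaFun n θ α (adG2 a ha) = _
  rw [etaFun_adG2, evalZero_eq hp, hp0, zero_smul, sub_zero]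

lemma eval_zero_xiPoly (μ : Idx n) : MvPolynomial.eval 0 (xiPoly θ μ) = 0 := by
  simp [xiPoly]

lemma eta_adT (μ : Idx n) : (eta n θ).toFun (adT n θ μ) = genT n θ μ :=
  eta_adG2 _ (p := Complex.I • xiPoly θ μ) (map_smul _ _ _)
    (by rw [MvPolynomial.smul_eval, eval_zero_xiPoly, mul_zero])

lemma eta_adU (μ : Idx n) : (eta n θ).toFun (adU n θ μ) = genU n θ μ :=
  -- The polynomial `p` represents the even component, which is zero for an odd element.
  eta_adG2 _ (p := 0) (map_zero _) (map_zero _)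

lemma eta_adM (μ ν : Idx n) : (eta n θ).toFun (adM n θ μ ν) = genM n θ μ ν :=
  eta_adG2 _ (p := Complex.I • (xiPoly θ μ * xiPoly θ ν)) (map_smul _ _ _)
    (by rw [MvPolynomial.smul_eval, map_mul, eval_zero_xiPoly, zero_mul, mul_zero])

/-- The constant in `J` is untouched because it sits in the odd component. An odd constant is not
central in the graded sense, so unlike an even one it is determined by its derivation. -/
lemma eta_adJ : (eta n θ).toFun (adJ n θ) = genJ n θ :=
  eta_adG2 _ (p := 0) (map_zero _) (map_zero _)

/-- For this lemma and its three analogues, a form of degree `0` preserves degrees, which forces the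
other component to vanish; the remaining equality holds by definition. -/
lemma toFun_adT (A : OneForm (gradedG2 n θ)) (μ : Idx n) :
    A.toFun (adT n θ μ) = .mk (compT A μ) 0 :=
  GradedDouble.ext rfl (mem_homogeneous_zero.1 (A.mem _))

lemma toFun_adU (A : OneForm (gradedG2 n θ)) (μ : Idx n) :
    A.toFun (adU n θ μ) = .mk 0 (compU A μ) :=
  GradedDouble.ext (mem_homogeneous_one.1 (A.mem _)) rfl

lemma toFun_adM (A : OneForm (gradedG2 n θ)) (μ ν : Idx n) :
    A.toFun (adM n θ μ ν) = .mk (compM A μ ν) 0 :=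
  GradedDouble.ext rfl (mem_homogeneous_zero.1 (A.mem _))

lemma toFun_adJ (A : OneForm (gradedG2 n θ)) : A.toFun (adJ n θ) = .mk 0 (compJ A) :=
  GradedDouble.ext (mem_homogeneous_one.1 (A.mem _)) rfl

lemma tensorForm_apply (A : OneForm (gradedG2 n θ)) {α : ZMod 2} (X : (gradedG2 n θ).carrier α) :
    (tensorForm A).toFun X = (-Complex.I) • A.toFun X + (eta n θ).toFun X := rfl

/-- Adding `η` contributes `iξ_μ`, and `-iA^0_μ + iξ_μ = -i(A^0_μ - ξ_μ)`. The covariant coordinates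
are normalised so that this factor `-i` comes out; the other three generators behave in the same
way. -/
lemma tensorForm_adT (A : OneForm (gradedG2 n θ)) (μ : Idx n) :
    (tensorForm A).toFun (adT n θ μ) = (-Complex.I) • .mk (covT A μ) 0 := by
  rw [tensorForm_apply, toFun_adT, eta_adT]
  refine GradedDouble.ext ?_ ?_ <;> simp [genT, covT, sub_eq_neg_add]

lemma tensorForm_adU (A : OneForm (gradedG2 n θ)) (μ : Idx n) :
    (tensorForm A).toFun (adU n θ μ) = (-Complex.I) • .mk 0 (covU A μ) := by
  rw [tensorForm_apply, toFun_adU, eta_adU]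
  refine GradedDouble.ext ?_ ?_ <;> simp [genU, covU, sub_eq_neg_add]

lemma tensorForm_adM (A : OneForm (gradedG2 n θ)) (μ ν : Idx n) :
    (tensorForm A).toFun (adM n θ μ ν) = (-Complex.I) • .mk (covM A μ ν) 0 := by
  rw [tensorForm_apply, toFun_adM, eta_adM]
  refine GradedDouble.ext ?_ ?_ <;> simp [genM, covM, sub_eq_neg_add]

lemma tensorForm_adJ (A : OneForm (gradedG2 n θ)) :
    (tensorForm A).toFun (adJ n θ) = (-Complex.I) • .mk 0 (covJ A) := by
  rw [tensorForm_apply, toFun_adJ, eta_adJ]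
  refine GradedDouble.ext ?_ ?_ <;> simp [genJ, covJ, sub_eq_neg_add]

lemma genT_eq (μ : Idx n) : genT n θ μ = Complex.I • .mk (xi n θ μ) 0 :=
  GradedDouble.ext rfl (smul_zero _).symm

lemma genU_eq (μ : Idx n) : genU n θ μ = Complex.I • .mk 0 (xi n θ μ) :=
  GradedDouble.ext (smul_zero _).symm rfl

lemma genM_eq (μ ν : Idx n) : genM n θ μ ν = Complex.I • .mk (xiSq n θ μ ν) 0 :=
  GradedDouble.ext rfl (smul_zero _).symm

lemma genJ_eq : genJ n θ = Complex.I • .mk 0 1 :=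
  GradedDouble.ext (smul_zero _).symm rfl

/-- If `[a, b]_• = c + k`, where `η` fixes `a`, `b` and `c`, then the curvature is
`F (Ad_a, Ad_b) = [𝒜 (Ad_a), 𝒜 (Ad_b)]_• - 𝒜 (Ad_c) - k`. -/
lemma curvature_eq (A : OneForm (gradedG2 n θ)) {α β γ : ZMod 2} (hγ : α + β = γ)
    {a b c : GradedMoyal n θ} {k : ℂ} {X : (gradedG2 n θ).carrier α}
    {Y : (gradedG2 n θ).carrier β} {Z : (gradedG2 n θ).carrier γ}
    (hX : X.1 = Ad a) (hY : Y.1 = Ad b) (hZ : Z.1 = Ad c)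
    (ha : (eta n θ).toFun X = a) (hb : (eta n θ).toFun Y = b) (hc : (eta n θ).toFun Z = c)
    (h : gradedBracket a b = c + k • 1) :
    (connectionForm A).curvature X Y =
      gradedBracket ((tensorForm A).toFun X) ((tensorForm A).toFun Y) -
        (tensorForm A).toFun Z - k • 1 := by
  -- Homogeneity of `a` and `b` need not be assumed: they are values of the 1-form `η`, which
  -- preserves degrees.
  have ha' : a ∈ homogeneous _ α := ha ▸ (eta n θ).mem X
  have hb' : b ∈ homogeneous _ β := hb ▸ (eta n θ).mem Y
  have hω : ∀ {δ : ZMod 2} (W : (gradedG2 n θ).carrier δ),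
      (tensorForm A).toFun W = (connectionForm A).toFun W + (eta n θ).toFun W := fun W => rfl
  -- The derivations `Ad_{[a,b]}` and `Ad_c` coincide because the scalar `k` is central, so `ω`
  -- takes the same value on them. The constant is thereby lost in `ω([X, Y])`, while it is still
  -- present in `[a, b]`.
  have hbr : (connectionForm A).toFun ((gradedG2 n θ).bracket X Y) =
      (connectionForm A).toFun Z := by
    refine OneForm.toFun_congr _ hγ ?_
    change gradedCommutator α β X.1 Y.1 = _
    rw [hX, hY, hZ, gradedCommutator_Ad ha' hb', h, Ad_add_smul_one]
  -- Graded antisymmetry: up to sign this is the bracket of `ω(X)` with `b`, one of the cross terms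
  -- in `[ω(X) + a, ω(Y) + b]`.
  have hYX : gradedSign α β • Ad b ((connectionForm A).toFun X) =
      gradedSign α β • (b * (connectionForm A).toFun X) - (connectionForm A).toFun X * b := by
    rw [Ad_apply, gradedBracket_homogeneous hb' ((connectionForm A).mem X), smul_sub, smul_smul,
      gradedSign_mul_swap, one_smul]
  -- Both sides are expanded into products of `a`, `b`, `ω(X)` and `ω(Y)`. The right-hand side
  -- contains the extra bracket `[a, b]`; substituting `c = [a, b] - k` in `𝒜(Z) = ω(Z) + c` cancels
  -- it together with `k`.
  rw [OneForm.curvature, OneForm.d, OneForm.prod, hX, hY, hYX, hbr, Ad_apply,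
    gradedBracket_homogeneous ha' ((connectionForm A).mem Y),
    gradedBracket_homogeneous ((tensorForm A).mem X) ((tensorForm A).mem Y), hω X, hω Y, hω Z,
    ha, hb, hc, eq_sub_of_add_eq h.symm, gradedBracket_homogeneous ha' hb']
  simp only [mul_add, add_mul, smul_add]
  abel

end Covariant

/-! ### The ten components of the curvature -/

section Components

variable {n : ℕ} {θ : ℝ} [NeZero θ]

/-- The bracket of `T_μ` and `T_ν` is the scalar `iΘ⁻¹_{μν}`, so the derivations commute although
the elements do not. Here `c = 0`, and the whole bracket is the constant `k`. -/
lemma curvature_adT_adT (A : OneForm (gradedG2 n θ)) (μ ν : Idx n) :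
    (connectionForm A).curvature (adT n θ μ) (adT n θ ν) =
      .mk (-(covT A μ * covT A ν - covT A ν * covT A μ) - (Complex.I * thetaInv n θ μ ν) • 1) 0 := by
  have h : gradedBracket (genT n θ μ) (genT n θ ν) =
      0 + (Complex.I * thetaInv n θ μ ν : ℂ) • 1 := by
    simp only [genT_eq, gradedBracket_smul_even_even, Complex.I_mul_I]
    refine GradedDouble.ext ?_ ?_ <;>
      simp only [fst_add, snd_add, fst_smul, snd_smul, fst_one, snd_one, fst_zero, snd_zero]
    · rw [xi_mul_xi_sub (θ := θ) μ ν]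
      module
    · module
  rw [curvature_eq A (γ := 0)
      -- With `c = 0` the zero derivation represents the bracket, and the term `𝒜(Z)` disappears.
      (Z := 0) (by decide)
      rfl rfl ((map_zero Ad).symm) (eta_adT μ) (eta_adT ν)
      (map_zero _) h]
  simp only [tensorForm_adT, map_zero, gradedBracket_smul_even_even, neg_mul_neg, Complex.I_mul_I]
  refine GradedDouble.ext ?_ ?_ <;>
    simp only [fst_add, snd_add, fst_sub, snd_sub, fst_smul, snd_smul, fst_one, snd_one, fst_zero,
      snd_zero]
  · module
  · module

/-- Two odd elements have an anticommutator as bracket, and the anticommutator of the `ξ` is twice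
their pointwise product. Hence `[U_μ, U_ν] = -2(ξ_μ ξ_ν, 0) = 2i M_{μν}`: closing the bracket of the
`U` requires quadratic generators. -/
lemma curvature_adU_adU (A : OneForm (gradedG2 n θ)) (μ ν : Idx n) :
    (connectionForm A).curvature (adU n θ μ) (adU n θ ν) =
      .mk (-(covU A μ * covU A ν + covU A ν * covU A μ) - (2 : ℂ) • covM A μ ν) 0 := by
  have h : gradedBracket (genU n θ μ) (genU n θ ν) =
      (2 * Complex.I) • genM n θ μ ν + (0 : ℂ) • 1 := by
    simp only [genM_eq, genU_eq, gradedBracket_smul_odd_odd, Complex.I_mul_I]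
    refine GradedDouble.ext ?_ ?_ <;>
      simp only [fst_add, snd_add, fst_smul, snd_smul, fst_one, snd_one, fst_zero, snd_zero]
    · rw [xiSq_eq (θ := θ) μ ν]
      match_scalars <;> first | ring1 | linear_combination -Complex.I_mul_I
    · module
  rw [curvature_eq A (γ := 0)
      (Z := (2 * Complex.I) • adM n θ μ ν) (by decide)
      rfl rfl (by simp only [map_add, map_smul]; rfl) (eta_adU μ) (eta_adU ν)
      (by simp only [map_add, map_smul, eta_adM]) h]
  simp only [tensorForm_adM, tensorForm_adU, map_add, map_smul, gradedBracket_smul_odd_odd, neg_mul_neg, Complex.I_mul_I]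
  refine GradedDouble.ext ?_ ?_ <;>
    simp only [fst_add, snd_add, fst_sub, snd_sub, fst_smul, snd_smul, fst_one, snd_one, fst_zero,
      snd_zero]
  -- The same relation for `-(2i)(-i) = -2`, the coefficient of the covariant coordinate.
  · match_scalars <;> first | ring1 | linear_combination 2 * Complex.I_mul_I
  · module

/-- The odd element `J` does not commute with itself in the graded sense: `[J, J] = 2J² = -2`, a
scalar. It is the second and last component with a constant term. -/
lemma curvature_adJ_adJ (A : OneForm (gradedG2 n θ)) :
    (connectionForm A).curvature (adJ n θ) (adJ n θ) =
      .mk (-((2 : ℂ) • (covJ A * covJ A)) + (2 : ℂ) • 1) 0 := by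
  have h : gradedBracket (genJ n θ) (genJ n θ) =
      0 + (-2 : ℂ) • 1 := by
    simp only [genJ_eq, gradedBracket_smul_odd_odd, Complex.I_mul_I]
    refine GradedDouble.ext ?_ ?_ <;>
      simp only [fst_add, snd_add, fst_smul, snd_smul, fst_one, snd_one, fst_zero, snd_zero,
        mul_one, one_mul]
    · module
    · module
  rw [curvature_eq A (γ := 0)
      (Z := 0) (by decide)
      rfl rfl ((map_zero Ad).symm) eta_adJ eta_adJ
      (map_zero _) h]
  simp only [tensorForm_adJ, map_zero, gradedBracket_smul_odd_odd, neg_mul_neg, Complex.I_mul_I]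
  refine GradedDouble.ext ?_ ?_ <;>
    simp only [fst_add, snd_add, fst_sub, snd_sub, fst_smul, snd_smul, fst_one, snd_one, fst_zero,
      snd_zero]
  · module
  · module

/-- Against an even element the bracket with `J` is an ordinary commutator with a multiple of the
unit, so both `c` and `k` vanish. -/
lemma curvature_adT_adJ (A : OneForm (gradedG2 n θ)) (μ : Idx n) :
    (connectionForm A).curvature (adT n θ μ) (adJ n θ) =
      .mk 0 (-(covT A μ * covJ A - covJ A * covT A μ)) := by
  have h : gradedBracket (genT n θ μ) (genJ n θ) =
      0 + (0 : ℂ) • 1 := by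
    simp only [genJ_eq, genT_eq, gradedBracket_smul_even_odd, Complex.I_mul_I]
    refine GradedDouble.ext ?_ ?_ <;>
      simp only [fst_add, snd_add, fst_smul, snd_smul, fst_one, snd_one, fst_zero, snd_zero,
        mul_one, one_mul]
    · module
    · module
  rw [curvature_eq A (γ := 1)
      (Z := 0) (by decide)
      rfl rfl ((map_zero Ad).symm) (eta_adT μ) eta_adJ
      (map_zero _) h]
  simp only [tensorForm_adJ, tensorForm_adT, map_zero, gradedBracket_smul_even_odd, neg_mul_neg, Complex.I_mul_I]
  refine GradedDouble.ext ?_ ?_ <;>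
    simp only [fst_add, snd_add, fst_sub, snd_sub, fst_smul, snd_smul, fst_one, snd_one, fst_zero,
      snd_zero]
  · module
  · module

/-- Here the bracket is an anticommutator with a multiple of the unit and doubles instead of
vanishing: `[U_μ, J] = -2(ξ_μ, 0) = 2i T_μ`. -/
lemma curvature_adU_adJ (A : OneForm (gradedG2 n θ)) (μ : Idx n) :
    (connectionForm A).curvature (adU n θ μ) (adJ n θ) =
      .mk (-(covU A μ * covJ A + covJ A * covU A μ) - (2 : ℂ) • covT A μ) 0 := by
  have h : gradedBracket (genU n θ μ) (genJ n θ) =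
      (2 * Complex.I) • genT n θ μ + (0 : ℂ) • 1 := by
    simp only [genJ_eq, genT_eq, genU_eq, gradedBracket_smul_odd_odd, Complex.I_mul_I]
    refine GradedDouble.ext ?_ ?_ <;>
      simp only [fst_add, snd_add, fst_smul, snd_smul, fst_one, snd_one, fst_zero, snd_zero,
        mul_one, one_mul]
    · match_scalars <;> first | ring1 | linear_combination -2 * Complex.I_mul_I
    · module
  rw [curvature_eq A (γ := 0)
      (Z := (2 * Complex.I) • adT n θ μ) (by decide)
      rfl rfl (by simp only [map_add, map_smul]; rfl) (eta_adU μ) eta_adJ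
      (by simp only [map_add, map_smul, eta_adT]) h]
  simp only [tensorForm_adJ, tensorForm_adT, tensorForm_adU, map_add, map_smul, gradedBracket_smul_odd_odd, neg_mul_neg, Complex.I_mul_I]
  refine GradedDouble.ext ?_ ?_ <;>
    simp only [fst_add, snd_add, fst_sub, snd_sub, fst_smul, snd_smul, fst_one, snd_one, fst_zero,
      snd_zero]
  -- As before, `-(2i)(-i) = -2`.
  · match_scalars <;> first | ring1 | linear_combination 2 * Complex.I_mul_I
  · module

/-- The even quadratic element commutes with the unit in the odd component, so the bracket is zero.
-/
lemma curvature_adM_adJ (A : OneForm (gradedG2 n θ)) (μ ν : Idx n) :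
    (connectionForm A).curvature (adM n θ μ ν) (adJ n θ) =
      .mk 0 (-(covM A μ ν * covJ A - covJ A * covM A μ ν)) := by
  have h : gradedBracket (genM n θ μ ν) (genJ n θ) =
      0 + (0 : ℂ) • 1 := by
    simp only [genJ_eq, genM_eq, gradedBracket_smul_even_odd, Complex.I_mul_I]
    refine GradedDouble.ext ?_ ?_ <;>
      simp only [fst_add, snd_add, fst_smul, snd_smul, fst_one, snd_one, fst_zero, snd_zero,
        mul_one, one_mul]
    · module
    · module
  rw [curvature_eq A (γ := 1)
      (Z := 0) (by decide)
      rfl rfl ((map_zero Ad).symm) (eta_adM μ ν) eta_adJ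
      (map_zero _) h]
  simp only [tensorForm_adJ, tensorForm_adM, map_zero, gradedBracket_smul_even_odd, neg_mul_neg, Complex.I_mul_I]
  refine GradedDouble.ext ?_ ?_ <;>
    simp only [fst_add, snd_add, fst_sub, snd_sub, fst_smul, snd_smul, fst_one, snd_one, fst_zero,
      snd_zero]
  · module
  · module

/-- The scalar `iΘ⁻¹_{μν}` known from `[T_μ, T_ν]` now lies in the odd component, where it is the
multiple `Θ⁻¹_{μν} J` of a generator. It therefore enters through `𝒜(Ad_J)`, as a coefficient of
`Φ`, and not as a constant. -/
lemma curvature_adT_adU (A : OneForm (gradedG2 n θ)) (μ ν : Idx n) :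
    (connectionForm A).curvature (adT n θ μ) (adU n θ ν) =
      .mk 0 (-(covT A μ * covU A ν - covU A ν * covT A μ) +
        (Complex.I * thetaInv n θ μ ν) • covJ A) := by
  have h : gradedBracket (genT n θ μ) (genU n θ ν) =
      thetaInv n θ μ ν • genJ n θ + (0 : ℂ) • 1 := by
    simp only [genJ_eq, genT_eq, genU_eq, gradedBracket_smul_even_odd, Complex.I_mul_I]
    refine GradedDouble.ext ?_ ?_ <;>
      simp only [fst_add, snd_add, fst_smul, snd_smul, fst_one, snd_one, fst_zero, snd_zero]
    · module
    · rw [xi_mul_xi_sub (θ := θ) μ ν]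
      module
  rw [curvature_eq A (γ := 1)
      (Z := thetaInv n θ μ ν • adJ n θ) (by decide)
      rfl rfl (by simp only [map_add, map_smul]; rfl) (eta_adT μ) (eta_adU ν)
      (by simp only [map_add, map_smul, eta_adJ]) h]
  simp only [tensorForm_adJ, tensorForm_adT, tensorForm_adU, map_add, map_smul, gradedBracket_smul_even_odd, neg_mul_neg, Complex.I_mul_I]
  refine GradedDouble.ext ?_ ?_ <;>
    simp only [fst_add, snd_add, fst_sub, snd_sub, fst_smul, snd_smul, fst_one, snd_one, fst_zero,
      snd_zero]
  · module
  · module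

/-- By `xiSq_mul_xi_sub` the bracket with `M_{μν}` maps the span of the `T` to itself, with
coefficients from `Θ⁻¹` and no constant term. -/
lemma curvature_adM_adT (A : OneForm (gradedG2 n θ)) (μ ν ρ : Idx n) :
    (connectionForm A).curvature (adM n θ μ ν) (adT n θ ρ) =
      .mk (-(covM A μ ν * covT A ρ - covT A ρ * covM A μ ν) +
        (Complex.I * thetaInv n θ ν ρ) • covT A μ + (Complex.I * thetaInv n θ μ ρ) • covT A ν) 0 := by
  have h : gradedBracket (genM n θ μ ν) (genT n θ ρ) =
      thetaInv n θ ν ρ • genT n θ μ +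
        thetaInv n θ μ ρ • genT n θ ν + (0 : ℂ) • 1 := by
    simp only [genM_eq, genT_eq, gradedBracket_smul_even_even, Complex.I_mul_I]
    refine GradedDouble.ext ?_ ?_ <;>
      simp only [fst_add, snd_add, fst_smul, snd_smul, fst_one, snd_one, fst_zero, snd_zero]
    · rw [xiSq_mul_xi_sub (θ := θ) μ ν ρ]
      module
    · module
  rw [curvature_eq A (γ := 0)
      (Z := thetaInv n θ ν ρ • adT n θ μ +
        thetaInv n θ μ ρ • adT n θ ν) (by decide)
      rfl rfl (by simp only [map_add, map_smul]; rfl) (eta_adM μ ν) (eta_adT ρ)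
      (by simp only [map_add, map_smul, eta_adT]) h]
  simp only [tensorForm_adM, tensorForm_adT, map_add, map_smul, gradedBracket_smul_even_even, neg_mul_neg, Complex.I_mul_I]
  refine GradedDouble.ext ?_ ?_ <;>
    simp only [fst_add, snd_add, fst_sub, snd_sub, fst_smul, snd_smul, fst_one, snd_one, fst_zero,
      snd_zero]
  · module
  · module

/-- `M_{μν}` is even, so it acts on the odd component by the same commutator as on the even one. The
structure constants are those of its action on the `T`. -/
lemma curvature_adM_adU (A : OneForm (gradedG2 n θ)) (μ ν ρ : Idx n) :
    (connectionForm A).curvature (adM n θ μ ν) (adU n θ ρ) =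
      .mk 0 (-(covM A μ ν * covU A ρ - covU A ρ * covM A μ ν) +
        (Complex.I * thetaInv n θ ν ρ) • covU A μ + (Complex.I * thetaInv n θ μ ρ) • covU A ν) := by
  have h : gradedBracket (genM n θ μ ν) (genU n θ ρ) =
      thetaInv n θ ν ρ • genU n θ μ +
        thetaInv n θ μ ρ • genU n θ ν + (0 : ℂ) • 1 := by
    simp only [genM_eq, genU_eq, gradedBracket_smul_even_odd, Complex.I_mul_I]
    refine GradedDouble.ext ?_ ?_ <;>
      simp only [fst_add, snd_add, fst_smul, snd_smul, fst_one, snd_one, fst_zero, snd_zero]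
    · module
    · rw [xiSq_mul_xi_sub (θ := θ) μ ν ρ]
      module
  rw [curvature_eq A (γ := 1)
      (Z := thetaInv n θ ν ρ • adU n θ μ +
        thetaInv n θ μ ρ • adU n θ ν) (by decide)
      rfl rfl (by simp only [map_add, map_smul]; rfl) (eta_adM μ ν) (eta_adU ρ)
      (by simp only [map_add, map_smul, eta_adU]) h]
  simp only [tensorForm_adM, tensorForm_adU, map_add, map_smul, gradedBracket_smul_even_odd, neg_mul_neg, Complex.I_mul_I]
  refine GradedDouble.ext ?_ ?_ <;>
    simp only [fst_add, snd_add, fst_sub, snd_sub, fst_smul, snd_smul, fst_one, snd_one, fst_zero,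
      snd_zero]
  · module
  · module

/-- The `M` close among themselves by `xiSq_mul_xiSq_sub`. Because they stand for pointwise
products, that is, symmetrised ones, reordering leaves no scalar and `k = 0`. -/
lemma curvature_adM_adM (A : OneForm (gradedG2 n θ)) (μ ν ρ σ : Idx n) :
    (connectionForm A).curvature (adM n θ μ ν) (adM n θ ρ σ) =
      .mk (-(covM A μ ν * covM A ρ σ - covM A ρ σ * covM A μ ν) +
        Complex.I • (thetaInv n θ ν σ • covM A μ ρ + thetaInv n θ ν ρ • covM A μ σ +
          thetaInv n θ μ σ • covM A ν ρ + thetaInv n θ μ ρ • covM A ν σ)) 0 := by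
  have h : gradedBracket (genM n θ μ ν) (genM n θ ρ σ) =
      thetaInv n θ ν σ • genM n θ μ ρ +
        thetaInv n θ ν ρ • genM n θ μ σ +
        thetaInv n θ μ σ • genM n θ ν ρ +
        thetaInv n θ μ ρ • genM n θ ν σ + (0 : ℂ) • 1 := by
    simp only [genM_eq, gradedBracket_smul_even_even, Complex.I_mul_I]
    refine GradedDouble.ext ?_ ?_ <;>
      simp only [fst_add, snd_add, fst_smul, snd_smul, fst_one, snd_one, fst_zero, snd_zero]
    · rw [xiSq_mul_xiSq_sub (θ := θ) μ ν ρ σ]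
      module
    · module
  rw [curvature_eq A (γ := 0)
      (Z := thetaInv n θ ν σ • adM n θ μ ρ +
        thetaInv n θ ν ρ • adM n θ μ σ +
        thetaInv n θ μ σ • adM n θ ν ρ +
        thetaInv n θ μ ρ • adM n θ ν σ) (by decide)
      rfl rfl (by simp only [map_add, map_smul]; rfl) (eta_adM μ ν) (eta_adM ρ σ)
      (by simp only [map_add, map_smul, eta_adM]) h]
  simp only [tensorForm_adM, map_add, map_smul, gradedBracket_smul_even_even, neg_mul_neg, Complex.I_mul_I]
  refine GradedDouble.ext ?_ ?_ <;>
    simp only [fst_add, snd_add, fst_sub, snd_sub, fst_smul, snd_smul, fst_one, snd_one, fst_zero,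
      snd_zero]
  · module
  · module

end Components
end Moyal

/-! ### The curvature identity and all components together -/

theorem mainTheorem11 (n : ℕ) (θ : ℝ) [NeZero θ] (A : OneForm (gradedG2 n θ)) :
    -- the curvature is the one of the connection with 1-form connection `-i A`
    (∀ {α β : ZMod 2} (X : (gradedG2 n θ).carrier α) (Y : (gradedG2 n θ).carrier β),
      gradedCommutator α β ((connectionForm A).nabla X) ((connectionForm A).nabla Y) -
          (connectionForm A).nabla ((gradedG2 n θ).bracket X Y) =
        LinearMap.mulLeft ℂ ((connectionForm A).curvature X Y)) ∧
    -- the components of `A`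
    (∀ μ, A.toFun (adT n θ μ) = .mk (compT A μ) 0) ∧
    (∀ μ, A.toFun (adU n θ μ) = .mk 0 (compU A μ)) ∧
    (∀ μ ν, A.toFun (adM n θ μ ν) = .mk (compM A μ ν) 0) ∧
    A.toFun (adJ n θ) = .mk 0 (compJ A) ∧
    -- the components of the tensor 1-form
    (∀ μ, (tensorForm A).toFun (adT n θ μ) = (-Complex.I) • .mk (covT A μ) 0) ∧
    (∀ μ, (tensorForm A).toFun (adU n θ μ) = (-Complex.I) • .mk 0 (covU A μ)) ∧
    (∀ μ ν, (tensorForm A).toFun (adM n θ μ ν) = (-Complex.I) • .mk (covM A μ ν) 0) ∧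
    (tensorForm A).toFun (adJ n θ) = (-Complex.I) • .mk 0 (covJ A) ∧
    -- the components of the curvature
    (∀ μ ν, (connectionForm A).curvature (adT n θ μ) (adT n θ ν) =
      .mk (-(covT A μ * covT A ν - covT A ν * covT A μ) - (Complex.I * thetaInv n θ μ ν) • 1) 0) ∧
    (∀ μ ν, (connectionForm A).curvature (adU n θ μ) (adU n θ ν) =
      .mk (-(covU A μ * covU A ν + covU A ν * covU A μ) - (2 : ℂ) • covM A μ ν) 0) ∧
    (connectionForm A).curvature (adJ n θ) (adJ n θ) =
      .mk (-((2 : ℂ) • (covJ A * covJ A)) + (2 : ℂ) • 1) 0 ∧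
    (∀ μ, (connectionForm A).curvature (adT n θ μ) (adJ n θ) =
      .mk 0 (-(covT A μ * covJ A - covJ A * covT A μ))) ∧
    (∀ μ, (connectionForm A).curvature (adU n θ μ) (adJ n θ) =
      .mk (-(covU A μ * covJ A + covJ A * covU A μ) - (2 : ℂ) • covT A μ) 0) ∧
    (∀ μ ν, (connectionForm A).curvature (adM n θ μ ν) (adJ n θ) =
      .mk 0 (-(covM A μ ν * covJ A - covJ A * covM A μ ν))) ∧
    (∀ μ ν, (connectionForm A).curvature (adT n θ μ) (adU n θ ν) =
      .mk 0 (-(covT A μ * covU A ν - covU A ν * covT A μ) +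
        (Complex.I * thetaInv n θ μ ν) • covJ A)) ∧
    (∀ μ ν ρ, (connectionForm A).curvature (adM n θ μ ν) (adT n θ ρ) =
      .mk (-(covM A μ ν * covT A ρ - covT A ρ * covM A μ ν) +
        (Complex.I * thetaInv n θ ν ρ) • covT A μ + (Complex.I * thetaInv n θ μ ρ) • covT A ν) 0) ∧
    (∀ μ ν ρ, (connectionForm A).curvature (adM n θ μ ν) (adU n θ ρ) =
      .mk 0 (-(covM A μ ν * covU A ρ - covU A ρ * covM A μ ν) +
        (Complex.I * thetaInv n θ ν ρ) • covU A μ + (Complex.I * thetaInv n θ μ ρ) • covU A ν)) ∧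
    (∀ μ ν ρ σ, (connectionForm A).curvature (adM n θ μ ν) (adM n θ ρ σ) =
      .mk (-(covM A μ ν * covM A ρ σ - covM A ρ σ * covM A μ ν) +
        Complex.I • (thetaInv n θ ν σ • covM A μ ρ + thetaInv n θ ν ρ • covM A μ σ +
          thetaInv n θ μ σ • covM A ν ρ + thetaInv n θ μ ρ • covM A ν σ)) 0) :=
  ⟨fun X Y => (connectionForm A).gradedCommutator_nabla_sub X Y, toFun_adT A, toFun_adU A,
    toFun_adM A, toFun_adJ A, tensorForm_adT A, tensorForm_adU A, tensorForm_adM A,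
    tensorForm_adJ A, curvature_adT_adT A, curvature_adU_adU A, curvature_adJ_adJ A,
    curvature_adT_adJ A, curvature_adU_adJ A, curvature_adM_adJ A, curvature_adT_adU A,
    curvature_adM_adT A, curvature_adM_adU A, curvature_adM_adM A⟩
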